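/- Let $\mathbb D=\{|z|<1\}$, let $\Omega\subset\mathbb C$ be a convex domain with $1\in\Omega$, and let $P$ be a conformal map of $\mathbb D$ onto $\Omega$ with $P(z)=1+\alpha_1z+\alpha_2z^2+\cdots$. Let $\mathcal{CV}(\Omega)$ be the class of analytic functions $f$ in $\mathbb D$ with $f(0)=0$, $f'(0)=1$, $f'\neq0$ in $\mathbb D$ and $1+zf''(z)/f'(z)\in\Omega$ for all $z\in\mathbb D$. Write $a_k(f)=f^{(k)}(0)/k!$, let $\log f'$ be the analytic branch in $\mathbb D$ with $\log f'(0)=0$, and put $\mathcal A(3,\Omega)=\{(a_2(f),a_3(f)):f\in\mathcal{CV}(\Omega)\}\subset\mathbb C^2$ and $\sigma_a(z)=(z+a)/(1+\overline a z)$. For $(\lambda,\mu)\in\mathbb C^2$ let $\gamma_1=2\lambda/\alpha_1$ and $$\gamma_2=\begin{cases}\dfrac{2\overline{\alpha_1}\{3\alpha_1^2\mu-2(\alpha_1^2+\alpha_2)\lambda^2\}}{\alpha_1^2(|\alpha_1|^2-4|\lambda|^2)} & \text{if } |\gamma_1|<1,\\[2mm] 0 & \text{if } |\gamma_1|=1 \text{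 and } 3\alpha_1^2\mu=2(\alpha_1^2+\alpha_2)\lambda^2,\\ \infty & \text{otherwise.}\end{cases}$$ Then $(\lambda,\mu)\in\partial\mathcal A(3,\Omega)$ if and only if either $|\gamma_1|=1$ and $\gamma_2=0$, or $|\gamma_1|<1$ and $|\gamma_2|=1$; and $(\lambda,\mu)\in\operatorname{Int}\mathcal A(3,\Omega)$ if and only if $|\gamma_1|<1$ and $|\gamma_2|<1$. Moreover, for $z_0\in\mathbb D\setminus\{0\}$ let $$V(z_0,\lambda,\mu)=\{\log f'(z_0): f\in\mathcal{CV}(\Omega),\ (a_2(f),a_3(f))=(\lambda,\mu)\}.$$ (i) If $|\gamma_1|=1$ and $\gamma_2=0$, then $V(z_0,\lambda,\mu)=\left\{\int_0^{z_0}\zeta^{-1}\{P(\gamma_1\zeta)-1\}\,d\zeta\right\}$. (ii) If $|\gamma_1|<1$ and $|\gamma_2|=1$, then $V(z_0,\lambda,\mu)=\left\{\int_0^{z_0}\zeta^{-1}\{P(\zeta\sigma_{\gamma_1}(\gamma_2\zeta))-1\}\,d\zeta\right\}$. (iii) If $|\gamma_1|<1$ and $|\gamma_2|<1$, put $$Q_{\gamma_1,\gamma_2}(z,\varepsilon)=\int_0^{z}\zeta^{-1}\{P(\zeta\sigma_{\gamma_1}(\zeta\sigma_{\gamma_2}(\varepsilon\zeta)))-1\}\,d\zeta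 .$$ Then $\varepsilon\mapsto Q_{\gamma_1,\gamma_2}(z_0,\varepsilon)$ is a convex univalent analytic function on $\overline{\mathbb D}$ (analytic in a neighbourhood of $\overline{\mathbb D}$, injective on $\overline{\mathbb D}$, and mapping $\mathbb D$ and $\overline{\mathbb D}$ onto convex sets), and $V(z_0,\lambda,\mu)=Q_{\gamma_1,\gamma_2}(z_0,\overline{\mathbb D})$. Furthermore, for every $\varepsilon$ with $|\varepsilon|=1$ and every function $f$ on $\mathbb D$, one has $f\in\mathcal{CV}(\Omega)$, $(a_2(f),a_3(f))=(\lambda,\mu)$ and $\log f'(z_0)=Q_{\gamma_1,\gamma_2}(z_0,\varepsilon)$ if and only if $$f(z)=\int_0^z\exp\{Q_{\gamma_1,\gamma_2}(\zeta,\varepsilon)\}\,d\zeta\qquad(z\in\mathbb D).$$ -/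

import Mathlib

open Set Metric

noncomputable section

namespace VariabilityRegion

/-- The `k`-th Taylor coefficient `f⁽ᵏ⁾(0) / k!` of `f` at the origin. -/
def coeff (f : ℂ → ℂ) (k : ℕ) : ℂ := iteratedDeriv k f 0 / (k.factorial : ℂ)

/-- `P` maps the open unit disk conformally (holomorphically and bijectively) onto `Ω`. -/
def IsConformalMap (P : ℂ → ℂ) (Ω : Set ℂ) : Prop :=
  DifferentiableOn ℂ P (ball 0 1) ∧ BijOn P (ball 0 1) Ω

/-- The class `CV(Ω)`: functions `f` analytic in the unit disk with `f(0) = 0`, `f'(0) = 1` and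
`1 + z f''(z) / f'(z) ∈ Ω` for all `z` in the disk. Where `f'` vanishes the quotient has a pole,
so that it has no value in `Ω`; hence the explicit clause `f'(z) ≠ 0`. -/
def CV (Ω : Set ℂ) : Set (ℂ → ℂ) :=
  {f | DifferentiableOn ℂ f (ball 0 1) ∧ f 0 = 0 ∧ deriv f 0 = 1 ∧
    ∀ z ∈ ball (0 : ℂ) 1, deriv f z ≠ 0 ∧ 1 + z * deriv (deriv f) z / deriv f z ∈ Ω}

/-- `w` is the value at `z` of the single-valued analytic branch `L` of `log f'` in the unit disk
that is normalized by `L(0) = 0`. -/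
def IsLogDerivValue (f : ℂ → ℂ) (z w : ℂ) : Prop :=
  ∃ L : ℂ → ℂ, DifferentiableOn ℂ L (ball 0 1) ∧ L 0 = 0 ∧
    (∀ ζ ∈ ball (0 : ℂ) 1, Complex.exp (L ζ) = deriv f ζ) ∧ L z = w

/-- The coefficient region `{(a₂(f), a₃(f)) : f ∈ CV(Ω)}`. -/
def coeffRegion (Ω : Set ℂ) : Set (ℂ × ℂ) :=
  {p | ∃ f ∈ CV Ω, (coeff f 2, coeff f 3) = p}

/-- The variability region of `log f'(z₀)` for `f ∈ CV(Ω)` with `(a₂(f), a₃(f)) = (lam, mu)`. -/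
def region (Ω : Set ℂ) (z₀ lam mu : ℂ) : Set ℂ :=
  {w | ∃ f ∈ CV Ω, (coeff f 2, coeff f 3) = (lam, mu) ∧ IsLogDerivValue f z₀ w}

/-- The first Schur parameter `γ₁ = 2 lam / α₁`, where `P(z) = 1 + α₁ z + α₂ z² + ⋯`. -/
def gamma₁ (P : ℂ → ℂ) (lam : ℂ) : ℂ := 2 * lam / coeff P 1

open Classical in
/-- The second Schur parameter, a complex number or `∞`. For `|γ₁| > 1`, where it is not needed,
it is given the value `∞`. -/
def gamma₂ (P : ℂ → ℂ) (lam mu : ℂ) : OnePoint ℂ :=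
  if ‖gamma₁ P lam‖ < 1 then
    ((2 * (starRingEnd ℂ) (coeff P 1) *
        (3 * coeff P 1 ^ 2 * mu - 2 * (coeff P 1 ^ 2 + coeff P 2) * lam ^ 2) /
      (coeff P 1 ^ 2 * ((‖coeff P 1‖ ^ 2 - 4 * ‖lam‖ ^ 2 : ℝ) : ℂ)) : ℂ) : OnePoint ℂ)
  else if ‖gamma₁ P lam‖ = 1 ∧
      3 * coeff P 1 ^ 2 * mu = 2 * (coeff P 1 ^ 2 + coeff P 2) * lam ^ 2 then
    ((0 : ℂ) : OnePoint ℂ)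
  else OnePoint.infty

/-- The disk automorphism `σ_a(z) = (z + a) / (1 + ā z)`. -/
def sigma (a z : ℂ) : ℂ := (z + a) / (1 + (starRingEnd ℂ) a * z)

/-- The integral `∫₀ᶻ F(ζ) dζ` along the segment from `0` to `z`. -/
def integralTo (F : ℂ → ℂ) (z : ℂ) : ℂ := z * ∫ t in (0 : ℝ)..1, F (t * z)

/-- `∫₀ᶻ ζ⁻¹ (P(ω(ζ)) - 1) dζ`. -/
def logIntegral (P ω : ℂ → ℂ) (z : ℂ) : ℂ := integralTo (fun ζ => ζ⁻¹ * (P (ω ζ) - 1)) z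

/-- `Q_{γ₁,γ₂}(z, ε) = ∫₀ᶻ ζ⁻¹ (P(ζ σ_{γ₁}(ζ σ_{γ₂}(ε ζ))) - 1) dζ`. -/
def Q (P : ℂ → ℂ) (γ₁ γ₂ z ε : ℂ) : ℂ :=
  logIntegral P (fun ζ => ζ * sigma γ₁ (ζ * sigma γ₂ (ε * ζ))) z

/-- `h` is a convex univalent analytic function on the closed unit disk: it is analytic in a
neighbourhood of the closed disk, injective on the closed disk, and maps both the open and the
closed disk onto convex sets. -/
def IsConvexUnivalent (h : ℂ → ℂ) : Prop :=
  AnalyticOnNhd ℂ h (closedBall 0 1) ∧ InjOn h (closedBall 0 1) ∧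
    Convex ℝ (h '' ball 0 1) ∧ Convex ℝ (h '' closedBall 0 1)

end VariabilityRegion

end

namespace VariabilityRegion

open Filter Topology MeasureTheory ComplexConjugate Interval

/-! The class is parametrized by Schur functions. Schwarz's lemma for P⁻¹(1 + z f''/f') gives 1 + z
f''/f' = P(z w(z)) with |w| ≤ 1, and conversely every such w generates a member f of CV(Ω), with log
f'(z) = ∫₀ᶻ ζ⁻¹ (P(ζ w(ζ)) - 1) dζ (`exists_isGeneratedBy`, `IsGeneratedBy.mem_CV`). Comparing
Taylor coefficients, (a₂, a₃) corresponds bijectively to (w(0), w'(0)), so the coefficient region is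
|w(0)|² + |w'(0)| ≤ 1 in other coordinates, and γ₁ = w(0), w'(0) = (1 - |γ₁|²) γ₂ when |γ₁| < 1. On
the boundary of the region the maximum principle leaves a single w. In the interior two Schur steps
give w(ζ) = σ_{γ₁}(ζ σ_{γ₂}(ζ ψ(ζ))) with ψ an arbitrary Schur function, and Q is the case of a
constant ψ = ε.

The heart is `re_logIntegral_sub_div_pos`: if |ψ| ≤ |ε| ≤ 1, ε ≠ 0 and ψ never equals ε, then N/D
has positive real part at z₀, where N(z) is the value of log f'(z) for the constant ε minus that for
ψ, and D = ε ∂Q/∂ε. For |ε| = 1 this supplies a supporting line of the region at Q(z₀, ε), met only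
by ψ = ε. Hence the image of the closed disk is an intersection of half-planes, which gives
convexity, the inclusion of all other values, and uniqueness at boundary points. Allowing |ε| < 1
gives injectivity.

The inequality N/D is derived from N'/D' by a Sakaguchi–Libera argument
(`re_weightedMean_div_weightedMean_pos`), which needs two facts. First, Re(N'/D') > 0. Here N'/D' =
(P(b) - P(a)) / (P'(b) A), where b and a are the values of ω(ζ) = ζ w(ζ) belonging to ε and ψ, and A
= ε ∂b/∂ε. A convex map sends hyperbolic disks, hence horodisks, to convex sets, so it is enough
that a lies in the horodisk through b with inner normal -A. That property survives multiplication by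
ζ and disk automorphisms, the two operations that build ω. Second, Re(1 + z D''/D') > 0, which is
the infinitesimal version of the same horodisk argument combined with the preSchwarzian bound for
convex maps. -/

/-! ### Holomorphic inverses of injective maps -/

/-- The open mapping theorem at `a`: the locally constant alternative contradicts injectivity, which
the left inverse provides. -/
lemma continuousAt_of_leftInverse {f R : ℂ → ℂ} {U : Set ℂ} (hU : IsOpen U)
    (hf : DifferentiableOn ℂ f U) (hR : ∀ z ∈ U, R (f z) = z) {a : ℂ} (ha : a ∈ U) :
    ContinuousAt R (f a) ∧ f '' U ∈ 𝓝 (f a) := by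
  have hinj : InjOn f U := fun x hx y hy h => by rw [← hR x hx, ← hR y hy, h]
  have han : AnalyticAt ℂ f a := hf.analyticAt (hU.mem_nhds ha)
  have hopen : 𝓝 (f a) ≤ map f (𝓝 a) := by
    refine han.eventually_constant_or_nhds_le_map_nhds.resolve_left fun hc => ?_
    have h1 : ∀ᶠ z in 𝓝[≠] a, f z = f a ∧ z ∈ U :=
      (hc.and (hU.mem_nhds ha)).filter_mono nhdsWithin_le_nhds
    obtain ⟨z, ⟨hz, hzU⟩, hne⟩ := (h1.and self_mem_nhdsWithin).exists
    exact hne (hinj hzU ha hz)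
  refine ⟨?_, hopen (image_mem_map (hU.mem_nhds ha))⟩
  rw [ContinuousAt, hR a ha]
  intro s hs
  have : f '' (s ∩ U) ∈ 𝓝 (f a) := hopen (image_mem_map (inter_mem hs (hU.mem_nhds ha)))
  refine mem_map.2 (mem_of_superset this ?_)
  rintro _ ⟨z, ⟨hzs, hzU⟩, rfl⟩
  simpa [hR z hzU] using hzs

lemma hasDerivAt_of_leftInverse {f R : ℂ → ℂ} {U : Set ℂ} (hU : IsOpen U)
    (hf : DifferentiableOn ℂ f U) (hR : ∀ z ∈ U, R (f z) = z) {a : ℂ} (ha : a ∈ U)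
    (hd : deriv f a ≠ 0) : HasDerivAt R (deriv f a)⁻¹ (f a) := by
  obtain ⟨hc, hn⟩ := continuousAt_of_leftInverse hU hf hR ha
  refine HasDerivAt.of_local_left_inverse hc (f := f) ?_ hd ?_
  · rw [hR a ha]
    exact (hf.differentiableAt (hU.mem_nhds ha)).hasDerivAt
  · filter_upwards [hn]
    rintro _ ⟨z, hz, rfl⟩
    rw [hR z hz]

/-- An injective holomorphic function has nonvanishing derivative. -/
lemma deriv_ne_zero_of_leftInverse {f R : ℂ → ℂ} {U : Set ℂ} (hU : IsOpen U)
    (hf : DifferentiableOn ℂ f U) (hR : ∀ z ∈ U, R (f z) = z) {a : ℂ} (ha : a ∈ U) :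
    deriv f a ≠ 0 := by
  intro h0
  have hinj : InjOn f U := fun x hx y hy h => by rw [← hR x hx, ← hR y hy, h]
  have hdan : AnalyticAt ℂ (deriv f) a := ((hf.analyticAt (hU.mem_nhds ha))).deriv
  rcases hdan.eventually_eq_zero_or_eventually_ne_zero with h | h
  · obtain ⟨r, hr, hball⟩ := Metric.mem_nhds_iff.1 (h.and (hU.mem_nhds ha))
    have hconst : ∀ z ∈ ball a r, f z = f a := fun z hz => by
      refine (convex_ball a r).is_const_of_fderivWithin_eq_zero (𝕜 := ℂ)
        (hf.mono fun x hx => (hball hx).2) (fun x hx => ?_) hz (mem_ball_self hr)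
      rw [fderivWithin_of_isOpen isOpen_ball hx]
      ext
      simpa using (hball hx).1
    have h1 : ∀ᶠ z in 𝓝[≠] a, z ∈ ball a r := nhdsWithin_le_nhds (ball_mem_nhds a hr)
    obtain ⟨z, hz, hne⟩ := (h1.and self_mem_nhdsWithin).exists
    exact hne (hinj (hball hz).2 ha (hconst z hz))
  -- The zero of `deriv f` is isolated, so `R` is holomorphic on a punctured neighbourhood of `f a`
  -- and continuous at `f a`. The singularity is removable, and the chain rule for `R ∘ f = id` at
  -- `a` contradicts `deriv f a = 0`.
  · obtain ⟨hc, hn⟩ := continuousAt_of_leftInverse hU hf hR ha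
    have hev : ∀ᶠ w in 𝓝[≠] (f a), DifferentiableAt ℂ R w := by
      have h1 : ∀ᶠ z in 𝓝 a, z ∈ U ∧ (z ≠ a → deriv f z ≠ 0) :=
        (hU.eventually_mem ha).and (eventually_nhdsWithin_iff.1 h)
      have h2 : ∀ᶠ w in 𝓝 (f a), R w ∈ U ∧ (R w ≠ a → deriv f (R w) ≠ 0) := by
        have := hc
        rw [ContinuousAt, hR a ha] at this
        exact this.eventually h1
      filter_upwards [nhdsWithin_le_nhds h2, nhdsWithin_le_nhds hn, self_mem_nhdsWithin]
      rintro _ hw ⟨z, hz, rfl⟩ hne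
      rw [hR z hz] at hw
      exact (hasDerivAt_of_leftInverse hU hf hR hz
        (hw.2 fun h => hne (by rw [h]; rfl))).differentiableAt
    have hRd : DifferentiableAt ℂ R (f a) :=
      (Complex.analyticAt_of_differentiable_on_punctured_nhds_of_continuousAt hev hc).differentiableAt
    have hfd : HasDerivAt f (deriv f a) a := (hf.differentiableAt (hU.mem_nhds ha)).hasDerivAt
    have h3 : HasDerivAt (fun z => R (f z)) (deriv R (f a) * deriv f a) a :=
      hRd.hasDerivAt.comp a hfd
    have h4 : HasDerivAt (fun z => R (f z)) 1 a :=
      (hasDerivAt_id a).congr_of_eventuallyEq (by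
        filter_upwards [hU.mem_nhds ha] with z hz
        exact hR z hz)
    have := h3.unique h4
    rw [h0, mul_zero] at this
    exact zero_ne_one this

/-- A conformal map onto `Ω` has a holomorphic inverse. -/
lemma IsConformalMap.exists_inverse {P : ℂ → ℂ} {Ω : Set ℂ} (hP : IsConformalMap P Ω) :
    ∃ R : ℂ → ℂ, DifferentiableOn ℂ R Ω ∧ MapsTo R Ω (ball 0 1) ∧
      (∀ w ∈ Ω, P (R w) = w) ∧ ∀ z ∈ ball (0 : ℂ) 1, R (P z) = z := by
  obtain ⟨hd, hb⟩ := hP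
  have hR : ∀ z ∈ ball (0 : ℂ) 1, Function.invFunOn P (ball 0 1) (P z) = z := fun z hz =>
    hb.injOn.leftInvOn_invFunOn hz
  refine ⟨Function.invFunOn P (ball 0 1), ?_, ?_, ?_, hR⟩
  · intro w hw
    obtain ⟨z, hz, rfl⟩ := hb.surjOn hw
    exact (hasDerivAt_of_leftInverse isOpen_ball hd hR hz
      (deriv_ne_zero_of_leftInverse isOpen_ball hd hR hz)).differentiableAt.differentiableWithinAt
  · intro w hw
    obtain ⟨z, hz, rfl⟩ := hb.surjOn hw
    rw [hR z hz]; exact hz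
  · intro w hw
    obtain ⟨z, hz, rfl⟩ := hb.surjOn hw
    rw [hR z hz]

lemma IsConformalMap.deriv_ne_zero {P : ℂ → ℂ} {Ω : Set ℂ} (hP : IsConformalMap P Ω) {z : ℂ}
    (hz : z ∈ ball (0 : ℂ) 1) : deriv P z ≠ 0 := by
  obtain ⟨R, -, -, -, hR⟩ := hP.exists_inverse
  exact deriv_ne_zero_of_leftInverse isOpen_ball hP.1 hR hz

/-! ### Radial integrals and primitives -/

/-- Differentiation under the integral sign, for a jointly continuous derivative. -/
lemma hasDerivAt_integral_of_continuousOn {U : Set ℂ} (hU : IsOpen U) {G G' : ℂ → ℝ → ℂ}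
    (hG : ∀ w ∈ U, ContinuousOn (G w) (Icc 0 1))
    (hG' : ContinuousOn (fun p : ℂ × ℝ => G' p.1 p.2) (U ×ˢ Icc 0 1))
    (hd : ∀ w ∈ U, ∀ t ∈ Icc (0 : ℝ) 1, HasDerivAt (fun w => G w t) (G' w t) w)
    {w : ℂ} (hw : w ∈ U) :
    HasDerivAt (fun w => ∫ t in (0 : ℝ)..1, G w t) (∫ t in (0 : ℝ)..1, G' w t) w := by
  obtain ⟨r, hr, hrU⟩ := Metric.nhds_basis_closedBall.mem_iff.1 (hU.mem_nhds hw)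
  obtain ⟨C, hC⟩ := ((isCompact_closedBall w r).prod (isCompact_Icc (a := (0 : ℝ)) (b := 1))).exists_bound_of_continuousOn
    (hG'.mono (prod_mono_left hrU))
  have hsub : Ι (0 : ℝ) 1 ⊆ Icc 0 1 := by rw [uIoc_of_le zero_le_one]; exact Ioc_subset_Icc_self
  have hm : ∀ g : ℝ → ℂ, ContinuousOn g (Icc 0 1) →
      AEStronglyMeasurable g (volume.restrict (Ι (0 : ℝ) 1)) := fun g hg =>
    (hg.mono hsub).aestronglyMeasurable measurableSet_uIoc
  have hG'w : ContinuousOn (G' w) (Icc 0 1) :=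
    hG'.comp (f := fun t : ℝ => (w, t)) (by fun_prop) fun t ht => ⟨hw, ht⟩
  refine (intervalIntegral.hasDerivAt_integral_of_dominated_loc_of_deriv_le (bound := fun _ => C)
    (closedBall_mem_nhds w hr) ?_ ?_ (hm _ hG'w) ?_ ?_ ?_).2
  · filter_upwards [hU.mem_nhds hw] with x hx using hm _ (hG x hx)
  · exact ((hG w hw).mono (by rw [uIcc_of_le zero_le_one])).intervalIntegrable
  · exact ae_of_all _ fun t ht x hx => hC (x, t) ⟨hx, hsub ht⟩
  · simp
  · exact ae_of_all _ fun t ht x hx => hd x (hrU hx) t (hsub ht)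

lemma ofReal_mul_mem_ball {z : ℂ} {r : ℝ} (hz : z ∈ ball (0 : ℂ) r) {t : ℝ} (ht : t ∈ Icc (0 : ℝ) 1) :
    (t : ℂ) * z ∈ ball (0 : ℂ) r := by
  rw [mem_ball_zero_iff] at *
  rw [norm_mul, Complex.norm_real, Real.norm_of_nonneg ht.1]
  nlinarith [ht.1, ht.2, norm_nonneg z]

/-- `∫₀¹ tⁿ φ(tz) dt`, that is, `z⁻ⁿ⁻¹ ∫₀ᶻ ζⁿ φ(ζ) dζ`. -/
noncomputable def weightedMean (n : ℕ) (φ : ℂ → ℂ) (z : ℂ) : ℂ := ∫ t in (0 : ℝ)..1, (t : ℂ) ^ n * φ (t * z)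

lemma hasDerivAt_weightedMean {n : ℕ} {φ : ℂ → ℂ} (hφ : DifferentiableOn ℂ φ (ball 0 1)) {z : ℂ}
    (hz : z ∈ ball (0 : ℂ) 1) :
    HasDerivAt (weightedMean n φ) (∫ t in (0 : ℝ)..1, (t : ℂ) ^ (n + 1) * deriv φ (t * z)) z := by
  have hφ' : ContinuousOn (deriv φ) (ball 0 1) := (hφ.deriv isOpen_ball).continuousOn
  refine hasDerivAt_integral_of_continuousOn (G := fun z (t : ℝ) => (t : ℂ) ^ n * φ (t * z))
    (G' := fun z (t : ℝ) => (t : ℂ) ^ (n + 1) * deriv φ (t * z)) isOpen_ball ?_ ?_ ?_ hz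
  · intro w hw
    exact ContinuousOn.mul (by fun_prop) (hφ.continuousOn.comp (by fun_prop)
      fun t ht => ofReal_mul_mem_ball hw ht)
  · exact ContinuousOn.mul (by fun_prop) (hφ'.comp (by fun_prop)
      fun p hp => ofReal_mul_mem_ball hp.1 hp.2)
  · intro w hw t ht
    have h1 := (hφ.differentiableAt (isOpen_ball.mem_nhds (ofReal_mul_mem_ball hw ht))).hasDerivAt
    have h2 : HasDerivAt (fun w : ℂ => (t : ℂ) * w) (t : ℂ) w := by
      simpa using (hasDerivAt_id w).const_mul (t : ℂ)
    have := (h1.comp w h2).const_mul ((t : ℂ) ^ n)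
    refine this.congr_deriv ?_
    ring

/-- The fundamental theorem of calculus for t ↦ tⁿ⁺¹ φ(tz) on [0, 1]. With W the weighted mean it
expresses (zⁿ⁺¹ W)' = zⁿ φ after cancelling zⁿ, so it keeps its content at the origin. -/
lemma weightedMean_ode {n : ℕ} {φ : ℂ → ℂ} (hφ : DifferentiableOn ℂ φ (ball 0 1)) {z : ℂ}
    (hz : z ∈ ball (0 : ℂ) 1) :
    (n + 1) * weightedMean n φ z + z * deriv (weightedMean n φ) z = φ z := by
  rw [(hasDerivAt_weightedMean hφ hz).deriv]
  have hφ' : ContinuousOn (deriv φ) (ball 0 1) := (hφ.deriv isOpen_ball).continuousOn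
  have hc : ContinuousOn (fun t : ℝ => φ (t * z)) (Icc 0 1) :=
    hφ.continuousOn.comp (by fun_prop) fun t ht => ofReal_mul_mem_ball hz ht
  have hc' : ContinuousOn (fun t : ℝ => deriv φ (t * z)) (Icc 0 1) :=
    hφ'.comp (by fun_prop) fun t ht => ofReal_mul_mem_ball hz ht
  have hi : ∀ g : ℝ → ℂ, ContinuousOn g (Icc 0 1) → IntervalIntegrable g volume 0 1 := fun g hg =>
    (hg.mono (by rw [uIcc_of_le zero_le_one])).intervalIntegrable
  have hA : ContinuousOn (fun t : ℝ => ((n : ℂ) + 1) * ((t : ℂ) ^ n * φ (t * z))) (Icc 0 1) :=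
    continuousOn_const.mul (ContinuousOn.mul (by fun_prop) hc)
  have hB : ContinuousOn (fun t : ℝ => z * ((t : ℂ) ^ (n + 1) * deriv φ (t * z))) (Icc 0 1) :=
    continuousOn_const.mul (ContinuousOn.mul (by fun_prop) hc')
  have hftc := intervalIntegral.integral_eq_sub_of_hasDerivAt (a := (0 : ℝ)) (b := 1)
    (f := fun t : ℝ => (t : ℂ) ^ (n + 1) * φ (t * z))
    (f' := fun t : ℝ => (n + 1) * ((t : ℂ) ^ n * φ (t * z)) +
      z * ((t : ℂ) ^ (n + 1) * deriv φ (t * z))) ?_ ?_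
  · rw [intervalIntegral.integral_add, intervalIntegral.integral_const_mul,
      intervalIntegral.integral_const_mul] at hftc
    · simpa [weightedMean] using hftc
    · exact hi _ hA
    · exact hi _ hB
  · intro t ht
    rw [uIcc_of_le zero_le_one] at ht
    have h1 := (hφ.differentiableAt (isOpen_ball.mem_nhds (ofReal_mul_mem_ball hz ht))).hasDerivAt
    have h2 : HasDerivAt (fun w : ℂ => w * z) z t := by
      simpa using (hasDerivAt_id (t : ℂ)).mul_const z
    have h3 := ((hasDerivAt_pow (n + 1) (t : ℂ)).mul (h1.comp (t : ℂ) h2)).comp_ofReal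
    refine h3.congr_deriv ?_
    simp only [Function.comp_apply, Nat.add_sub_cancel, Nat.cast_add, Nat.cast_one]
    ring
  · exact hi _ (hA.add hB)

lemma differentiableOn_weightedMean {n : ℕ} {φ : ℂ → ℂ} (hφ : DifferentiableOn ℂ φ (ball 0 1)) :
    DifferentiableOn ℂ (weightedMean n φ) (ball 0 1) := fun _ hz =>
  (hasDerivAt_weightedMean hφ hz).differentiableAt.differentiableWithinAt

lemma integralTo_eq_weightedMean (φ : ℂ → ℂ) (z : ℂ) : integralTo φ z = z * weightedMean 0 φ z := by
  simp [integralTo, weightedMean]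

/-- `integralTo φ` is the primitive of `φ` vanishing at the origin. -/
lemma hasDerivAt_integralTo {φ : ℂ → ℂ} (hφ : DifferentiableOn ℂ φ (ball 0 1)) {z : ℂ}
    (hz : z ∈ ball (0 : ℂ) 1) : HasDerivAt (integralTo φ) (φ z) z := by
  have h := (hasDerivAt_id z).mul
    ((differentiableOn_weightedMean (n := 0) hφ).differentiableAt (isOpen_ball.mem_nhds hz)).hasDerivAt
  have h2 := weightedMean_ode (n := 0) hφ hz
  rw [show integralTo φ = id * weightedMean 0 φ from funext fun z => integralTo_eq_weightedMean φ z]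
  refine h.congr_deriv ?_
  rw [← h2]; simp

lemma eqOn_ball_of_deriv_eq {F G : ℂ → ℂ} (hF : DifferentiableOn ℂ F (ball 0 1))
    (hG : DifferentiableOn ℂ G (ball 0 1)) (h0 : F 0 = G 0)
    (h : ∀ z ∈ ball (0 : ℂ) 1, deriv F z = deriv G z) : ∀ z ∈ ball (0 : ℂ) 1, F z = G z := by
  intro z hz
  exact isOpen_ball.eqOn_of_deriv_eq (convex_ball (0 : ℂ) 1).isPreconnected hF hG h
    (mem_ball_self one_pos) h0 hz


/-! ### Jack's lemma and quotients of primitives -/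

lemma nonneg_of_hasDerivAt_of_le {g : ℝ → ℝ} {d : ℝ} (hg : HasDerivAt g d 0)
    (h : ∀ᶠ s in 𝓝[>] (0 : ℝ), g 0 ≤ g s) : 0 ≤ d := by
  refine ge_of_tendsto hg.tendsto_slope_zero_right ?_
  filter_upwards [h, self_mem_nhdsWithin] with s hs hpos
  have hpos' : 0 < s := hpos
  simp only [zero_add, smul_eq_mul]
  have := sub_nonneg.2 hs
  positivity

/-- Jack's lemma in the form used for differential subordinations: at a point of least modulus at
which `Re p` fails to be positive, `p` is imaginary and `z p'(z)` is real and nonpositive. -/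
lemma re_pos_of_forall_boundary {p : ℂ → ℂ} (hp : DifferentiableOn ℂ p (ball 0 1))
    (h0 : 0 < (p 0).re)
    (h : ∀ z ∈ ball (0 : ℂ) 1, z ≠ 0 → (p z).re = 0 → (z * deriv p z).im = 0 →
      (z * deriv p z).re ≤ 0 → False) :
    ∀ z ∈ ball (0 : ℂ) 1, 0 < (p z).re := by
  by_contra! hcon
  obtain ⟨w, hw, hwre⟩ := hcon
  have hsub : closedBall (0 : ℂ) ‖w‖ ⊆ ball 0 1 := closedBall_subset_ball (by simpa using hw)
  have hcre : ContinuousOn (fun z => (p z).re) (closedBall 0 ‖w‖) :=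
    Complex.continuous_re.comp_continuousOn (hp.continuousOn.mono hsub)
  have hSc : IsCompact (closedBall (0 : ℂ) ‖w‖ ∩ (fun z => (p z).re) ⁻¹' Iic 0) :=
    (isCompact_closedBall 0 ‖w‖).of_isClosed_subset
      (hcre.preimage_isClosed_of_isClosed isClosed_closedBall isClosed_Iic) inter_subset_left
  obtain ⟨z, ⟨hzb, hzre⟩, hmin⟩ := hSc.exists_isMinOn ⟨w, by simp, hwre⟩
    (f := fun z : ℂ => ‖z‖) continuous_norm.continuousOn
  have hzball : z ∈ ball (0 : ℂ) 1 := hsub hzb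
  have hz0 : z ≠ 0 := by
    rintro rfl
    exact absurd hzre (not_le.2 h0)
  have hpos : ∀ y : ℂ, ‖y‖ < ‖z‖ → 0 < (p y).re := by
    intro y hy
    by_contra! hle
    have hyS : y ∈ closedBall (0 : ℂ) ‖w‖ ∩ (fun z => (p z).re) ⁻¹' Iic 0 :=
      ⟨by simpa using hy.le.trans (by simpa using hzb), hle⟩
    exact absurd (hmin hyS) (not_le.2 hy)
  have hnn : ∀ y : ℂ, ‖y‖ ≤ ‖z‖ → 0 ≤ (p y).re := by
    intro y hy
    have hyb : y ∈ ball (0 : ℂ) 1 := by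
      have := mem_ball_zero_iff.1 hzball
      exact mem_ball_zero_iff.2 (hy.trans_lt this)
    have hc : ContinuousAt (fun t : ℝ => (p (t * y)).re) 1 := by
      refine Complex.continuous_re.continuousAt.comp ?_
      refine ContinuousAt.comp (f := fun t : ℝ => (t : ℂ) * y) (g := p) ?_ (by fun_prop)
      simpa using (hp.differentiableAt (isOpen_ball.mem_nhds hyb)).continuousAt
    have ht : Tendsto (fun t : ℝ => (p (t * y)).re) (𝓝[<] 1) (𝓝 (p y).re) := by
      simpa using hc.tendsto.mono_left nhdsWithin_le_nhds
    refine ge_of_tendsto ht ?_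
    filter_upwards [Ioo_mem_nhdsLT (show (0 : ℝ) < 1 by norm_num)] with t ht
    refine (hpos _ ?_).le
    rw [norm_mul, Complex.norm_real, Real.norm_of_nonneg ht.1.le]
    have hzn := norm_pos_iff.2 hz0
    nlinarith [ht.1, ht.2, norm_nonneg y]
  have hre0 : (p z).re = 0 := le_antisymm hzre (hnn z le_rfl)
  -- For Re ζ ≤ 0 the curve s ↦ z exp(sζ), s ≥ 0, stays in the closed disk of radius |z|, where Re p
  -- ≥ 0, and starts at a zero of Re p. Its right derivative there is therefore nonnegative; the
  -- choices ζ = ±i and ζ = -1 give the two conditions.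
  have key : ∀ ζ : ℂ, ζ.re ≤ 0 → 0 ≤ (ζ * (z * deriv p z)).re := by
    intro ζ hζ
    have h1 : HasDerivAt (fun s : ℂ => z * Complex.exp (s * ζ)) (z * ζ) ((0 : ℝ) : ℂ) := by
      have := (((hasDerivAt_id (0 : ℂ)).mul_const ζ).cexp).const_mul z
      simpa using this
    have h2 : HasDerivAt p (deriv p z) (z * Complex.exp (((0 : ℝ) : ℂ) * ζ)) := by
      simpa using (hp.differentiableAt (isOpen_ball.mem_nhds hzball)).hasDerivAt
    have h3 := (HasDerivAt.comp (h₂ := p) (h := fun s : ℂ => z * Complex.exp (s * ζ)) _ h2 h1).real_of_complex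
    have := nonneg_of_hasDerivAt_of_le h3 ?_
    · convert this using 2
      ring
    · filter_upwards [self_mem_nhdsWithin] with s hs
      have hs' : 0 < s := hs
      simp only [Function.comp_apply, Complex.ofReal_zero, zero_mul, Complex.exp_zero, mul_one, hre0]
      refine hnn _ ?_
      rw [norm_mul, Complex.norm_exp]
      refine mul_le_of_le_one_right (norm_nonneg z) (Real.exp_le_one_iff.2 ?_)
      simp only [Complex.mul_re, Complex.ofReal_re, Complex.ofReal_im, zero_mul, sub_zero]
      exact mul_nonpos_of_nonneg_of_nonpos hs'.le hζ
  refine h z hzball hz0 hre0 ?_ ?_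
  · have h1 := key Complex.I (by simp)
    have h2 := key (-Complex.I) (by simp)
    simp at h1 h2
    simp only [Complex.mul_im]
    linarith
  · have h1 := key (-1) (by simp)
    simp at h1
    simp only [Complex.mul_re]
    linarith

/-- A multivalently convex function is starlike, in terms of `κ(z) = z⁻ⁿ F'(z)`. -/
lemma re_weightedMean_div_pos {n : ℕ} {κ : ℂ → ℂ} (hκ : DifferentiableOn ℂ κ (ball 0 1))
    (hne : ∀ z ∈ ball (0 : ℂ) 1, κ z ≠ 0)
    (h : ∀ z ∈ ball (0 : ℂ) 1, z ≠ 0 → 0 < (n + 1 + z * deriv κ z / κ z).re) :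
    ∀ z ∈ ball (0 : ℂ) 1, 0 < (weightedMean n κ z / κ z).re := by
  have hW := differentiableOn_weightedMean (n := n) hκ
  refine re_pos_of_forall_boundary (p := fun z => weightedMean n κ z / κ z) (hW.div hκ hne) ?_ ?_
  · have h0 := weightedMean_ode (n := n) hκ (mem_ball_self one_pos)
    have hk0 := hne 0 (mem_ball_self one_pos)
    have hn : ((n : ℂ) + 1) ≠ 0 := by exact_mod_cast n.succ_ne_zero
    have : weightedMean n κ 0 / κ 0 = (((n : ℝ) + 1 : ℝ) : ℂ)⁻¹ := by
      rw [← h0] at hk0 ⊢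
      rw [zero_mul, add_zero] at hk0 ⊢
      have := right_ne_zero_of_mul hk0
      push_cast
      field_simp
    rw [this, ← Complex.ofReal_inv, Complex.ofReal_re]
    positivity
  · intro z hz hz0 hre him hle
    set q := weightedMean n κ z / κ z with hq
    have hd := ((hW.differentiableAt (isOpen_ball.mem_nhds hz)).hasDerivAt.fun_div
      (hκ.differentiableAt (isOpen_ball.mem_nhds hz)).hasDerivAt (hne z hz)).deriv
    rw [hd] at him hle
    have hk := hne z hz
    have hode := weightedMean_ode (n := n) hκ hz
    set k := (n : ℂ) + 1 + z * deriv κ z / κ z with hkdef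
    -- The Riccati relation z q' = 1 - q k. At the critical point q is imaginary and z q' is real,
    -- so Im q · Re k = 0 and q = 0; then z q' = 1, which is not ≤ 0.
    have e : z * ((deriv (weightedMean n κ) z * κ z - weightedMean n κ z * deriv κ z) / κ z ^ 2)
        = 1 - q * k := by
      rw [hq, hkdef]
      have : z * deriv (weightedMean n κ) z = κ z - (n + 1) * weightedMean n κ z := by
        rw [← hode]; ring
      field_simp
      linear_combination (κ z) * this
    rw [e] at him hle
    have hkpos := h z hz hz0
    rw [← hkdef] at hkpos
    simp only [Complex.sub_im, Complex.one_im, Complex.mul_im, hre, Complex.sub_re, Complex.one_re,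
      Complex.mul_re] at him hle
    have : q.im = 0 := by
      have : q.im * k.re = 0 := by linarith
      exact (mul_eq_zero.1 this).resolve_right hkpos.ne'
    rw [this] at hle
    norm_num at hle

/-- If `N'/D'` has positive real part and `D` is multivalently convex, then `N/D` has positive real
part, in terms of `η(z) = z⁻ⁿ N'(z)` and `κ(z) = z⁻ⁿ D'(z)`. -/
lemma re_weightedMean_div_weightedMean_pos {n : ℕ} {κ η : ℂ → ℂ}
    (hκ : DifferentiableOn ℂ κ (ball 0 1)) (hη : DifferentiableOn ℂ η (ball 0 1))
    (hne : ∀ z ∈ ball (0 : ℂ) 1, κ z ≠ 0)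
    (h : ∀ z ∈ ball (0 : ℂ) 1, z ≠ 0 → 0 < (n + 1 + z * deriv κ z / κ z).re)
    (hpos : ∀ z ∈ ball (0 : ℂ) 1, 0 < (η z / κ z).re) :
    ∀ z ∈ ball (0 : ℂ) 1, 0 < (weightedMean n η z / weightedMean n κ z).re := by
  have hq := re_weightedMean_div_pos hκ hne h
  have hWne : ∀ z ∈ ball (0 : ℂ) 1, weightedMean n κ z ≠ 0 := fun z hz h0 => by
    have := hq z hz
    simp [h0] at this
  have hW := differentiableOn_weightedMean (n := n) hκ
  have hV := differentiableOn_weightedMean (n := n) hη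
  refine re_pos_of_forall_boundary (p := fun z => weightedMean n η z / weightedMean n κ z)
    (hV.div hW hWne) ?_ ?_
  · have h0 := weightedMean_ode (n := n) hκ (mem_ball_self one_pos)
    have h1 := weightedMean_ode (n := n) hη (mem_ball_self one_pos)
    have hn : ((n : ℂ) + 1) ≠ 0 := by exact_mod_cast n.succ_ne_zero
    have := hpos 0 (mem_ball_self one_pos)
    rw [← h0, ← h1, zero_mul, add_zero, zero_mul, add_zero, mul_div_mul_left _ _ hn] at this
    exact this
  · intro z hz hz0 hre him hle
    have hd := ((hV.differentiableAt (isOpen_ball.mem_nhds hz)).hasDerivAt.fun_div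
      (hW.differentiableAt (isOpen_ball.mem_nhds hz)).hasDerivAt (hWne z hz)).deriv
    rw [hd] at him hle
    have hp := hpos z hz
    have hode := weightedMean_ode (n := n) hκ hz
    have hode' := weightedMean_ode (n := n) hη hz
    have hwz := hWne z hz
    have hk := hne z hz
    set d := z * ((deriv (weightedMean n η) z * weightedMean n κ z -
      weightedMean n η z * deriv (weightedMean n κ) z) / weightedMean n κ z ^ 2) with hddef
    -- With p the quotient of means and q that of `re_weightedMean_div_pos`, η/κ = p + z p' q. If Re
    -- p = 0 and z p' is real and nonpositive, then Re q > 0 forces Re(η/κ) ≤ 0.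
    have e : η z / κ z = weightedMean n η z / weightedMean n κ z +
        d * (weightedMean n κ z / κ z) := by
      rw [hddef]
      field_simp
      linear_combination (weightedMean n η z) * hode - (weightedMean n κ z) * hode'
    rw [e, Complex.add_re, hre, Complex.mul_re, him] at hp
    nlinarith [hq z hz]


/-! ### Disk automorphisms -/

lemma one_add_conj_mul_ne_zero {a z : ℂ} (h : ‖a‖ * ‖z‖ < 1) : 1 + conj a * z ≠ 0 := by
  intro h0
  have : conj a * z = -1 := by linear_combination h0
  have h2 := congrArg norm this
  rw [norm_mul, RCLike.norm_conj, norm_neg, norm_one] at h2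
  linarith

lemma sigma_zero (a : ℂ) : sigma a 0 = a := by simp [sigma]

lemma conj_mul_self (a : ℂ) : conj a * a = ((‖a‖ ^ 2 : ℝ) : ℂ) := by
  rw [Complex.conj_mul', Complex.ofReal_pow]

lemma one_sub_norm_sigma_sq {a z : ℂ} (h : ‖a‖ * ‖z‖ < 1) :
    (1 - ‖sigma a z‖ ^ 2) * ‖1 + conj a * z‖ ^ 2 = (1 - ‖a‖ ^ 2) * (1 - ‖z‖ ^ 2) := by
  have hne := one_add_conj_mul_ne_zero h
  have hmul : ‖sigma a z‖ * ‖1 + conj a * z‖ = ‖z + a‖ := by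
    rw [sigma, ← norm_mul, div_mul_cancel₀ _ hne]
  rw [sub_mul, ← mul_pow, hmul, ← Complex.normSq_eq_norm_sq, ← Complex.normSq_eq_norm_sq,
    ← Complex.normSq_eq_norm_sq, ← Complex.normSq_eq_norm_sq]
  simp only [Complex.normSq_apply, Complex.add_re, Complex.add_im, Complex.mul_re, Complex.mul_im,
    Complex.conj_re, Complex.conj_im, Complex.one_re, Complex.one_im]
  ring

lemma norm_mul_norm_lt_one {a z : ℂ} (ha : ‖a‖ < 1) (hz : ‖z‖ ≤ 1) : ‖a‖ * ‖z‖ < 1 := by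
  nlinarith [norm_nonneg a, norm_nonneg z]

lemma norm_sigma_le_one {a z : ℂ} (ha : ‖a‖ < 1) (hz : ‖z‖ ≤ 1) : ‖sigma a z‖ ≤ 1 := by
  have h := norm_mul_norm_lt_one ha hz
  have h1 := one_sub_norm_sigma_sq h
  have h2 : 0 < ‖1 + conj a * z‖ ^ 2 := by
    have := norm_pos_iff.2 (one_add_conj_mul_ne_zero h); positivity
  have h3 : 0 ≤ (1 - ‖a‖ ^ 2) * (1 - ‖z‖ ^ 2) :=
    mul_nonneg (by nlinarith [norm_nonneg a]) (by nlinarith [norm_nonneg z])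
  rw [← h1] at h3
  nlinarith [nonneg_of_mul_nonneg_left h3 h2, norm_nonneg (sigma a z)]

lemma norm_sigma_lt_one {a z : ℂ} (ha : ‖a‖ < 1) (hz : ‖z‖ < 1) : ‖sigma a z‖ < 1 := by
  have h := norm_mul_norm_lt_one ha hz.le
  have h1 := one_sub_norm_sigma_sq h
  have h2 : 0 < ‖1 + conj a * z‖ ^ 2 := by
    have := norm_pos_iff.2 (one_add_conj_mul_ne_zero h); positivity
  have h3 : 0 < (1 - ‖a‖ ^ 2) * (1 - ‖z‖ ^ 2) :=
    mul_pos (by nlinarith [norm_nonneg a]) (by nlinarith [norm_nonneg z])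
  rw [← h1] at h3
  nlinarith [pos_of_mul_pos_left h3 h2.le, norm_nonneg (sigma a z)]

lemma hasDerivAt_sigma {a z : ℂ} (h : ‖a‖ * ‖z‖ < 1) :
    HasDerivAt (sigma a) ((1 - conj a * a) / (1 + conj a * z) ^ 2) z := by
  have hne := one_add_conj_mul_ne_zero h
  have h1 := ((hasDerivAt_id z).add_const a).fun_div
    (((hasDerivAt_id z).const_mul (conj a)).const_add 1) hne
  refine h1.congr_deriv ?_
  simp only [id]
  field_simp
  ring

lemma one_sub_conj_mul_self_ne_zero {a : ℂ} (ha : ‖a‖ < 1) : 1 - conj a * a ≠ 0 := by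
  rw [conj_mul_self, ← Complex.ofReal_one, ← Complex.ofReal_sub, Complex.ofReal_ne_zero]
  nlinarith [norm_nonneg a]

lemma sigma_neg_sigma {a z : ℂ} (ha : ‖a‖ < 1) (hz : ‖z‖ ≤ 1) : sigma a (sigma (-a) z) = z := by
  have h1 : 1 - conj a * z ≠ 0 := by
    have := one_add_conj_mul_ne_zero (a := -a) (by simpa using norm_mul_norm_lt_one ha hz)
    simpa [← sub_eq_add_neg] using this
  have h2 := one_sub_conj_mul_self_ne_zero ha
  simp only [sigma, map_neg, neg_mul, ← sub_eq_add_neg]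
  have e : 1 + conj a * ((z - a) / (1 - conj a * z)) = (1 - conj a * a) / (1 - conj a * z) := by
    field_simp; ring
  rw [div_eq_iff (by rw [e]; exact div_ne_zero h2 h1), e, mul_div_assoc', div_add' _ _ _ h1]
  congr 1
  ring

lemma differentiableOn_sigma {a : ℂ} (ha : ‖a‖ < 1) :
    DifferentiableOn ℂ (sigma a) (ball 0 1) := fun _ hz =>
  (hasDerivAt_sigma (norm_mul_norm_lt_one ha
    (mem_ball_zero_iff.1 hz).le)).differentiableAt.differentiableWithinAt

lemma mapsTo_sigma {a : ℂ} (ha : ‖a‖ < 1) : MapsTo (sigma a) (ball 0 1) (ball 0 1) := fun _ hz =>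
  mem_ball_zero_iff.2 (norm_sigma_lt_one ha (mem_ball_zero_iff.1 hz))

lemma IsConformalMap.comp_sigma {P : ℂ → ℂ} {Ω : Set ℂ} (hP : IsConformalMap P Ω) {a : ℂ}
    (ha : ‖a‖ < 1) : IsConformalMap (fun z => P (sigma a z)) Ω := by
  have ha' : ‖-a‖ < 1 := by simpa using ha
  refine ⟨hP.1.comp (differentiableOn_sigma ha) (mapsTo_sigma ha), hP.2.comp ?_⟩
  refine InvOn.bijOn (f' := sigma (-a)) ⟨fun z hz => ?_, fun z hz => ?_⟩ (mapsTo_sigma ha)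
    (mapsTo_sigma ha')
  · simpa using sigma_neg_sigma ha' (mem_ball_zero_iff.1 hz).le
  · exact sigma_neg_sigma ha (mem_ball_zero_iff.1 hz).le

/-! ### Tangent inequalities and the preSchwarzian of convex maps -/

lemma IsConformalMap.hasDerivAt {P : ℂ → ℂ} {Ω : Set ℂ} (hP : IsConformalMap P Ω) {z : ℂ}
    (hz : z ∈ ball (0 : ℂ) 1) : HasDerivAt P (deriv P z) z :=
  (hP.1.differentiableAt (isOpen_ball.mem_nhds hz)).hasDerivAt

/-- The image of a disk centred at the origin under a convex map lies on one side of its tangent. -/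
lemma IsConformalMap.re_div_nonneg_of_norm_le {P : ℂ → ℂ} {Ω : Set ℂ} (hP : IsConformalMap P Ω)
    (hΩ : Convex ℝ Ω) {a b : ℂ} (hab : ‖a‖ ≤ ‖b‖) (hb : ‖b‖ < 1) (hb0 : b ≠ 0) :
    0 ≤ ((P b - P a) / (b * deriv P b)).re := by
  obtain ⟨R, hRd, hRm, hPR, hR⟩ := hP.exists_inverse
  have hbb : b ∈ ball (0 : ℂ) 1 := mem_ball_zero_iff.2 hb
  have hs : ‖a / b‖ ≤ 1 := by
    rw [norm_div]; exact div_le_one_of_le₀ hab (norm_nonneg b)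
  have hsz : ∀ z ∈ ball (0 : ℂ) 1, a / b * z ∈ ball (0 : ℂ) 1 := fun z hz => by
    rw [mem_ball_zero_iff] at *
    rw [norm_mul]
    nlinarith [norm_nonneg z, norm_nonneg (a / b)]
  have hseg : ∀ t : ℝ, t ∈ Icc (0 : ℝ) 1 → ∀ z ∈ ball (0 : ℂ) 1,
      P z + t * (P (a / b * z) - P z) ∈ Ω := fun t ht z hz => by
    have := hΩ.add_smul_sub_mem (hP.2.mapsTo hz) (hP.2.mapsTo (hsz z hz)) ht
    simpa using this
  -- Schwarz's lemma for z ↦ R((1 - t) P(z) + t P((a/b) z)): by convexity of Ω this is a self-map of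
  -- the disk, it fixes 0, and at z = b it gives the bound. So the segment from P(b) to P(a) pulls
  -- back into the disk of radius |b|, and its initial velocity points inwards.
  have hbound : ∀ t : ℝ, t ∈ Icc (0 : ℝ) 1 → ‖R (P b + t * (P a - P b))‖ ≤ ‖b‖ := by
    intro t ht
    have := Complex.norm_le_norm_of_mapsTo_ball
      (f := fun z => R (P z + t * (P (a / b * z) - P z))) (z := b) (R := 1) ?_ ?_ ?_ hb
    · simpa [div_mul_cancel₀ a hb0] using this
    · refine hRd.comp ?_ (fun z hz => hseg t ht z hz)
      exact hP.1.add (((hP.1.comp (by fun_prop) hsz).sub hP.1).const_mul _)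
    · exact fun z hz => ball_subset_closedBall (hRm (hseg t ht z hz))
    · simp [hR 0 (mem_ball_self one_pos)]
  have h1 : HasDerivAt R (deriv P b)⁻¹ (P b + (0 : ℝ) * (P a - P b)) := by
    simpa using hasDerivAt_of_leftInverse isOpen_ball hP.1 hR hbb (hP.deriv_ne_zero hbb)
  have h2 : HasDerivAt (fun t : ℂ => P b + t * (P a - P b)) (P a - P b) ((0 : ℝ) : ℂ) := by
    simpa using ((hasDerivAt_id (0 : ℂ)).mul_const (P a - P b)).const_add (P b)
  have h3 := ((HasDerivAt.comp (h₂ := R) (h := fun t : ℂ => P b + t * (P a - P b)) _ h1 h2).const_mul (-conj b)).real_of_complex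
  have h4 := nonneg_of_hasDerivAt_of_le h3 ?_
  · have : (P b - P a) / (b * deriv P b) =
        (((‖b‖ ^ 2 : ℝ)⁻¹ : ℝ) : ℂ) * (-conj b * ((deriv P b)⁻¹ * (P a - P b))) := by
      have hc : conj b ≠ 0 := by simpa using hb0
      have hd := hP.deriv_ne_zero hbb
      rw [Complex.ofReal_inv, ← conj_mul_self]
      field_simp
      ring
    rw [this, Complex.re_ofReal_mul]
    positivity
  · filter_upwards [Ioo_mem_nhdsGT (show (0 : ℝ) < 1 by norm_num)] with t ht
    have e := hbound t ⟨ht.1.le, ht.2.le⟩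
    have h5 : (conj b * R (P b + t * (P a - P b))).re ≤ ‖b‖ ^ 2 := by
      refine (Complex.re_le_norm _).trans ?_
      rw [norm_mul, RCLike.norm_conj, sq]
      exact mul_le_mul_of_nonneg_left e (norm_nonneg b)
    simp only [Function.comp_apply, Complex.ofReal_zero, zero_mul, add_zero, hR b hbb, neg_mul,
      Complex.neg_re, conj_mul_self b, Complex.ofReal_re]
    linarith

/-- If `a` lies in the open horodisk through `b` with inner normal `-A` at `b`, then `P a` lies on
the inner side of the image of its tangent under a convex map `P`. -/
lemma IsConformalMap.re_div_nonneg_of_mem_horodisk {P : ℂ → ℂ} {Ω : Set ℂ}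
    (hP : IsConformalMap P Ω) (hΩ : Convex ℝ Ω) {a b A : ℂ} (ha : ‖a‖ < 1) (hb : ‖b‖ < 1)
    (hab : a ≠ b) (hA : A ≠ 0)
    (hS : ‖A‖ < (1 - ‖b‖ ^ 2) * (A / (b - a)).re + (A * conj b).re) :
    0 ≤ ((P b - P a) / (deriv P b * A)).re := by
  have hbb : b ∈ ball (0 : ℂ) 1 := mem_ball_zero_iff.2 hb
  have hb' : ‖-b‖ < 1 := by simpa using hb
  set δ := sigma (-b) a with hδ
  have hδ1 : ‖δ‖ < 1 := norm_sigma_lt_one hb' ha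
  have hden : 1 - conj b * a ≠ 0 := by
    have := one_add_conj_mul_ne_zero (norm_mul_norm_lt_one hb' ha.le)
    simpa [← sub_eq_add_neg] using this
  have hδe : δ = (a - b) / (1 - conj b * a) := by
    simp [hδ, sigma, ← sub_eq_add_neg]
  have hδ0 : δ ≠ 0 := by rw [hδe]; exact div_ne_zero (sub_ne_zero.2 hab) hden
  have hA' : 0 < ‖A‖ := norm_pos_iff.2 hA
  set u : ℂ := A / (‖A‖ : ℂ) with hu
  have hAu : A = (‖A‖ : ℂ) * u := by
    rw [hu, mul_div_cancel₀]; exact_mod_cast hA'.ne'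
  have hun : ‖u‖ = 1 := by rw [hu, norm_div, Complex.norm_real, norm_norm, div_self hA'.ne']
  -- After b is moved to 0, the horodisk is the open disk with diameter from 0 to -u, and δ lies
  -- inside it.
  have hS' : 1 < (-u / δ).re := by
    have e : (1 - ‖b‖ ^ 2) * (A / (b - a)).re + (A * conj b).re = ‖A‖ * (-u / δ).re := by
      rw [← Complex.re_ofReal_mul, ← Complex.re_ofReal_mul, ← Complex.add_re]
      congr 1
      have hba : b - a ≠ 0 := sub_ne_zero.2 hab.symm
      have hab' : a - b ≠ 0 := sub_ne_zero.2 hab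
      rw [Complex.ofReal_sub, ← conj_mul_self, hδe, Complex.ofReal_one]
      have : -u / ((a - b) / (1 - conj b * a)) = u * (1 - conj b * a) / (b - a) := by
        rw [← neg_sub b a]; field_simp
      rw [this]
      nth_rewrite 1 2 [hAu]
      field_simp
      ring
    rw [e] at hS
    exact lt_of_mul_lt_mul_left (by simpa using hS) hA'.le
  set M := (-u * conj δ).re with hM
  have hMδ : ‖δ‖ ^ 2 < M := by
    have hd2 : 0 < ‖δ‖ ^ 2 := by have := norm_pos_iff.2 hδ0; positivity
    have e : -u * conj δ = ((‖δ‖ ^ 2 : ℝ) : ℂ) * (-u / δ) := by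
      rw [← conj_mul_self]; field_simp
    rw [hM, e, Complex.re_ofReal_mul]
    nlinarith
  -- The horodisk is the increasing limit, as r → 1, of the hyperbolic disks centred at -r u with 0
  -- on their boundary. The inequality says that δ lies in such a disk; it holds at r = 1, hence for
  -- r close to 1.
  obtain ⟨r, hr0, hr1, hr⟩ : ∃ r : ℝ, 0 < r ∧ r < 1 ∧ ‖δ‖ ^ 2 * (1 + r ^ 2) < 2 * r * M := by
    have hc : ContinuousAt (fun r : ℝ => 2 * r * M - ‖δ‖ ^ 2 * (1 + r ^ 2)) 1 := by fun_prop
    have : ∀ᶠ r : ℝ in 𝓝[<] 1, 0 < 2 * r * M - ‖δ‖ ^ 2 * (1 + r ^ 2) :=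
      (hc.tendsto.mono_left nhdsWithin_le_nhds).eventually_const_lt (by nlinarith)
    obtain ⟨r, h1, h2⟩ := (this.and (Ioo_mem_nhdsLT (show (0 : ℝ) < 1 by norm_num))).exists
    exact ⟨r, h2.1, h2.2, by linarith⟩
  set τ : ℂ := -(r * u) with hτ
  have hτn : ‖τ‖ = r := by
    rw [hτ, norm_neg, norm_mul, hun, Complex.norm_real, Real.norm_of_nonneg hr0.le, mul_one]
  have hτ1 : ‖τ‖ < 1 := hτn ▸ hr1
  have hτ1' : ‖-τ‖ < 1 := by simpa using hτ1
  have hP2 := (hP.comp_sigma hb).comp_sigma hτ1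
  have hwa : ‖sigma (-τ) δ‖ ≤ ‖-τ‖ := by
    have h1 := norm_mul_norm_lt_one hτ1' hδ1.le
    have h2 := one_sub_norm_sigma_sq h1
    have h3 := norm_pos_iff.2 (one_add_conj_mul_ne_zero h1)
    have h4 : ‖1 + conj (-τ) * δ‖ ^ 2 = 1 - 2 * r * M + r ^ 2 * ‖δ‖ ^ 2 := by
      have hu2 : u.re * u.re + u.im * u.im = 1 := by
        rw [← Complex.normSq_apply, Complex.normSq_eq_norm_sq, hun, one_pow]
      rw [hM, ← Complex.normSq_eq_norm_sq, ← Complex.normSq_eq_norm_sq, hτ]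
      simp only [Complex.normSq_apply, neg_neg, map_mul, Complex.conj_ofReal, Complex.add_re,
        Complex.add_im, Complex.mul_re, Complex.mul_im, Complex.conj_re, Complex.conj_im,
        Complex.one_re, Complex.one_im, Complex.ofReal_re, Complex.ofReal_im, Complex.neg_re,
        Complex.neg_im]
      linear_combination (r ^ 2 * (δ.re * δ.re + δ.im * δ.im)) * hu2
    rw [norm_neg, hτn] at h2 ⊢
    refine abs_le_of_sq_le_sq' ?_ hr0.le |>.2
    by_contra! hlt
    have h5 : 0 < ‖1 + conj (-τ) * δ‖ ^ 2 := by positivity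
    have h6 : (1 - ‖sigma (-τ) δ‖ ^ 2) * ‖1 + conj (-τ) * δ‖ ^ 2 <
        (1 - r ^ 2) * ‖1 + conj (-τ) * δ‖ ^ 2 := by
      apply mul_lt_mul_of_pos_right _ h5; linarith
    rw [h2, h4] at h6
    have h7 : 1 - ‖δ‖ ^ 2 < 1 - 2 * r * M + r ^ 2 * ‖δ‖ ^ 2 :=
      lt_of_mul_lt_mul_left h6 (by nlinarith)
    nlinarith
  have hτ0 : -τ ≠ 0 := by rw [← norm_pos_iff, norm_neg, hτn]; exact hr0
  -- With the hyperbolic centre τ moved to the origin, the hyperbolic disk becomes a centred disk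
  -- with -τ, the new position of b, on its boundary.
  have key := hP2.re_div_nonneg_of_norm_le hΩ hwa hτ1' hτ0
  have e1 : sigma τ (-τ) = 0 := by simp [sigma]
  have e2 : sigma τ (sigma (-τ) δ) = δ := sigma_neg_sigma hτ1 hδ1.le
  have e3 : sigma b δ = a := sigma_neg_sigma hb ha.le
  have hd : HasDerivAt (fun z => P (sigma b (sigma τ z)))
      (deriv P b * ((1 - conj b * b) * (1 / (1 - conj τ * τ)))) (-τ) := by
    have d1 : HasDerivAt (sigma τ) (1 / (1 - conj τ * τ)) (-τ) := by
      refine (hasDerivAt_sigma (norm_mul_norm_lt_one hτ1 hτ1'.le)).congr_deriv ?_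
      have := one_sub_conj_mul_self_ne_zero hτ1
      rw [show 1 + conj τ * -τ = 1 - conj τ * τ by ring]
      field_simp
    have d2 : HasDerivAt (sigma b) (1 - conj b * b) (sigma τ (-τ)) := by
      rw [e1]
      refine (hasDerivAt_sigma (by simp)).congr_deriv ?_
      simp
    have d3 : HasDerivAt P (deriv P b) (sigma b (sigma τ (-τ))) := by
      rw [e1, sigma_zero]; exact hP.hasDerivAt hbb
    exact d3.comp (-τ) (d2.comp (-τ) d1)
  rw [hd.deriv, e1, e2, e3, sigma_zero] at key
  have e : (P b - P a) / (deriv P b * A) = (((r * (1 - ‖b‖ ^ 2) / (1 - r ^ 2)) / ‖A‖ : ℝ) : ℂ) *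
      ((P b - P a) / (-τ * (deriv P b * ((1 - conj b * b) * (1 / (1 - conj τ * τ)))))) := by
    have hb2 := one_sub_conj_mul_self_ne_zero hb
    have ht2 := one_sub_conj_mul_self_ne_zero hτ1
    rw [← hτn]
    push_cast
    rw [← Complex.conj_mul', ← Complex.conj_mul' τ, hτn]
    have hPd := hP.deriv_ne_zero hbb
    have hu0 : u ≠ 0 := by rw [← norm_pos_iff, hun]; exact one_pos
    have hrc : (r : ℂ) ≠ 0 := by exact_mod_cast hr0.ne'
    have hAc : (‖A‖ : ℂ) ≠ 0 := by exact_mod_cast hA'.ne'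
    have hτ' : -τ = r * u := by rw [hτ, neg_neg]
    rw [hτ']
    nth_rewrite 1 [hAu]
    field_simp
  rw [e, Complex.re_ofReal_mul]
  refine mul_nonneg ?_ key
  have : 0 < 1 - ‖b‖ ^ 2 := by nlinarith [norm_nonneg b]
  have : 0 < 1 - r ^ 2 := by nlinarith
  positivity

/-- The strict horodisk condition is open in A, so A may be replaced by A / (1 - t X̄) with a small
t > 0. The weak inequality then reads Re X ≥ t |X|², and X ≠ 0 because P is injective. -/
lemma IsConformalMap.re_div_pos_of_mem_horodisk {P : ℂ → ℂ} {Ω : Set ℂ}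
    (hP : IsConformalMap P Ω) (hΩ : Convex ℝ Ω) {a b A : ℂ} (ha : ‖a‖ < 1) (hb : ‖b‖ < 1)
    (hab : a ≠ b) (hA : A ≠ 0)
    (hS : ‖A‖ < (1 - ‖b‖ ^ 2) * (A / (b - a)).re + (A * conj b).re) :
    0 < ((P b - P a) / (deriv P b * A)).re := by
  have hbb : b ∈ ball (0 : ℂ) 1 := mem_ball_zero_iff.2 hb
  set X := (P b - P a) / (deriv P b * A) with hX
  have hX0 : X ≠ 0 := by
    refine div_ne_zero (sub_ne_zero.2 fun h => hab ?_) (mul_ne_zero (hP.deriv_ne_zero hbb) hA)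
    exact (hP.2.injOn hbb (mem_ball_zero_iff.2 ha) h).symm
  have hc : ContinuousAt (fun t : ℝ => A / (1 - t * conj X)) 0 :=
    ContinuousAt.div (by fun_prop) (by fun_prop) (by simp)
  have hc' : ContinuousAt (fun t : ℝ => (1 - ‖b‖ ^ 2) * ((A / (1 - t * conj X)) / (b - a)).re +
      ((A / (1 - t * conj X)) * conj b).re - ‖A / (1 - t * conj X)‖) 0 := by
    have h1 := Complex.continuous_re.continuousAt.comp (hc.div_const (b - a))
    have h2 := Complex.continuous_re.continuousAt.comp (hc.mul_const (conj b))
    exact ((h1.const_mul (1 - ‖b‖ ^ 2)).add h2).sub hc.norm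
  have hev : ∀ᶠ t : ℝ in 𝓝 0, 0 < (1 - ‖b‖ ^ 2) * ((A / (1 - t * conj X)) / (b - a)).re +
      ((A / (1 - t * conj X)) * conj b).re - ‖A / (1 - t * conj X)‖ :=
    hc'.tendsto.eventually_const_lt (by simpa using hS)
  have hne : ∀ᶠ t : ℝ in 𝓝 0, (1 - t * conj X : ℂ) ≠ 0 :=
    (show ContinuousAt (fun t : ℝ => (1 - t * conj X : ℂ)) 0 by fun_prop).eventually_ne (by simp)
  obtain ⟨t, ⟨h1, h2⟩, h3⟩ := (((hev.and hne).filter_mono nhdsWithin_le_nhds).and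
    (self_mem_nhdsWithin (s := Ioi (0 : ℝ)))).exists
  have h3' : 0 < t := h3
  have key := hP.re_div_nonneg_of_mem_horodisk hΩ ha hb hab (div_ne_zero hA h2) (sub_pos.1 h1)
  have e : (P b - P a) / (deriv P b * (A / (1 - t * conj X))) = X - ((t * ‖X‖ ^ 2 : ℝ) : ℂ) := by
    have hPd := hP.deriv_ne_zero hbb
    have e1 : (P b - P a) / (deriv P b * (A / (1 - t * conj X))) = X * (1 - t * conj X) := by
      rw [hX]; field_simp
    rw [e1]
    push_cast
    rw [← Complex.conj_mul']
    ring
  rw [e, Complex.sub_re, Complex.ofReal_re] at key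
  have := norm_pos_iff.2 hX0
  have : 0 < t * ‖X‖ ^ 2 := by positivity
  linarith

/-- The second coefficient of a convex map is at most the first one. -/
lemma IsConformalMap.norm_deriv_deriv_zero_le {P : ℂ → ℂ} {Ω : Set ℂ} (hP : IsConformalMap P Ω)
    (hΩ : Convex ℝ Ω) : ‖deriv (deriv P) 0‖ ≤ 2 * ‖deriv P 0‖ := by
  obtain ⟨R, hRd, hRm, hPR, hR⟩ := hP.exists_inverse
  have h0 : (0 : ℂ) ∈ ball (0 : ℂ) 1 := mem_ball_self one_pos
  have hneg : ∀ z ∈ ball (0 : ℂ) 1, -z ∈ ball (0 : ℂ) 1 := fun z hz => by simpa using hz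
  have hmid : ∀ z ∈ ball (0 : ℂ) 1, (P z + P (-z)) / 2 ∈ Ω := fun z hz => by
    have := hΩ (hP.2.mapsTo hz) (hP.2.mapsTo (hneg z hz)) (show (0 : ℝ) ≤ 1 / 2 by norm_num)
      (show (0 : ℝ) ≤ 1 / 2 by norm_num) (by norm_num)
    convert this using 1
    simp only [Complex.real_smul]
    push_cast
    ring
  -- Pulling back midpoints of P(z) and P(-z) gives a self-map of the disk whose expansion starts
  -- with (P''(0) / 2P'(0)) z². Cauchy's estimate on circles of radius r → 1 bounds that coefficient
  -- by one.
  set c : ℂ → ℂ := fun z => R ((P z + P (-z)) / 2) with hc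
  have hcd : DifferentiableOn ℂ c (ball 0 1) :=
    hRd.comp ((hP.1.add (hP.1.comp (by fun_prop) hneg)).div_const 2) hmid
  have hcm : MapsTo c (ball 0 1) (ball 0 1) := fun z hz => hRm (hmid z hz)
  have hc0 : c 0 = 0 := by simp [hc, hR 0 h0]
  have hP' : DifferentiableOn ℂ (deriv P) (ball 0 1) := hP.1.deriv isOpen_ball
  have hc' : DifferentiableOn ℂ (deriv c) (ball 0 1) := hcd.deriv isOpen_ball
  have hat : ∀ {f : ℂ → ℂ}, DifferentiableOn ℂ f (ball 0 1) → ∀ z ∈ ball (0 : ℂ) 1,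
      HasDerivAt f (deriv f z) z := fun hf z hz =>
    (hf.differentiableAt (isOpen_ball.mem_nhds hz)).hasDerivAt
  have hfirst : ∀ z ∈ ball (0 : ℂ) 1,
      deriv P (c z) * deriv c z = (deriv P z - deriv P (-z)) / 2 := by
    intro z hz
    have h1 := (hat hP.1 (c z) (hcm hz)).comp z (hat hcd z hz)
    have h2 : HasDerivAt (fun z => (P z + P (-z)) / 2) ((deriv P z - deriv P (-z)) / 2) z := by
      have := ((hat hP.1 z hz).add ((hat hP.1 (-z) (hneg z hz)).comp z (hasDerivAt_neg z))).div_const 2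
      refine this.congr_deriv ?_
      ring
    refine h1.unique (h2.congr_of_eventuallyEq ?_)
    filter_upwards [isOpen_ball.mem_nhds hz] with y hy
    exact hPR _ (hmid y hy)
  have hc1 : deriv c 0 = 0 := by
    have := hfirst 0 h0
    rw [hc0, neg_zero, sub_self, zero_div] at this
    exact (mul_eq_zero.1 this).resolve_left (hP.deriv_ne_zero h0)
  have hsecond : deriv P 0 * deriv (deriv c) 0 = deriv (deriv P) 0 := by
    have h1 : HasDerivAt (fun z => deriv P (c z) * deriv c z)
        (deriv (deriv P) (c 0) * deriv c 0 * deriv c 0 + deriv P (c 0) * deriv (deriv c) 0) 0 :=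
      ((hat hP' (c 0) (hcm h0)).comp 0 (hat hcd 0 h0)).mul (hat hc' 0 h0)
    have h2 : HasDerivAt (fun z => (deriv P z - deriv P (-z)) / 2) (deriv (deriv P) 0) 0 := by
      have h3 : HasDerivAt (fun z => deriv P (-z)) (deriv (deriv P) 0 * -1) 0 := by
        refine HasDerivAt.comp (h₂ := deriv P) (h := fun z : ℂ => -z) 0 ?_ (hasDerivAt_neg 0)
        simpa using hat hP' 0 h0
      refine (((hat hP' 0 h0).sub h3).div_const 2).congr_deriv ?_
      ring
    have h4 := h1.unique (h2.congr_of_eventuallyEq (by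
      filter_upwards [isOpen_ball.mem_nhds h0] with y hy
      exact hfirst y hy))
    rwa [hc0, hc1, mul_zero, zero_add] at h4
  have hbound : ‖deriv (deriv c) 0‖ ≤ 2 := by
    have h1 : ∀ r ∈ Ioo (0 : ℝ) 1, ‖deriv (deriv c) 0‖ ≤ 2 / r ^ 2 := by
      intro r hr
      have hsub : closedBall (0 : ℂ) r ⊆ ball 0 1 := closedBall_subset_ball hr.2
      have := Complex.norm_iteratedDeriv_le_of_forall_mem_sphere_norm_le (c := 0) (C := 1) 2 hr.1
        (hcd.diffContOnCl_ball hsub)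
        (fun z hz => (mem_ball_zero_iff.1 (hcm (hsub (sphere_subset_closedBall hz)))).le)
      rw [iteratedDeriv_succ, iteratedDeriv_one] at this
      simpa using this
    have h2 : Tendsto (fun r : ℝ => 2 / r ^ 2) (𝓝[<] 1) (𝓝 (2 / 1 ^ 2)) :=
      (show ContinuousAt (fun r : ℝ => 2 / r ^ 2) 1 from
        ContinuousAt.div (by fun_prop) (by fun_prop) (by norm_num)).tendsto.mono_left
        nhdsWithin_le_nhds
    have h3 := ge_of_tendsto h2 (by
      filter_upwards [Ioo_mem_nhdsLT (show (0 : ℝ) < 1 by norm_num)] with r hr using h1 r hr)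
    simpa using h3
  rw [← hsecond, norm_mul]
  nlinarith [norm_nonneg (deriv P 0)]

/-- The coefficient bound at the origin, applied to the convex map P ∘ σ_b. -/
lemma IsConformalMap.norm_preSchwarzian_le {P : ℂ → ℂ} {Ω : Set ℂ} (hP : IsConformalMap P Ω)
    (hΩ : Convex ℝ Ω) {b : ℂ} (hb : ‖b‖ < 1) :
    ‖(1 - ‖b‖ ^ 2 : ℝ) * (deriv (deriv P) b / deriv P b) - 2 * conj b‖ ≤ 2 := by
  have hbb : b ∈ ball (0 : ℂ) 1 := mem_ball_zero_iff.2 hb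
  have h0 : (0 : ℂ) ∈ ball (0 : ℂ) 1 := mem_ball_self one_pos
  have h := (hP.comp_sigma hb).norm_deriv_deriv_zero_le hΩ
  have hP' : DifferentiableOn ℂ (deriv P) (ball 0 1) := hP.1.deriv isOpen_ball
  have hs : ∀ z ∈ ball (0 : ℂ) 1,
      HasDerivAt (sigma b) ((1 - conj b * b) / (1 + conj b * z) ^ 2) z := fun z hz =>
    hasDerivAt_sigma (norm_mul_norm_lt_one hb (mem_ball_zero_iff.1 hz).le)
  have h1 : ∀ z ∈ ball (0 : ℂ) 1, deriv (fun z => P (sigma b z)) z =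
      deriv P (sigma b z) * ((1 - conj b * b) / (1 + conj b * z) ^ 2) := fun z hz =>
    ((hP.hasDerivAt (mapsTo_sigma hb hz)).comp z (hs z hz)).deriv
  have h2 : HasDerivAt (fun z : ℂ => (1 - conj b * b) / (1 + conj b * z) ^ 2)
      (-2 * conj b * (1 - conj b * b)) 0 := by
    have h3 := ((((hasDerivAt_id (0 : ℂ)).const_mul (conj b)).const_add 1).fun_pow 2)
    have := (hasDerivAt_const (0 : ℂ) (1 - conj b * b)).fun_div h3 (by simp)
    refine this.congr_deriv ?_
    simp
    ring
  have h4 : HasDerivAt (fun z => deriv P (sigma b z)) (deriv (deriv P) b * (1 - conj b * b)) 0 := by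
    have h5 : HasDerivAt (deriv P) (deriv (deriv P) b) (sigma b 0) := by
      rw [sigma_zero]
      exact (hP'.differentiableAt (isOpen_ball.mem_nhds hbb)).hasDerivAt
    refine (h5.comp 0 (hs 0 h0)).congr_deriv ?_
    simp
  have h5 : deriv (deriv fun z => P (sigma b z)) 0 = deriv (deriv P) b * (1 - conj b * b) ^ 2 -
      2 * conj b * (1 - conj b * b) * deriv P b := by
    have : deriv (fun z => P (sigma b z)) =ᶠ[𝓝 0]
        fun z => deriv P (sigma b z) * ((1 - conj b * b) / (1 + conj b * z) ^ 2) := by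
      filter_upwards [isOpen_ball.mem_nhds h0] with z hz using h1 z hz
    rw [this.deriv_eq, (h4.fun_mul h2).deriv, sigma_zero]
    simp
    ring
  have hPd := hP.deriv_ne_zero hbb
  have hbn := one_sub_conj_mul_self_ne_zero hb
  rw [h5, h1 0 h0, sigma_zero] at h
  have e : ((1 - ‖b‖ ^ 2 : ℝ) * (deriv (deriv P) b / deriv P b) - 2 * conj b) *
      (deriv P b * (1 - conj b * b)) = deriv (deriv P) b * (1 - conj b * b) ^ 2 -
      2 * conj b * (1 - conj b * b) * deriv P b := by
    rw [Complex.ofReal_sub, ← conj_mul_self, Complex.ofReal_one]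
    field_simp
  rw [← e, norm_mul] at h
  simp only [mul_zero, add_zero, one_pow, div_one] at h
  exact le_of_mul_le_mul_right h (norm_pos_iff.2 (mul_ne_zero hPd hbn))


/-! ### Propagation of the horodisk condition -/

/-- `a` lies in the closed horodisk through `b` with inner normal `-A` at `b`. -/
def MemHorodisk (b a A : ℂ) : Prop :=
  ‖A‖ ≤ (1 - ‖b‖ ^ 2) * (A / (b - a)).re + (A * conj b).re

lemma re_mul_conj_le (A b : ℂ) : (A * conj b).re ≤ ‖A‖ * ‖b‖ := by
  refine (Complex.re_le_norm _).trans ?_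
  rw [norm_mul, RCLike.norm_conj]

lemma half_le_re_div_sub {a b : ℂ} (hab : ‖a‖ ≤ ‖b‖) (hne : a ≠ b) : 1 ≤ 2 * (b / (b - a)).re := by
  have hd : b - a ≠ 0 := sub_ne_zero.2 hne.symm
  have hn : 0 < Complex.normSq (b - a) := Complex.normSq_pos.2 hd
  have hab2 : Complex.normSq a ≤ Complex.normSq b := by
    rw [Complex.normSq_eq_norm_sq, Complex.normSq_eq_norm_sq]
    exact pow_le_pow_left₀ (norm_nonneg a) hab 2
  rw [Complex.div_re, ← add_div, mul_div_assoc', le_div_iff₀ hn]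
  simp only [Complex.normSq_apply, Complex.sub_re, Complex.sub_im] at *
  nlinarith

/-- Since Re(b / (b - a)) ≥ 1/2, the right side is at least (1 + |b|²)/2 ≥ |b|. This starts the
induction with b = ε and a = ψ(ζ); the case |b| = 1 is included. -/
lemma memHorodisk_self {a b : ℂ} (hab : ‖a‖ ≤ ‖b‖) (hb : ‖b‖ ≤ 1) (hne : a ≠ b) :
    MemHorodisk b a b := by
  have h := half_le_re_div_sub hab hne
  have h2 : (b * conj b).re = ‖b‖ ^ 2 := by rw [mul_comm, conj_mul_self, Complex.ofReal_re]
  rw [MemHorodisk, h2]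
  nlinarith [norm_nonneg b, mul_nonneg (show 0 ≤ 1 - ‖b‖ ^ 2 by nlinarith [norm_nonneg b])
    (sub_nonneg.2 h), sq_nonneg (1 - ‖b‖)]

lemma MemHorodisk.norm_le {a b A : ℂ} (h : MemHorodisk b a A) (hb : ‖b‖ < 1) :
    ‖A‖ ≤ 2 * (A / (b - a)).re := by
  have h1 := re_mul_conj_le A b
  rw [MemHorodisk] at h
  have h2 : ‖A‖ * (1 - ‖b‖) ≤ (1 + ‖b‖) * (A / (b - a)).re * (1 - ‖b‖) := by nlinarith
  have h3 : ‖A‖ ≤ (1 + ‖b‖) * (A / (b - a)).re := le_of_mul_le_mul_right h2 (by linarith)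
  nlinarith [norm_nonneg A, norm_nonneg b]

lemma MemHorodisk.ne {a b A : ℂ} (h : MemHorodisk b a A) (hb : ‖b‖ < 1) (hA : A ≠ 0) : a ≠ b := by
  rintro rfl
  have := h.norm_le hb
  simp only [sub_self, div_zero, Complex.zero_re, mul_zero] at this
  exact absurd (norm_pos_iff.2 hA) (not_lt.2 this)

/-- The new right side is |z|² times that of `h` plus (1 - |z|²) Re(A / (b - a)). It is therefore at
least |A| (1 + |z|²)/2, which exceeds |z| |A| by |A| (1 - |z|)²/2. The second hypothesis follows
from the first only when |b| < 1, and b = ε may have modulus one. -/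
lemma MemHorodisk.mul_left {a b A z : ℂ} (h : MemHorodisk b a A) (h' : ‖A‖ ≤ 2 * (A / (b - a)).re)
    (hA : A ≠ 0) (hz : ‖z‖ < 1) (hz0 : z ≠ 0) :
    ‖z * A‖ < (1 - ‖z * b‖ ^ 2) * (z * A / (z * b - z * a)).re + (z * A * conj (z * b)).re := by
  have e1 : z * A / (z * b - z * a) = A / (b - a) := by
    rw [← mul_sub, mul_div_mul_left _ _ hz0]
  have e2 : (z * A * conj (z * b)).re = ‖z‖ ^ 2 * (A * conj b).re := by
    rw [← Complex.re_ofReal_mul, ← conj_mul_self, map_mul]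
    congr 1; ring
  rw [e1, e2, norm_mul, norm_mul]
  rw [MemHorodisk] at h
  have hA' := norm_pos_iff.2 hA
  have h1 := mul_le_mul_of_nonneg_left h (sq_nonneg ‖z‖)
  have h2 := mul_le_mul_of_nonneg_left h' (show 0 ≤ 1 - ‖z‖ ^ 2 by nlinarith [norm_nonneg z])
  have h3 : 0 < ‖A‖ * (1 - ‖z‖) ^ 2 := by
    have : 0 < 1 - ‖z‖ := by linarith
    positivity
  nlinarith

lemma norm_deriv_sigma {c b : ℂ} (hc : ‖c‖ < 1) :
    ‖(1 - conj c * c) / (1 + conj c * b) ^ 2‖ = (1 - ‖c‖ ^ 2) / ‖1 + conj c * b‖ ^ 2 := by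
  rw [norm_div, norm_pow, conj_mul_self, ← Complex.ofReal_one, ← Complex.ofReal_sub,
    Complex.norm_real, Real.norm_of_nonneg (by nlinarith [norm_nonneg c])]

lemma conj_one_add_conj_mul (c b : ℂ) : conj (1 + conj c * b) = 1 + c * conj b := by
  simp

lemma sigma_sub_sigma {c x y : ℂ} (hx : 1 + conj c * x ≠ 0) (hy : 1 + conj c * y ≠ 0) :
    sigma c x - sigma c y =
      (1 - conj c * c) * (x - y) / ((1 + conj c * x) * (1 + conj c * y)) := by
  rw [sigma, sigma, div_sub_div _ _ hx hy]
  congr 1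
  ring

/-- Horodisks are conformally invariant: if A is transported as a tangent vector, both sides are
multiplied by S = |σ_c'(b)|. -/
lemma MemHorodisk.comp_sigma {a b A c : ℂ} (h : MemHorodisk b a A) (ha : ‖a‖ ≤ 1) (hb : ‖b‖ < 1)
    (hc : ‖c‖ < 1) (hA : A ≠ 0) :
    MemHorodisk (sigma c b) (sigma c a) ((1 - conj c * c) / (1 + conj c * b) ^ 2 * A) := by
  have hab := h.ne hb hA
  have hda := one_add_conj_mul_ne_zero (norm_mul_norm_lt_one hc ha)
  have hdb := one_add_conj_mul_ne_zero (norm_mul_norm_lt_one hc hb.le)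
  have hdb' : 1 + c * conj b ≠ 0 := by
    rw [← conj_one_add_conj_mul]; exact (map_ne_zero _).2 hdb
  have hcc := one_sub_conj_mul_self_ne_zero hc
  have hba : b - a ≠ 0 := sub_ne_zero.2 hab.symm
  have hσ : (1 - ‖sigma c b‖ ^ 2) =
      (1 - ‖c‖ ^ 2) / ‖1 + conj c * b‖ ^ 2 * (1 - ‖b‖ ^ 2) := by
    have h1 := one_sub_norm_sigma_sq (norm_mul_norm_lt_one hc hb.le)
    have : ‖1 + conj c * b‖ ≠ 0 := norm_ne_zero_iff.2 hdb
    field_simp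
    linarith
  set S := (1 - ‖c‖ ^ 2) / ‖1 + conj c * b‖ ^ 2 with hS
  have hS0 : 0 ≤ S := by
    have : 0 ≤ 1 - ‖c‖ ^ 2 := by nlinarith [norm_nonneg c]
    positivity
  have hSc : (S : ℂ) = (1 - conj c * c) / ((1 + conj c * b) * (1 + c * conj b)) := by
    rw [hS, Complex.ofReal_div, Complex.ofReal_sub, ← conj_mul_self, ← conj_mul_self,
      conj_one_add_conj_mul, Complex.ofReal_one, mul_comm (1 + c * conj b)]
  rw [MemHorodisk, norm_mul, norm_deriv_sigma hc, ← hS, hσ, ← Complex.re_ofReal_mul,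
    ← Complex.add_re]
  have e : ((S * (1 - ‖b‖ ^ 2) : ℝ) : ℂ) * ((1 - conj c * c) / (1 + conj c * b) ^ 2 * A /
      (sigma c b - sigma c a)) + (1 - conj c * c) / (1 + conj c * b) ^ 2 * A * conj (sigma c b) =
      (S : ℂ) * (((1 - ‖b‖ ^ 2 : ℝ) : ℂ) * (A / (b - a)) + A * conj b) := by
    rw [sigma_sub_sigma hdb hda, Complex.ofReal_mul, hSc, Complex.ofReal_sub, ← conj_mul_self,
      Complex.ofReal_one, sigma, map_div₀, conj_one_add_conj_mul, map_add]
    generalize conj c = c' at *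
    generalize conj b = b' at *
    field_simp
    ring
  rw [e, Complex.re_ofReal_mul, Complex.add_re, Complex.re_ofReal_mul]
  exact mul_le_mul_of_nonneg_left h hS0

/-- The infinitesimal counterpart of `MemHorodisk`: `w` and `B` are the value and the logarithmic
derivative `z w'` of a self-map of the disk, and `E` is `z s' / s` for a nonvanishing `s`. -/
def HorodiskBound (w B E : ℂ) : Prop :=
  2 * ‖B‖ ≤ (1 - ‖w‖ ^ 2) * E.re + 2 * (conj w * B).re

lemma re_conj_mul_le (w B : ℂ) : (conj w * B).re ≤ ‖w‖ * ‖B‖ := by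
  refine (Complex.re_le_norm _).trans ?_
  rw [norm_mul, RCLike.norm_conj]

lemma HorodiskBound.norm_le {w B E : ℂ} (h : HorodiskBound w B E) (hw : ‖w‖ < 1) : ‖B‖ ≤ E.re := by
  have h1 := re_conj_mul_le w B
  rw [HorodiskBound] at h
  have h2 : 2 * ‖B‖ * (1 - ‖w‖) ≤ (1 + ‖w‖) * E.re * (1 - ‖w‖) := by nlinarith
  have h3 : 2 * ‖B‖ ≤ (1 + ‖w‖) * E.re := le_of_mul_le_mul_right h2 (by linarith)
  nlinarith [norm_nonneg B, norm_nonneg w]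

/-- Replacing w by zw and s by zs turns B into z(w + B) and E into 1 + E. Weighting the hypotheses
by |z|² and 1 - |z|² leaves a margin of at least (1 - |z||w|)² + |B| (1 - |z|)², and the first
square makes it strict. -/
lemma HorodiskBound.mul_left {w B E z : ℂ} (h : HorodiskBound w B E) (h' : ‖B‖ ≤ E.re)
    (hw : ‖w‖ ≤ 1) (hz : ‖z‖ < 1) :
    2 * ‖z * (w + B)‖ <
      (1 - ‖z * w‖ ^ 2) * (1 + E).re + 2 * (conj (z * w) * (z * (w + B))).re := by
  have e : (conj (z * w) * (z * (w + B))).re = ‖z‖ ^ 2 * (‖w‖ ^ 2 + (conj w * B).re) := by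
    have : conj (z * w) * (z * (w + B)) = (conj z * z) * (conj w * w + conj w * B) := by
      rw [map_mul]; ring
    rw [this, conj_mul_self, conj_mul_self, Complex.re_ofReal_mul, Complex.add_re,
      Complex.ofReal_re]
  rw [e, norm_mul, norm_mul, Complex.add_re, Complex.one_re]
  rw [HorodiskBound] at h
  have hn := norm_add_le w B
  have h1 := mul_le_mul_of_nonneg_left h (sq_nonneg ‖z‖)
  have h2 := mul_le_mul_of_nonneg_left h' (show 0 ≤ 1 - ‖z‖ ^ 2 by nlinarith [norm_nonneg z])
  have h3 := mul_le_mul_of_nonneg_left hn (norm_nonneg z)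
  have h4 : 0 ≤ ‖B‖ * (1 - ‖z‖) ^ 2 := by positivity
  have h5 : ‖z‖ * ‖w‖ < 1 := by nlinarith [norm_nonneg z, norm_nonneg w]
  have h6 : 0 < (1 - ‖z‖ * ‖w‖) ^ 2 := by
    have : 0 < 1 - ‖z‖ * ‖w‖ := by linarith
    positivity
  nlinarith

/-- Here s is multiplied by σ_c'(w), whose logarithmic derivative is the correction to E. As in the
finite version, both sides scale by |σ_c'(w)|. -/
lemma HorodiskBound.comp_sigma {w B E c : ℂ} (h : HorodiskBound w B E) (hw : ‖w‖ < 1)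
    (hc : ‖c‖ < 1) :
    HorodiskBound (sigma c w) ((1 - conj c * c) / (1 + conj c * w) ^ 2 * B)
      (E - 2 * conj c * B / (1 + conj c * w)) := by
  have hdb := one_add_conj_mul_ne_zero (norm_mul_norm_lt_one hc hw.le)
  have hdb' : 1 + c * conj w ≠ 0 := by
    rw [← conj_one_add_conj_mul]; exact (map_ne_zero _).2 hdb
  have hσ : (1 - ‖sigma c w‖ ^ 2) =
      (1 - ‖c‖ ^ 2) / ‖1 + conj c * w‖ ^ 2 * (1 - ‖w‖ ^ 2) := by
    have h1 := one_sub_norm_sigma_sq (norm_mul_norm_lt_one hc hw.le)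
    have : ‖1 + conj c * w‖ ≠ 0 := norm_ne_zero_iff.2 hdb
    field_simp
    linarith
  set S := (1 - ‖c‖ ^ 2) / ‖1 + conj c * w‖ ^ 2 with hS
  have hS0 : 0 ≤ S := by
    have : 0 ≤ 1 - ‖c‖ ^ 2 := by nlinarith [norm_nonneg c]
    positivity
  have hSc : (S : ℂ) = (1 - conj c * c) / ((1 + conj c * w) * (1 + c * conj w)) := by
    rw [hS, Complex.ofReal_div, Complex.ofReal_sub, ← conj_mul_self, ← conj_mul_self,
      conj_one_add_conj_mul, Complex.ofReal_one, mul_comm (1 + c * conj w)]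
  rw [HorodiskBound] at *
  rw [norm_mul, norm_deriv_sigma hc, ← hS, hσ, ← Complex.re_ofReal_mul]
  have e2 : ∀ x : ℂ, 2 * x.re = (2 * x).re := fun x => by simp
  rw [e2, ← Complex.add_re]
  have e : ((S * (1 - ‖w‖ ^ 2) : ℝ) : ℂ) * (E - 2 * conj c * B / (1 + conj c * w)) +
      2 * (conj (sigma c w) * ((1 - conj c * c) / (1 + conj c * w) ^ 2 * B)) =
      (S : ℂ) * (((1 - ‖w‖ ^ 2 : ℝ) : ℂ) * E + 2 * (conj w * B)) := by
    rw [Complex.ofReal_mul, hSc, Complex.ofReal_sub, ← conj_mul_self,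
      Complex.ofReal_one, sigma, map_div₀, conj_one_add_conj_mul, map_add]
    generalize conj c = c' at *
    generalize conj w = b' at *
    field_simp
    ring
  rw [e, Complex.re_ofReal_mul, Complex.add_re, Complex.re_ofReal_mul, ← e2]
  nlinarith [mul_le_mul_of_nonneg_left h hS0]


/-! ### The derivative of Q in ε and its multivalent convexity -/

/-- The derivative of `sigma c`. -/
noncomputable def sigmaDeriv (c u : ℂ) : ℂ := (1 - conj c * c) / (1 + conj c * u) ^ 2

lemma sigmaDeriv_ne_zero {c u : ℂ} (hc : ‖c‖ < 1) (hu : ‖u‖ ≤ 1) : sigmaDeriv c u ≠ 0 :=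
  div_ne_zero (one_sub_conj_mul_self_ne_zero hc)
    (pow_ne_zero 2 (one_add_conj_mul_ne_zero (norm_mul_norm_lt_one hc hu)))

lemma hasDerivAt_sigmaDeriv {c u : ℂ} (h : ‖c‖ * ‖u‖ < 1) :
    HasDerivAt (sigmaDeriv c) (sigmaDeriv c u * (-2 * conj c / (1 + conj c * u))) u := by
  have hne := one_add_conj_mul_ne_zero h
  have h3 := ((((hasDerivAt_id u).const_mul (conj c)).const_add 1).fun_pow 2)
  have := (hasDerivAt_const u (1 - conj c * c)).fun_div h3 (pow_ne_zero 2 hne)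
  refine this.congr_deriv ?_
  simp only [id, sigmaDeriv]
  push_cast
  field_simp
  ring

/-- The function with first Schur parameters `γ₁, γ₂` and remaining Schur function `ψ`. -/
noncomputable def schurTower (γ₁ γ₂ : ℂ) (ψ : ℂ → ℂ) (z : ℂ) : ℂ :=
  sigma γ₁ (z * sigma γ₂ (z * ψ z))

lemma norm_mul_lt_one_of_mem_ball {z w : ℂ} (hz : z ∈ ball (0 : ℂ) 1) (hw : ‖w‖ ≤ 1) :
    ‖z * w‖ < 1 := by
  rw [mem_ball_zero_iff] at hz
  rw [norm_mul]
  nlinarith [norm_nonneg z, norm_nonneg w]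

lemma norm_sigma_mul_sigma_lt {γ₂ z u : ℂ} (h₂ : ‖γ₂‖ < 1) (hz : z ∈ ball (0 : ℂ) 1) (hu : ‖u‖ ≤ 1) :
    ‖z * sigma γ₂ u‖ < 1 :=
  norm_mul_lt_one_of_mem_ball hz (norm_sigma_le_one h₂ hu)

lemma norm_schurTower_lt_one {γ₁ γ₂ : ℂ} {ψ : ℂ → ℂ} (h₁ : ‖γ₁‖ < 1) (h₂ : ‖γ₂‖ < 1) {z : ℂ}
    (hz : z ∈ ball (0 : ℂ) 1) (hψ : ‖z * ψ z‖ < 1) : ‖schurTower γ₁ γ₂ ψ z‖ < 1 :=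
  norm_sigma_lt_one h₁ (norm_sigma_mul_sigma_lt h₂ hz hψ.le)

lemma DifferentiableOn.sigma_comp {c : ℂ} {u : ℂ → ℂ} (hc : ‖c‖ < 1)
    (hu : DifferentiableOn ℂ u (ball 0 1)) (hu1 : ∀ z ∈ ball (0 : ℂ) 1, ‖u z‖ < 1) :
    DifferentiableOn ℂ (fun z => sigma c (u z)) (ball 0 1) :=
  (differentiableOn_sigma hc).comp hu fun z hz => mem_ball_zero_iff.2 (hu1 z hz)

lemma differentiableOn_schurTower {γ₁ γ₂ : ℂ} {ψ : ℂ → ℂ} (h₁ : ‖γ₁‖ < 1) (h₂ : ‖γ₂‖ < 1)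
    (hψ : DifferentiableOn ℂ ψ (ball 0 1)) (hψ1 : ∀ z ∈ ball (0 : ℂ) 1, ‖ψ z‖ ≤ 1) :
    DifferentiableOn ℂ (schurTower γ₁ γ₂ ψ) (ball 0 1) := by
  have h3 : DifferentiableOn ℂ (fun z => sigma γ₂ (z * ψ z)) (ball 0 1) :=
    DifferentiableOn.sigma_comp h₂ (differentiableOn_id.mul hψ)
      fun z hz => norm_mul_lt_one_of_mem_ball hz (hψ1 z hz)
  exact DifferentiableOn.sigma_comp h₁ (differentiableOn_id.mul h3) fun z hz =>
    norm_sigma_mul_sigma_lt h₂ hz (norm_mul_lt_one_of_mem_ball hz (hψ1 z hz)).le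

/-- `ζ⁻³ ∂P(ω)/∂ε` for `ω(ζ) = ζ σ_{γ₁}(ζ σ_{γ₂}(ζ ε))`. -/
noncomputable def varKernel (P : ℂ → ℂ) (γ₁ γ₂ ε z : ℂ) : ℂ :=
  deriv P (z * sigma γ₁ (z * sigma γ₂ (z * ε))) *
    (sigmaDeriv γ₁ (z * sigma γ₂ (z * ε)) * sigmaDeriv γ₂ (z * ε))

/-- By the preSchwarzian bound, (1 - |w|²) P''/P' differs from 2w̄ by at most 2 in modulus. The
hypothesis is what remains after the worst case. -/
lemma IsConformalMap.re_pos_of_horodiskBound {P : ℂ → ℂ} {Ω : Set ℂ} (hP : IsConformalMap P Ω)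
    (hΩ : Convex ℝ Ω) {w B E : ℂ} (hw : ‖w‖ < 1)
    (h : 2 * ‖B‖ < (1 - ‖w‖ ^ 2) * E.re + 2 * (conj w * B).re) :
    0 < (B * (deriv (deriv P) w / deriv P w) + E).re := by
  have hx := hP.norm_preSchwarzian_le hΩ hw
  set x := ((1 - ‖w‖ ^ 2 : ℝ) : ℂ) * (deriv (deriv P) w / deriv P w) - 2 * conj w with hxdef
  have hw2 : 0 < 1 - ‖w‖ ^ 2 := by nlinarith [norm_nonneg w]
  have e : (1 - ‖w‖ ^ 2) * (B * (deriv (deriv P) w / deriv P w) + E).re =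
      (B * x).re + 2 * (conj w * B).re + (1 - ‖w‖ ^ 2) * E.re := by
    rw [← Complex.re_ofReal_mul, ← Complex.re_ofReal_mul, ← Complex.re_ofReal_mul, ← Complex.add_re, ← Complex.add_re,
      hxdef]
    congr 1
    push_cast
    ring
  have h1 : -(2 * ‖B‖) ≤ (B * x).re := by
    have h2 := (abs_le.1 (Complex.abs_re_le_norm (B * x))).1
    rw [norm_mul] at h2
    nlinarith [norm_nonneg B]
  refine pos_of_mul_pos_right (a := 1 - ‖w‖ ^ 2) ?_ hw2.le
  rw [e]
  linarith

lemma hasDerivAt_varKernel {P : ℂ → ℂ} {Ω : Set ℂ} (hP : IsConformalMap P Ω) {γ₁ γ₂ ε z : ℂ}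
    (h₁ : ‖γ₁‖ < 1) (h₂ : ‖γ₂‖ < 1) (hε : ‖ε‖ ≤ 1) (hz : z ∈ ball (0 : ℂ) 1) :
    let u₂ := z * ε
    let w₂ := sigma γ₂ u₂
    let u₁ := z * w₂
    let w₁ := sigma γ₁ u₁
    let du₁ := w₂ + z * (sigmaDeriv γ₂ u₂ * ε)
    let dw := w₁ + z * (sigmaDeriv γ₁ u₁ * du₁)
    HasDerivAt (varKernel P γ₁ γ₂ ε) (varKernel P γ₁ γ₂ ε z *
      (dw * (deriv (deriv P) (z * w₁) / deriv P (z * w₁)) - 2 * conj γ₁ * du₁ / (1 + conj γ₁ * u₁)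
        - 2 * conj γ₂ * ε / (1 + conj γ₂ * u₂))) z := by
  intro u₂ w₂ u₁ w₁ du₁ dw
  have hu₂ : ‖u₂‖ < 1 := norm_mul_lt_one_of_mem_ball hz hε
  have hu₁ : ‖u₁‖ < 1 := norm_sigma_mul_sigma_lt h₂ hz hu₂.le
  have hw₁ : ‖w₁‖ < 1 := norm_sigma_lt_one h₁ hu₁
  have hw : z * w₁ ∈ ball (0 : ℂ) 1 := mem_ball_zero_iff.2 (norm_mul_lt_one_of_mem_ball hz hw₁.le)
  have d1 : HasDerivAt (fun z : ℂ => z * ε) ε z := by simpa using (hasDerivAt_id z).mul_const ε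
  have d2 : HasDerivAt (fun z => sigma γ₂ (z * ε)) (sigmaDeriv γ₂ u₂ * ε) z :=
    (hasDerivAt_sigma (norm_mul_norm_lt_one h₂ hu₂.le)).comp (h₂ := sigma γ₂)
      (h := fun z => z * ε) z d1
  have d3 : HasDerivAt (fun z => z * sigma γ₂ (z * ε)) du₁ z := by
    simpa using (hasDerivAt_id z).fun_mul d2
  have d4 : HasDerivAt (fun z => sigma γ₁ (z * sigma γ₂ (z * ε))) (sigmaDeriv γ₁ u₁ * du₁) z :=
    (hasDerivAt_sigma (norm_mul_norm_lt_one h₁ hu₁.le)).comp (h₂ := sigma γ₁)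
      (h := fun z => z * sigma γ₂ (z * ε)) z d3
  have d5 : HasDerivAt (fun z => z * sigma γ₁ (z * sigma γ₂ (z * ε))) dw z := by
    simpa using (hasDerivAt_id z).fun_mul d4
  have d6 : HasDerivAt (fun z => deriv P (z * sigma γ₁ (z * sigma γ₂ (z * ε))))
      (deriv (deriv P) (z * w₁) * dw) z :=
    ((hP.1.deriv isOpen_ball).differentiableAt (isOpen_ball.mem_nhds hw)).hasDerivAt.comp
      (h := fun z => z * sigma γ₁ (z * sigma γ₂ (z * ε))) z d5
  have d7 : HasDerivAt (fun z => sigmaDeriv γ₁ (z * sigma γ₂ (z * ε))) _ z :=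
    (hasDerivAt_sigmaDeriv (norm_mul_norm_lt_one h₁ hu₁.le)).comp
      (h := fun z => z * sigma γ₂ (z * ε)) z d3
  have d8 : HasDerivAt (fun z => sigmaDeriv γ₂ (z * ε)) _ z :=
    (hasDerivAt_sigmaDeriv (norm_mul_norm_lt_one h₂ hu₂.le)).comp (h := fun z => z * ε) z d1
  refine (d6.fun_mul (d7.fun_mul d8)).congr_deriv ?_
  have hPd := hP.deriv_ne_zero hw
  have n1 := one_add_conj_mul_ne_zero (norm_mul_norm_lt_one h₁ hu₁.le)
  have n2 := one_add_conj_mul_ne_zero (norm_mul_norm_lt_one h₂ hu₂.le)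
  change deriv (deriv P) (z * w₁) * dw * (sigmaDeriv γ₁ u₁ * sigmaDeriv γ₂ u₂) +
    deriv P (z * w₁) * (sigmaDeriv γ₁ u₁ * (-2 * conj γ₁ / (1 + conj γ₁ * u₁)) * du₁ *
      sigmaDeriv γ₂ u₂ + sigmaDeriv γ₁ u₁ *
      (sigmaDeriv γ₂ u₂ * (-2 * conj γ₂ / (1 + conj γ₂ * u₂)) * ε)) =
    deriv P (z * w₁) * (sigmaDeriv γ₁ u₁ * sigmaDeriv γ₂ u₂) * _
  field_simp
  ring

lemma varKernel_ne_zero {P : ℂ → ℂ} {Ω : Set ℂ} (hP : IsConformalMap P Ω) {γ₁ γ₂ ε z : ℂ}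
    (h₁ : ‖γ₁‖ < 1) (h₂ : ‖γ₂‖ < 1) (hε : ‖ε‖ ≤ 1) (hz : z ∈ ball (0 : ℂ) 1) :
    varKernel P γ₁ γ₂ ε z ≠ 0 := by
  have hu₂ : ‖z * ε‖ < 1 := norm_mul_lt_one_of_mem_ball hz hε
  have hu₁ := norm_sigma_mul_sigma_lt h₂ hz hu₂.le
  exact mul_ne_zero (hP.deriv_ne_zero (mem_ball_zero_iff.2
    (norm_mul_lt_one_of_mem_ball hz (norm_sigma_lt_one h₁ hu₁).le)))
    (mul_ne_zero (sigmaDeriv_ne_zero h₁ hu₁.le) (sigmaDeriv_ne_zero h₂ hu₂.le))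

lemma differentiableOn_varKernel {P : ℂ → ℂ} {Ω : Set ℂ} (hP : IsConformalMap P Ω) {γ₁ γ₂ ε : ℂ}
    (h₁ : ‖γ₁‖ < 1) (h₂ : ‖γ₂‖ < 1) (hε : ‖ε‖ ≤ 1) :
    DifferentiableOn ℂ (varKernel P γ₁ γ₂ ε) (ball 0 1) := fun _ hz =>
  (hasDerivAt_varKernel hP h₁ h₂ hε hz).differentiableAt.differentiableWithinAt

/-- Three multiplications by z and two automorphisms carry the constant ε, with B = E = 0, to ω(z).
The quantity E then accumulates the logarithmic derivative of ∂ω/∂ε, in which z³ contributes the 3,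
and B P''/P' adds that of P'(ω). -/
lemma re_varKernel_pos {P : ℂ → ℂ} {Ω : Set ℂ} (hP : IsConformalMap P Ω) (hΩ : Convex ℝ Ω)
    {γ₁ γ₂ ε z : ℂ} (h₁ : ‖γ₁‖ < 1) (h₂ : ‖γ₂‖ < 1) (hε : ‖ε‖ ≤ 1) (hz : z ∈ ball (0 : ℂ) 1) :
    0 < ((2 : ℕ) + 1 + z * deriv (varKernel P γ₁ γ₂ ε) z / varKernel P γ₁ γ₂ ε z).re := by
  have hz1 := mem_ball_zero_iff.1 hz
  have hu₂ : ‖z * ε‖ < 1 := norm_mul_lt_one_of_mem_ball hz hε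
  have hu₁ := norm_sigma_mul_sigma_lt h₂ hz hu₂.le
  have hw₂ := norm_sigma_lt_one h₂ hu₂
  have hw₁ := norm_sigma_lt_one h₁ hu₁
  have b0 : HorodiskBound ε 0 0 := by simp [HorodiskBound]
  have b1 : HorodiskBound (z * ε) (z * (ε + 0)) (1 + 0) := (b0.mul_left (by simp) hε hz1).le
  have b2 := b1.comp_sigma hu₂ h₂
  have b3 : HorodiskBound _ _ _ := (b2.mul_left (b2.norm_le hw₂) hw₂.le hz1).le
  have b4 := b3.comp_sigma hu₁ h₁
  have b5 := b4.mul_left (b4.norm_le hw₁) hw₁.le hz1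
  have key := hP.re_pos_of_horodiskBound hΩ (norm_mul_lt_one_of_mem_ball hz hw₁.le) b5
  convert key using 2
  rw [(hasDerivAt_varKernel hP h₁ h₂ hε hz).deriv]
  have hk := varKernel_ne_zero hP h₁ h₂ hε hz
  rw [mul_left_comm, mul_div_cancel_left₀ _ hk]
  simp only [sigmaDeriv]
  push_cast
  ring

/-! ### The half-plane inequality -/

/-- M is the mean of f' over the segment from y to x. It makes the difference quotient analytic also
where x and y coincide, so that the factor ζ³ can be divided out at the origin. -/
lemma exists_secant {f x y : ℂ → ℂ} (hf : DifferentiableOn ℂ f (ball 0 1))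
    (hx : DifferentiableOn ℂ x (ball 0 1)) (hy : DifferentiableOn ℂ y (ball 0 1))
    (hxm : MapsTo x (ball 0 1) (ball 0 1)) (hym : MapsTo y (ball 0 1) (ball 0 1)) :
    ∃ M : ℂ → ℂ, DifferentiableOn ℂ M (ball 0 1) ∧ ∀ z ∈ ball (0 : ℂ) 1,
      f (x z) - f (y z) = (x z - y z) * M z ∧ (x z = y z → M z = deriv f (x z)) := by
  have hseg : ∀ z ∈ ball (0 : ℂ) 1, ∀ t ∈ Icc (0 : ℝ) 1,
      y z + t * (x z - y z) ∈ ball (0 : ℂ) 1 := fun z hz t ht => by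
    have := (convex_ball (0 : ℂ) 1).add_smul_sub_mem (hym hz) (hxm hz) ht
    simpa using this
  have hf' := hf.deriv isOpen_ball
  have hat : ∀ {f : ℂ → ℂ}, DifferentiableOn ℂ f (ball 0 1) → ∀ z ∈ ball (0 : ℂ) 1,
      HasDerivAt f (deriv f z) z := fun hf z hz =>
    (hf.differentiableAt (isOpen_ball.mem_nhds hz)).hasDerivAt
  have hpath : ∀ z, ContinuousOn (fun t : ℝ => y z + t * (x z - y z)) (Icc 0 1) := fun z => by
    fun_prop
  have hcomp : ∀ {g : ℂ → ℂ}, DifferentiableOn ℂ g (ball 0 1) →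
      ContinuousOn (fun p : ℂ × ℝ => g p.1) (ball 0 1 ×ˢ Icc 0 1) := fun hg =>
    hg.continuousOn.comp continuousOn_fst fun p hp => hp.1
  have ht : ContinuousOn (fun p : ℂ × ℝ => (p.2 : ℂ)) (ball (0 : ℂ) 1 ×ˢ Icc (0 : ℝ) 1) := by fun_prop
  refine ⟨fun z => ∫ t in (0 : ℝ)..1, deriv f (y z + t * (x z - y z)), fun z hz => ?_,
    fun z hz => ⟨?_, fun h => ?_⟩⟩
  · refine (hasDerivAt_integral_of_continuousOn
      (G := fun z (t : ℝ) => deriv f (y z + t * (x z - y z)))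
      (G' := fun z (t : ℝ) => deriv (deriv f) (y z + t * (x z - y z)) *
        (deriv y z + t * (deriv x z - deriv y z))) isOpen_ball ?_ ?_ ?_
      hz).differentiableAt.differentiableWithinAt
    · exact fun w hw => hf'.continuousOn.comp (hpath w) (hseg w hw)
    · refine ContinuousOn.mul ((hf'.deriv isOpen_ball).continuousOn.comp
        ((hcomp hy).add (ht.mul ((hcomp hx).sub (hcomp hy)))) fun p hp => hseg _ hp.1 _ hp.2) ?_
      exact (hcomp (hy.deriv isOpen_ball)).add
        (ht.mul ((hcomp (hx.deriv isOpen_ball)).sub (hcomp (hy.deriv isOpen_ball))))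
    · intro w hw t ht
      exact (hat hf' _ (hseg w hw t ht)).comp (h := fun w => y w + t * (x w - y w)) w
        ((hat hy w hw).add (((hat hx w hw).sub (hat hy w hw)).const_mul (t : ℂ)))
  · have hftc := intervalIntegral.integral_eq_sub_of_hasDerivAt (a := (0 : ℝ)) (b := 1)
      (f := fun t : ℝ => f (y z + t * (x z - y z)))
      (f' := fun t : ℝ => (x z - y z) * deriv f (y z + t * (x z - y z))) ?_ ?_
    · rw [intervalIntegral.integral_const_mul] at hftc
      rw [hftc]
      simp
    · intro t ht
      rw [uIcc_of_le zero_le_one] at ht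
      have h1 : HasDerivAt (fun t : ℂ => y z + t * (x z - y z)) (x z - y z) (t : ℂ) := by
        simpa using ((hasDerivAt_id (t : ℂ)).mul_const (x z - y z)).const_add (y z)
      refine ((hat hf _ (hseg z hz t ht)).comp (h := fun t : ℂ => y z + t * (x z - y z))
        (t : ℂ) h1).comp_ofReal.congr_deriv ?_
      ring
    · refine ContinuousOn.intervalIntegrable ?_
      rw [uIcc_of_le zero_le_one]
      exact continuousOn_const.mul (hf'.continuousOn.comp (hpath z) (hseg z hz))
  · simp [h]

/-- `f'' / f'` for the function `f` with `1 + z f''(z) / f'(z) = P (z w(z))`. -/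
noncomputable def preSchwarzian (P w : ℂ → ℂ) (z : ℂ) : ℂ := w z * dslope P 0 (z * w z)

lemma mul_preSchwarzian {P : ℂ → ℂ} (hP0 : P 0 = 1) (w : ℂ → ℂ) (z : ℂ) :
    z * preSchwarzian P w z = P (z * w z) - 1 := by
  have := sub_smul_dslope P 0 (z * w z)
  rw [sub_zero, hP0, smul_eq_mul] at this
  rw [← this, preSchwarzian, mul_assoc]

lemma differentiableOn_dslope_zero {P : ℂ → ℂ} (hP : DifferentiableOn ℂ P (ball 0 1)) :
    DifferentiableOn ℂ (dslope P 0) (ball 0 1) :=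
  (Complex.differentiableOn_dslope (ball_mem_nhds 0 one_pos)).2 hP

lemma differentiableOn_preSchwarzian {P w : ℂ → ℂ} (hP : DifferentiableOn ℂ P (ball 0 1))
    (hw : DifferentiableOn ℂ w (ball 0 1)) (hw1 : ∀ z ∈ ball (0 : ℂ) 1, ‖w z‖ ≤ 1) :
    DifferentiableOn ℂ (preSchwarzian P w) (ball 0 1) :=
  hw.mul ((differentiableOn_dslope_zero hP).comp (differentiableOn_id.mul hw)
    fun z hz => mem_ball_zero_iff.2 (norm_mul_lt_one_of_mem_ball hz (hw1 z hz)))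

/-- The endpoint t = 0 is a null set. This matters because `0⁻¹ = 0` gives the integrand of
`logIntegral` the value 0 at the origin instead of its limit. -/
lemma integralTo_congr {F G : ℂ → ℂ} {z : ℂ} (hz : z ≠ 0)
    (h : ∀ t ∈ Ioc (0 : ℝ) 1, (t : ℂ) * z ≠ 0 → F (t * z) = G (t * z)) :
    integralTo F z = integralTo G z := by
  rw [integralTo, integralTo]
  congr 1
  refine intervalIntegral.integral_congr_ae (ae_of_all _ fun t ht => ?_)
  rw [uIoc_of_le zero_le_one] at ht
  exact h t ht (mul_ne_zero (by exact_mod_cast ht.1.ne') hz)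

lemma logIntegral_eq_integralTo {P : ℂ → ℂ} (hP0 : P 0 = 1) (w : ℂ → ℂ) (z : ℂ) :
    logIntegral P (fun ζ => ζ * w ζ) z = integralTo (preSchwarzian P w) z := by
  rcases eq_or_ne z 0 with rfl | hz
  · simp [logIntegral, integralTo]
  · refine integralTo_congr hz fun t _ h0 => ?_
    rw [← mul_preSchwarzian hP0, inv_mul_cancel_left₀ h0]

/-- The half-plane inequality behind the description of the variability region. -/
lemma re_logIntegral_sub_div_pos {P : ℂ → ℂ} {Ω : Set ℂ} (hP : IsConformalMap P Ω)
    (hΩ : Convex ℝ Ω) (hP0 : P 0 = 1) {γ₁ γ₂ ε z : ℂ} (h₁ : ‖γ₁‖ < 1) (h₂ : ‖γ₂‖ < 1)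
    (hε : ‖ε‖ ≤ 1) (hε0 : ε ≠ 0) {ψ : ℂ → ℂ} (hψ : DifferentiableOn ℂ ψ (ball 0 1))
    (hψ1 : ∀ ζ ∈ ball (0 : ℂ) 1, ‖ψ ζ‖ ≤ ‖ε‖) (hψε : ∀ ζ ∈ ball (0 : ℂ) 1, ψ ζ ≠ ε)
    (hz : z ∈ ball (0 : ℂ) 1) (hz0 : z ≠ 0) :
    0 < ((integralTo (preSchwarzian P (schurTower γ₁ γ₂ fun _ => ε)) z -
      integralTo (preSchwarzian P (schurTower γ₁ γ₂ ψ)) z) /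
      (ε * (z ^ 3 * weightedMean 2 (varKernel P γ₁ γ₂ ε) z))).re := by
  have hψ1' : ∀ ζ ∈ ball (0 : ℂ) 1, ‖ψ ζ‖ ≤ 1 := fun ζ hζ => (hψ1 ζ hζ).trans hε
  have hε1' : ∀ ζ ∈ ball (0 : ℂ) 1, ‖(fun _ : ℂ => ε) ζ‖ ≤ 1 := fun ζ _ => hε
  have hεd : DifferentiableOn ℂ (fun _ : ℂ => ε) (ball 0 1) := differentiableOn_const ε
  have hmaps : ∀ {ψ : ℂ → ℂ}, (∀ ζ ∈ ball (0 : ℂ) 1, ‖ψ ζ‖ ≤ 1) → ∀ ζ ∈ ball (0 : ℂ) 1,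
      ‖schurTower γ₁ γ₂ ψ ζ‖ < 1 := fun h ζ hζ =>
    norm_schurTower_lt_one h₁ h₂ hζ (norm_mul_lt_one_of_mem_ball hζ (h ζ hζ))
  have hx := differentiableOn_id.mul (differentiableOn_schurTower h₁ h₂ hεd hε1')
  have hy := differentiableOn_id.mul (differentiableOn_schurTower h₁ h₂ hψ hψ1')
  obtain ⟨M, hMd, hM⟩ := exists_secant hP.1 hx hy
    (fun ζ hζ => mem_ball_zero_iff.2 (norm_mul_lt_one_of_mem_ball hζ (hmaps hε1' ζ hζ).le))
    (fun ζ hζ => mem_ball_zero_iff.2 (norm_mul_lt_one_of_mem_ball hζ (hmaps hψ1' ζ hζ).le))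
  simp only [Pi.mul_apply, id] at hM
  set D₂ : ℂ → ℂ → ℂ := fun v ζ => 1 + conj γ₂ * (ζ * v) with hD₂
  set D₁ : ℂ → ℂ → ℂ := fun v ζ => 1 + conj γ₁ * (ζ * sigma γ₂ (ζ * v)) with hD₁
  have hD₂0 : ∀ v ζ, ζ ∈ ball (0 : ℂ) 1 → ‖v‖ ≤ 1 → D₂ v ζ ≠ 0 := fun v ζ hζ hv =>
    one_add_conj_mul_ne_zero (norm_mul_norm_lt_one h₂ (norm_mul_lt_one_of_mem_ball hζ hv).le)
  have hD₁0 : ∀ v ζ, ζ ∈ ball (0 : ℂ) 1 → ‖v‖ ≤ 1 → D₁ v ζ ≠ 0 := fun v ζ hζ hv =>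
    one_add_conj_mul_ne_zero (norm_mul_norm_lt_one h₁
      (norm_sigma_mul_sigma_lt h₂ hζ (norm_mul_lt_one_of_mem_ball hζ hv).le).le)
  -- η is the difference of the two values of P(ω) divided by ε ζ³: each factor ζ of ω and each
  -- difference of `sigma` values is extracted explicitly, which shows that η is analytic at 0.
  set η : ℂ → ℂ := fun ζ => (1 - conj γ₁ * γ₁) * (1 - conj γ₂ * γ₂) * ((ε - ψ ζ) / ε) /
    (D₁ ε ζ * D₁ (ψ ζ) ζ * (D₂ ε ζ * D₂ (ψ ζ) ζ)) * M ζ with hη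
  have hdiff : ∀ ζ ∈ ball (0 : ℂ) 1, P (ζ * schurTower γ₁ γ₂ (fun _ => ε) ζ) -
      P (ζ * schurTower γ₁ γ₂ ψ ζ) = ε * (ζ ^ 3 * η ζ) := by
    intro ζ hζ
    have a1 := hD₁0 ε ζ hζ hε
    have a2 := hD₁0 (ψ ζ) ζ hζ (hψ1' ζ hζ)
    have a3 := hD₂0 ε ζ hζ hε
    have a4 := hD₂0 (ψ ζ) ζ hζ (hψ1' ζ hζ)
    rw [(hM ζ hζ).1, ← mul_sub]
    simp only [schurTower]
    rw [sigma_sub_sigma a1 a2, ← mul_sub, sigma_sub_sigma a3 a4, ← mul_sub, hη]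
    change ζ * ((1 - conj γ₁ * γ₁) * (ζ * ((1 - conj γ₂ * γ₂) * (ζ * (ε - ψ ζ)) /
      (D₂ ε ζ * D₂ (ψ ζ) ζ))) / (D₁ ε ζ * D₁ (ψ ζ) ζ)) * M ζ = _
    field_simp
  have hηd : DifferentiableOn ℂ η (ball 0 1) := by
    have s2 : ∀ {ψ : ℂ → ℂ}, DifferentiableOn ℂ ψ (ball 0 1) →
        (∀ ζ ∈ ball (0 : ℂ) 1, ‖ψ ζ‖ ≤ 1) → DifferentiableOn ℂ (fun ζ => D₂ (ψ ζ) ζ) (ball 0 1) :=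
      fun h _ => (differentiableOn_const _).add ((differentiableOn_const _).mul
        (differentiableOn_id.mul h))
    have s1 : ∀ {ψ : ℂ → ℂ}, DifferentiableOn ℂ ψ (ball 0 1) →
        (∀ ζ ∈ ball (0 : ℂ) 1, ‖ψ ζ‖ ≤ 1) → DifferentiableOn ℂ (fun ζ => D₁ (ψ ζ) ζ) (ball 0 1) :=
      fun h h1 => (differentiableOn_const _).add ((differentiableOn_const _).mul
        (differentiableOn_id.mul (DifferentiableOn.sigma_comp h₂ (differentiableOn_id.mul h)
          fun ζ hζ => norm_mul_lt_one_of_mem_ball hζ (h1 ζ hζ))))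
    refine DifferentiableOn.mul (DifferentiableOn.div ((differentiableOn_const _).mul
      (((differentiableOn_const _).sub hψ).div_const ε))
      (((s1 hεd hε1').mul (s1 hψ hψ1')).mul ((s2 hεd hε1').mul (s2 hψ hψ1'))) fun ζ hζ => ?_) hMd
    exact mul_ne_zero (mul_ne_zero (hD₁0 ε ζ hζ hε) (hD₁0 (ψ ζ) ζ hζ (hψ1' ζ hζ)))
      (mul_ne_zero (hD₂0 ε ζ hζ hε) (hD₂0 (ψ ζ) ζ hζ (hψ1' ζ hζ)))
  have hpos : ∀ ζ ∈ ball (0 : ℂ) 1, 0 < (η ζ / varKernel P γ₁ γ₂ ε ζ).re := by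
    intro ζ hζ
    have hk := varKernel_ne_zero hP h₁ h₂ hε hζ
    rcases eq_or_ne ζ 0 with rfl | hζ0
    -- At the origin both values of ω are 0 and the horodisk comparison degenerates; only the inner
    -- quotient of ε and ψ(0) survives.
    · have e : η 0 / varKernel P γ₁ γ₂ ε 0 = (ε - ψ 0) / ε := by
        have hM0 := (hM 0 hζ).2 (by simp)
        have hd0 := hP.deriv_ne_zero hζ
        have n1 := one_sub_conj_mul_self_ne_zero h₁
        have n2 := one_sub_conj_mul_self_ne_zero h₂
        rw [div_eq_iff hk, hη]
        simp only [hD₁, hD₂, varKernel, sigmaDeriv, hM0, zero_mul, mul_zero, add_zero, mul_one,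
          div_one, one_pow]
        ring
      have hne : ε - ψ 0 ≠ 0 := sub_ne_zero.2 (hψε 0 hζ).symm
      have h3 := half_le_re_div_sub (hψ1 0 hζ) (hψε 0 hζ)
      rw [e, ← inv_div, Complex.inv_re]
      have : 0 < Complex.normSq (ε / (ε - ψ 0)) := Complex.normSq_pos.2 (div_ne_zero hε0 hne)
      exact div_pos (by linarith) this
    · have hζ1 := mem_ball_zero_iff.1 hζ
      have hu₂ : ‖ζ * ε‖ < 1 := norm_mul_lt_one_of_mem_ball hζ hε
      have hu₁ := norm_sigma_mul_sigma_lt h₂ hζ hu₂.le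
      have hw₂ := norm_sigma_lt_one h₂ hu₂
      have hw₁ := norm_sigma_lt_one h₁ hu₁
      have hv₂ : ‖ζ * ψ ζ‖ < 1 := norm_mul_lt_one_of_mem_ball hζ (hψ1' ζ hζ)
      have hv₁ := norm_sigma_mul_sigma_lt h₂ hζ hv₂.le
      have b0 := memHorodisk_self (hψ1 ζ hζ) hε (hψε ζ hζ)
      have hb0 : ‖ε‖ ≤ 2 * (ε / (ε - ψ ζ)).re :=
        hε.trans (half_le_re_div_sub (hψ1 ζ hζ) (hψε ζ hζ))
      have b1 : MemHorodisk (ζ * ε) (ζ * ψ ζ) (ζ * ε) := (b0.mul_left hb0 hε0 hζ1 hζ0).le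
      have n1 : ζ * ε ≠ 0 := mul_ne_zero hζ0 hε0
      have b2 := b1.comp_sigma hv₂.le hu₂ h₂ n1
      have n2 : sigmaDeriv γ₂ (ζ * ε) * (ζ * ε) ≠ 0 :=
        mul_ne_zero (sigmaDeriv_ne_zero h₂ hu₂.le) n1
      have b3 : MemHorodisk _ _ _ := (b2.mul_left (b2.norm_le hw₂) n2 hζ1 hζ0).le
      have n3 := mul_ne_zero hζ0 n2
      have b4 := b3.comp_sigma hv₁.le hu₁ h₁ n3
      have n4 := mul_ne_zero (sigmaDeriv_ne_zero h₁ hu₁.le) n3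
      have b5 := b4.mul_left (b4.norm_le hw₁) n4 hζ1 hζ0
      have hbn := norm_mul_lt_one_of_mem_ball hζ hw₁.le
      -- The transported vector is now A = ε ∂b/∂ε, so P'(b) A = ε ζ³ κ(ζ), with κ the kernel
      -- `varKernel`.
      have key := hP.re_div_pos_of_mem_horodisk hΩ
        (norm_mul_lt_one_of_mem_ball hζ (norm_sigma_lt_one h₁ hv₁).le) hbn
        (MemHorodisk.ne b5.le hbn (mul_ne_zero hζ0 n4)) (mul_ne_zero hζ0 n4) b5
      have hd := hdiff ζ hζ
      simp only [schurTower] at hd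
      rw [hd] at key
      convert key using 2
      have hd0 := hP.deriv_ne_zero (mem_ball_zero_iff.2 hbn)
      have m1 := sigmaDeriv_ne_zero h₁ hu₁.le
      have m2 := sigmaDeriv_ne_zero h₂ hu₂.le
      change _ = ε * (ζ ^ 3 * η ζ) / (deriv P (ζ * sigma γ₁ (ζ * sigma γ₂ (ζ * ε))) *
        (ζ * (sigmaDeriv γ₁ (ζ * sigma γ₂ (ζ * ε)) *
          (ζ * (sigmaDeriv γ₂ (ζ * ε) * (ζ * ε))))))
      rw [varKernel]
      field_simp
  have hfinal := re_weightedMean_div_weightedMean_pos (n := 2) (differentiableOn_varKernel hP h₁ h₂ hε) hηd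
    (fun ζ hζ => varKernel_ne_zero hP h₁ h₂ hε hζ)
    (fun ζ hζ _ => re_varKernel_pos hP hΩ h₁ h₂ hε hζ) hpos z hz
  have hsub : integralTo (preSchwarzian P (schurTower γ₁ γ₂ fun _ => ε)) z -
      integralTo (preSchwarzian P (schurTower γ₁ γ₂ ψ)) z = ε * (z ^ 3 * weightedMean 2 η z) := by
    have hint : ∀ {ψ : ℂ → ℂ}, DifferentiableOn ℂ ψ (ball 0 1) →
        (∀ ζ ∈ ball (0 : ℂ) 1, ‖ψ ζ‖ ≤ 1) →
        IntervalIntegrable (fun t : ℝ => preSchwarzian P (schurTower γ₁ γ₂ ψ) (t * z))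
          volume 0 1 := fun h h1 => by
      refine ContinuousOn.intervalIntegrable ?_
      rw [uIcc_of_le zero_le_one]
      exact (differentiableOn_preSchwarzian hP.1 (differentiableOn_schurTower h₁ h₂ h h1)
        fun ζ hζ => (hmaps h1 ζ hζ).le).continuousOn.comp (by fun_prop)
        fun t ht => ofReal_mul_mem_ball hz ht
    rw [integralTo, integralTo, ← mul_sub,
      ← intervalIntegral.integral_sub (hint hεd hε1') (hint hψ hψ1'), weightedMean]
    have e : ∀ t ∈ Ι (0 : ℝ) 1, preSchwarzian P (schurTower γ₁ γ₂ fun _ => ε) (t * z) -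
        preSchwarzian P (schurTower γ₁ γ₂ ψ) (t * z) = ε * z ^ 2 * ((t : ℂ) ^ 2 * η (t * z)) := by
      intro t ht
      rw [uIoc_of_le zero_le_one] at ht
      have h0 : (t : ℂ) * z ≠ 0 := mul_ne_zero (by exact_mod_cast ht.1.ne') hz0
      refine mul_left_cancel₀ h0 ?_
      rw [mul_sub, mul_preSchwarzian hP0, mul_preSchwarzian hP0, sub_sub_sub_cancel_right,
        hdiff _ (ofReal_mul_mem_ball hz ⟨ht.1.le, ht.2⟩)]
      ring
    rw [intervalIntegral.integral_congr_ae (ae_of_all _ e), intervalIntegral.integral_const_mul]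
    ring
  rw [hsub, mul_div_mul_left _ _ hε0, mul_div_mul_left _ _ (pow_ne_zero 3 hz0)]
  exact hfinal


/-! ### Schur functions and their first two coefficients -/

/-- The Schur class: analytic functions on the unit disk bounded by one. -/
def IsSchur (w : ℂ → ℂ) : Prop :=
  DifferentiableOn ℂ w (ball 0 1) ∧ ∀ z ∈ ball (0 : ℂ) 1, ‖w z‖ ≤ 1

lemma isSchur_const {c : ℂ} (hc : ‖c‖ ≤ 1) : IsSchur fun _ => c :=
  ⟨differentiableOn_const c, fun _ _ => hc⟩

lemma IsSchur.congr {v w : ℂ → ℂ} (hw : IsSchur w) (h : ∀ z ∈ ball (0 : ℂ) 1, v z = w z) :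
    IsSchur v :=
  ⟨hw.1.congr h, fun z hz => by rw [h z hz]; exact hw.2 z hz⟩

lemma zero_mem_ball : (0 : ℂ) ∈ ball (0 : ℂ) 1 := mem_ball_self one_pos

lemma IsSchur.eq_of_norm_eq_one {w : ℂ → ℂ} (hw : IsSchur w) {y : ℂ} (hy : y ∈ ball (0 : ℂ) 1)
    (h : ‖w y‖ = 1) : ∀ z ∈ ball (0 : ℂ) 1, w z = w y := by
  refine Complex.eqOn_of_isPreconnected_of_isMaxOn_norm (convex_ball (0 : ℂ) 1).isPreconnected
    isOpen_ball hw.1 hy fun z hz => ?_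
  simpa [h] using hw.2 z hz

lemma dslope_zero_schur {w : ℂ → ℂ} (hw : DifferentiableOn ℂ w (ball 0 1))
    (hm : MapsTo w (ball 0 1) (ball 0 1)) (h0 : w 0 = 0) :
    IsSchur (dslope w 0) ∧ ∀ z, z * dslope w 0 z = w z := by
  refine ⟨⟨differentiableOn_dslope_zero hw, fun z hz => ?_⟩, fun z => ?_⟩
  · have := Complex.norm_dslope_le_div_of_mapsTo_ball hw (R₂ := 1)
      (by rw [h0]; exact hm.mono_right ball_subset_closedBall) hz
    simpa using this
  · have := sub_smul_dslope w 0 z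
    simpa [h0] using this

/-- One step of the Schur algorithm. -/
lemma IsSchur.exists_eq_sigma {w : ℂ → ℂ} (hw : IsSchur w) (h0 : ‖w 0‖ < 1) :
    ∃ v, IsSchur v ∧ ∀ z ∈ ball (0 : ℂ) 1, w z = sigma (w 0) (z * v z) := by
  -- By the maximum principle a value of modulus one would make w constant, against |w(0)| < 1.
  have hlt : ∀ z ∈ ball (0 : ℂ) 1, ‖w z‖ < 1 := fun z hz => by
    refine lt_of_le_of_ne (hw.2 z hz) fun h => ?_
    have := hw.eq_of_norm_eq_one hz h 0 zero_mem_ball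
    rw [this, h] at h0
    exact lt_irrefl _ h0
  have h0' : ‖-w 0‖ < 1 := by simpa using h0
  obtain ⟨hs, he⟩ := dslope_zero_schur (w := fun z => sigma (-w 0) (w z))
    (DifferentiableOn.sigma_comp h0' hw.1 hlt)
    (fun z hz => mem_ball_zero_iff.2 (norm_sigma_lt_one h0' (hlt z hz))) (by simp [sigma])
  refine ⟨_, hs, fun z hz => ?_⟩
  rw [he z, sigma_neg_sigma h0 (hlt z hz).le]

lemma IsSchur.sigma_mul {v : ℂ → ℂ} (hv : IsSchur v) {c : ℂ} (hc : ‖c‖ < 1) :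
    IsSchur fun z => sigma c (z * v z) := by
  have h1 : ∀ z ∈ ball (0 : ℂ) 1, ‖z * v z‖ < 1 := fun z hz =>
    norm_mul_lt_one_of_mem_ball hz (hv.2 z hz)
  exact ⟨DifferentiableOn.sigma_comp hc (differentiableOn_id.mul hv.1) h1,
    fun z hz => norm_sigma_le_one hc (h1 z hz).le⟩

lemma IsSchur.deriv_sigma_mul {v w : ℂ → ℂ} (hv : IsSchur v) {c : ℂ}
    (h : ∀ z ∈ ball (0 : ℂ) 1, w z = sigma c (z * v z)) :
    w 0 = c ∧ deriv w 0 = (1 - conj c * c) * v 0 := by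
  refine ⟨by rw [h 0 zero_mem_ball, zero_mul, sigma_zero], ?_⟩
  have h1 : HasDerivAt (fun z => z * v z) (v 0) 0 := by
    simpa using (hasDerivAt_id (0 : ℂ)).fun_mul
      (hv.1.differentiableAt (isOpen_ball.mem_nhds zero_mem_ball)).hasDerivAt
  have h2 : HasDerivAt (sigma c) (1 - conj c * c) (0 * v 0) := by
    refine (hasDerivAt_sigma (by simp)).congr_deriv ?_
    simp
  have h3 := h2.comp (h := fun z => z * v z) 0 h1
  refine (h3.congr_of_eventuallyEq ?_).deriv
  filter_upwards [isOpen_ball.mem_nhds zero_mem_ball] with z hz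
  exact h z hz

lemma ofReal_one_sub_norm_sq (c : ℂ) : ((1 - ‖c‖ ^ 2 : ℝ) : ℂ) = 1 - conj c * c := by
  rw [Complex.ofReal_sub, ← conj_mul_self, Complex.ofReal_one]

/-- The first two coefficients of Schur functions. -/
lemma exists_isSchur_iff (c₀ c₁ : ℂ) :
    (∃ w, IsSchur w ∧ w 0 = c₀ ∧ deriv w 0 = c₁) ↔ ‖c₀‖ ^ 2 + ‖c₁‖ ≤ 1 := by
  constructor
  · rintro ⟨w, hw, rfl, rfl⟩
    rcases (hw.2 0 zero_mem_ball).lt_or_eq with h | h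
    · obtain ⟨v, hv, he⟩ := hw.exists_eq_sigma h
      rw [(hv.deriv_sigma_mul he).2, norm_mul, ← ofReal_one_sub_norm_sq, Complex.norm_real,
        Real.norm_of_nonneg (by nlinarith [norm_nonneg (w 0)])]
      have hp : 0 ≤ 1 - ‖w 0‖ ^ 2 := by nlinarith [norm_nonneg (w 0)]
      nlinarith [mul_le_mul_of_nonneg_left (hv.2 0 zero_mem_ball) hp]
    · have h1 : w =ᶠ[𝓝 0] fun _ => w 0 := by
        filter_upwards [isOpen_ball.mem_nhds zero_mem_ball] with z hz
        exact hw.eq_of_norm_eq_one zero_mem_ball h z hz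
      rw [h1.deriv_eq, h]
      simp
  · intro h
    have hle : ‖c₀‖ ≤ 1 := by nlinarith [norm_nonneg c₀, norm_nonneg c₁]
    rcases hle.lt_or_eq with h1 | h1
    · have hpos : 0 < 1 - ‖c₀‖ ^ 2 := by nlinarith [norm_nonneg c₀]
      have hne := one_sub_conj_mul_self_ne_zero h1
      have hv : IsSchur fun _ => c₁ / (1 - conj c₀ * c₀) := by
        refine isSchur_const ?_
        rw [norm_div, ← ofReal_one_sub_norm_sq, Complex.norm_real, Real.norm_of_nonneg hpos.le,
          div_le_one hpos]
        linarith
      refine ⟨_, hv.sigma_mul h1, (hv.deriv_sigma_mul fun z _ => rfl).1, ?_⟩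
      rw [(hv.deriv_sigma_mul fun z _ => rfl).2, mul_div_cancel₀ _ hne]
    · refine ⟨fun _ => c₀, isSchur_const hle, rfl, ?_⟩
      rw [h1] at h
      have : ‖c₁‖ = 0 := le_antisymm (by linarith) (norm_nonneg c₁)
      rw [norm_eq_zero.1 this]
      simp

/-! ### The correspondence between CV(Ω) and Schur functions -/

lemma integralTo_congr_ball {F G : ℂ → ℂ} (h : ∀ z ∈ ball (0 : ℂ) 1, F z = G z) {z : ℂ}
    (hz : z ∈ ball (0 : ℂ) 1) : integralTo F z = integralTo G z := by
  rcases eq_or_ne z 0 with rfl | h0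
  · simp [integralTo]
  · exact integralTo_congr h0 fun t ht _ => h _ (ofReal_mul_mem_ball hz ⟨ht.1.le, ht.2⟩)

/-- `log f'` for the function `f` with `1 + z f''(z) / f'(z) = P (z w(z))`. -/
noncomputable def logDerivOf (P w : ℂ → ℂ) (z : ℂ) : ℂ := integralTo (preSchwarzian P w) z

lemma logDerivOf_congr (P : ℂ → ℂ) {v w : ℂ → ℂ} (h : ∀ z ∈ ball (0 : ℂ) 1, v z = w z) {z : ℂ}
    (hz : z ∈ ball (0 : ℂ) 1) : logDerivOf P v z = logDerivOf P w z :=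
  integralTo_congr_ball (fun y hy => by rw [preSchwarzian, preSchwarzian, h y hy]) hz

lemma logDerivOf_zero (P w : ℂ → ℂ) : logDerivOf P w 0 = 0 := by simp [logDerivOf, integralTo]

section

variable {P w : ℂ → ℂ}

lemma IsSchur.differentiableOn_preSchwarzian (hw : IsSchur w)
    (hP : DifferentiableOn ℂ P (ball 0 1)) : DifferentiableOn ℂ (preSchwarzian P w) (ball 0 1) :=
  VariabilityRegion.differentiableOn_preSchwarzian hP hw.1 hw.2

lemma IsSchur.hasDerivAt_logDerivOf (hw : IsSchur w) (hP : DifferentiableOn ℂ P (ball 0 1)) {z : ℂ}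
    (hz : z ∈ ball (0 : ℂ) 1) : HasDerivAt (logDerivOf P w) (preSchwarzian P w z) z :=
  hasDerivAt_integralTo (hw.differentiableOn_preSchwarzian hP) hz

lemma IsSchur.differentiableOn_logDerivOf (hw : IsSchur w)
    (hP : DifferentiableOn ℂ P (ball 0 1)) : DifferentiableOn ℂ (logDerivOf P w) (ball 0 1) :=
  fun _ hz => (hw.hasDerivAt_logDerivOf hP hz).differentiableAt.differentiableWithinAt

/-- `f` is the function with `f(0) = 0`, `f'(0) = 1` and `1 + z f''(z) / f'(z) = P (z w(z))`. -/
def IsGeneratedBy (P w f : ℂ → ℂ) : Prop :=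
  ∀ z ∈ ball (0 : ℂ) 1, f z = integralTo (fun ζ => Complex.exp (logDerivOf P w ζ)) z

lemma IsGeneratedBy.hasDerivAt {f : ℂ → ℂ} (h : IsGeneratedBy P w f) (hw : IsSchur w)
    (hP : DifferentiableOn ℂ P (ball 0 1)) {z : ℂ} (hz : z ∈ ball (0 : ℂ) 1) :
    HasDerivAt f (Complex.exp (logDerivOf P w z)) z := by
  refine (hasDerivAt_integralTo (hw.differentiableOn_logDerivOf hP).cexp hz).congr_of_eventuallyEq ?_
  filter_upwards [isOpen_ball.mem_nhds hz] with y hy using h y hy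

lemma IsGeneratedBy.hasDerivAt_deriv {f : ℂ → ℂ} (h : IsGeneratedBy P w f) (hw : IsSchur w)
    (hP : DifferentiableOn ℂ P (ball 0 1)) {z : ℂ} (hz : z ∈ ball (0 : ℂ) 1) :
    HasDerivAt (deriv f) (Complex.exp (logDerivOf P w z) * preSchwarzian P w z) z := by
  refine (hw.hasDerivAt_logDerivOf hP hz).cexp.congr_of_eventuallyEq ?_
  filter_upwards [isOpen_ball.mem_nhds hz] with y hy using (h.hasDerivAt hw hP hy).deriv

lemma IsGeneratedBy.mem_CV {f : ℂ → ℂ} {Ω : Set ℂ} (h : IsGeneratedBy P w f) (hw : IsSchur w)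
    (hP : IsConformalMap P Ω) (hP0 : P 0 = 1) : f ∈ CV Ω := by
  refine ⟨fun z hz => (h.hasDerivAt hw hP.1 hz).differentiableAt.differentiableWithinAt, ?_, ?_,
    fun z hz => ⟨?_, ?_⟩⟩
  · simp [h 0 zero_mem_ball, integralTo]
  · rw [(h.hasDerivAt hw hP.1 zero_mem_ball).deriv, logDerivOf_zero, Complex.exp_zero]
  · rw [(h.hasDerivAt hw hP.1 hz).deriv]
    exact Complex.exp_ne_zero _
  · rw [(h.hasDerivAt hw hP.1 hz).deriv, (h.hasDerivAt_deriv hw hP.1 hz).deriv, mul_left_comm,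
      mul_div_cancel_left₀ _ (Complex.exp_ne_zero _), mul_preSchwarzian hP0, add_sub_cancel]
    exact hP.2.mapsTo (mem_ball_zero_iff.2 (norm_mul_lt_one_of_mem_ball hz (hw.2 z hz)))

/-- The function R(1 + z f''/f') is a self-map of the disk vanishing at 0, so Schwarz's lemma writes
it as z w(z) with w Schur. Then f' solves the linear equation y' = y · `preSchwarzian P w` with y(0)
= 1. -/
lemma exists_isGeneratedBy {f : ℂ → ℂ} {Ω : Set ℂ} (hP : IsConformalMap P Ω)
    (hP0 : P 0 = 1) (hf : f ∈ CV Ω) : ∃ w, IsSchur w ∧ IsGeneratedBy P w f := by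
  obtain ⟨hfd, hf0, hf1, hfΩ⟩ := hf
  obtain ⟨R, hRd, hRm, hPR, hR⟩ := hP.exists_inverse
  have hf' := hfd.deriv isOpen_ball
  have hf'' := hf'.deriv isOpen_ball
  obtain ⟨hw, he⟩ := dslope_zero_schur
    (w := fun z => R (1 + z * deriv (deriv f) z / deriv f z))
    (hRd.comp ((differentiableOn_const 1).add
      ((differentiableOn_id.mul hf'').div hf' fun z hz => (hfΩ z hz).1)) fun z hz => (hfΩ z hz).2)
    (fun z hz => hRm (hfΩ z hz).2)
    (by
      have := hR 0 zero_mem_ball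
      rw [hP0] at this
      simpa using this)
  set w := dslope (fun z => R (1 + z * deriv (deriv f) z / deriv f z)) 0
  have hne : ∀ z ∈ ball (0 : ℂ) 1, z ≠ 0 →
      deriv (deriv f) z = deriv f z * preSchwarzian P w z := fun z hz h0 => by
    have h1 := mul_preSchwarzian hP0 w z
    rw [he z, hPR _ (hfΩ z hz).2, add_sub_cancel_left] at h1
    have h2 := (hfΩ z hz).1
    field_simp at h1
    linear_combination -h1
  have hpre := hw.differentiableOn_preSchwarzian hP.1
  have hall : ∀ z ∈ ball (0 : ℂ) 1, deriv (deriv f) z = deriv f z * preSchwarzian P w z := by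
    intro z hz
    rcases eq_or_ne z 0 with rfl | h0
    -- At the origin the factor z cannot be cancelled; both sides are continuous and agree nearby.
    · have hn := isOpen_ball.mem_nhds hz
      have hc1 := (hf''.differentiableAt hn).continuousAt
      have hc2 := ((hf'.mul hpre).differentiableAt hn).continuousAt
      refine ((ContinuousAt.eventuallyEq_nhds_iff_eventuallyEq_nhdsNE hc1 hc2).1 ?_).eq_of_nhds
      filter_upwards [nhdsWithin_le_nhds hn, self_mem_nhdsWithin] with y hy hy0
      exact hne y hy hy0
    · exact hne z hz h0
  have hL := hw.differentiableOn_logDerivOf hP.1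
  have hexp : ∀ z ∈ ball (0 : ℂ) 1, deriv f z * Complex.exp (-logDerivOf P w z) = 1 := by
    refine eqOn_ball_of_deriv_eq (G := fun _ => 1) (hf'.mul hL.neg.cexp) (by fun_prop) ?_ ?_
    · simp [hf1, logDerivOf_zero]
    · intro z hz
      have h1 := (hf'.differentiableAt (isOpen_ball.mem_nhds hz)).hasDerivAt.fun_mul
        (hw.hasDerivAt_logDerivOf hP.1 hz).fun_neg.cexp
      rw [deriv_const]
      refine Eq.trans h1.deriv ?_
      rw [hall z hz]
      ring
  refine ⟨w, hw, fun z hz => ?_⟩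
  refine eqOn_ball_of_deriv_eq hfd (fun z hz => (hasDerivAt_integralTo hL.cexp
    hz).differentiableAt.differentiableWithinAt) (by simp [hf0, integralTo]) (fun z hz => ?_) z hz
  rw [(hasDerivAt_integralTo hL.cexp hz).deriv]
  have := hexp z hz
  rw [Complex.exp_neg] at this
  have h2 := Complex.exp_ne_zero (logDerivOf P w z)
  field_simp at this
  exact this

/-- The normalized branch is unique: exp L = f' determines L' = f''/f', and L(0) = 0 fixes the
constant. -/
lemma IsGeneratedBy.isLogDerivValue_iff {f : ℂ → ℂ} (h : IsGeneratedBy P w f) (hw : IsSchur w)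
    (hP : DifferentiableOn ℂ P (ball 0 1)) {z v : ℂ} (hz : z ∈ ball (0 : ℂ) 1) :
    IsLogDerivValue f z v ↔ v = logDerivOf P w z := by
  constructor
  · rintro ⟨L, hL, hL0, hLe, rfl⟩
    refine eqOn_ball_of_deriv_eq hL (hw.differentiableOn_logDerivOf hP)
      (by rw [hL0, logDerivOf_zero]) (fun y hy => ?_) z hz
    rw [(hw.hasDerivAt_logDerivOf hP hy).deriv]
    have h1 := (hL.differentiableAt (isOpen_ball.mem_nhds hy)).hasDerivAt.cexp
    have h2 := h1.unique ((h.hasDerivAt_deriv hw hP hy).congr_of_eventuallyEq (by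
      filter_upwards [isOpen_ball.mem_nhds hy] with x hx using hLe x hx))
    have h3 := hLe y hy
    rw [(h.hasDerivAt hw hP hy).deriv] at h3
    rw [h3] at h2
    exact mul_left_cancel₀ (Complex.exp_ne_zero _) h2
  · rintro rfl
    exact ⟨logDerivOf P w, hw.differentiableOn_logDerivOf hP, logDerivOf_zero P w,
      fun ζ hζ => (h.hasDerivAt hw hP hζ).deriv.symm, rfl⟩

lemma coeff_one (P : ℂ → ℂ) : coeff P 1 = deriv P 0 := by simp [coeff]

lemma coeff_two_eq_deriv_dslope (hP : DifferentiableOn ℂ P (ball 0 1)) :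
    coeff P 2 = deriv (dslope P 0) 0 := by
  have hd := differentiableOn_dslope_zero hP
  have hat : ∀ {f : ℂ → ℂ}, DifferentiableOn ℂ f (ball 0 1) → ∀ z ∈ ball (0 : ℂ) 1,
      HasDerivAt f (deriv f z) z := fun hf z hz =>
    (hf.differentiableAt (isOpen_ball.mem_nhds hz)).hasDerivAt
  have h1 : ∀ z ∈ ball (0 : ℂ) 1, deriv P z = dslope P 0 z + z * deriv (dslope P 0) z := by
    intro z hz
    have h2 : HasDerivAt (fun z => P 0 + z * dslope P 0 z)
        (dslope P 0 z + z * deriv (dslope P 0) z) z := by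
      simpa using ((hasDerivAt_id z).fun_mul (hat hd z hz)).const_add (P 0)
    have h3 : (fun z => P 0 + z * dslope P 0 z) = P := by
      funext y
      have := sub_smul_dslope P 0 y
      rw [sub_zero, smul_eq_mul] at this
      rw [this]; ring
    rw [h3] at h2
    exact h2.deriv
  have h4 : HasDerivAt (fun z => dslope P 0 z + z * deriv (dslope P 0) z)
      (2 * deriv (dslope P 0) 0) 0 := by
    refine ((hat hd 0 zero_mem_ball).add ((hasDerivAt_id (0 : ℂ)).fun_mul
      (hat (hd.deriv isOpen_ball) 0 zero_mem_ball))).congr_deriv ?_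
    simp
    ring
  have h5 : deriv (deriv P) 0 = 2 * deriv (dslope P 0) 0 := by
    refine (h4.congr_of_eventuallyEq ?_).deriv
    filter_upwards [isOpen_ball.mem_nhds zero_mem_ball] with z hz using h1 z hz
  rw [coeff, iteratedDeriv_succ, iteratedDeriv_one, h5]
  simp

lemma IsGeneratedBy.coeff_two {f : ℂ → ℂ} (h : IsGeneratedBy P w f) (hw : IsSchur w)
    (hP : DifferentiableOn ℂ P (ball 0 1)) : coeff f 2 = coeff P 1 * w 0 / 2 := by
  rw [coeff, iteratedDeriv_succ, iteratedDeriv_one,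
    (h.hasDerivAt_deriv hw hP zero_mem_ball).deriv, logDerivOf_zero, coeff_one]
  simp [preSchwarzian]
  ring

lemma IsGeneratedBy.coeff_three {f : ℂ → ℂ} (h : IsGeneratedBy P w f) (hw : IsSchur w)
    (hP : DifferentiableOn ℂ P (ball 0 1)) :
    coeff f 3 = (coeff P 1 ^ 2 * w 0 ^ 2 + coeff P 1 * deriv w 0 + coeff P 2 * w 0 ^ 2) / 6 := by
  have hat : ∀ {f : ℂ → ℂ}, DifferentiableOn ℂ f (ball 0 1) → ∀ z ∈ ball (0 : ℂ) 1,
      HasDerivAt f (deriv f z) z := fun hf z hz =>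
    (hf.differentiableAt (isOpen_ball.mem_nhds hz)).hasDerivAt
  have h1 : HasDerivAt (fun z => z * w z) (w 0) 0 := by
    simpa using (hasDerivAt_id (0 : ℂ)).fun_mul (hat hw.1 0 zero_mem_ball)
  have h2 : HasDerivAt (dslope P 0) (deriv (dslope P 0) 0) (0 * w 0) := by
    rw [zero_mul]
    exact hat (differentiableOn_dslope_zero hP) 0 zero_mem_ball
  have h3 : HasDerivAt (preSchwarzian P w)
      (deriv w 0 * deriv P 0 + w 0 * (deriv (dslope P 0) 0 * w 0)) 0 := by
    refine ((hat hw.1 0 zero_mem_ball).mul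
      (h2.comp (h := fun z => z * w z) 0 h1)).congr_deriv ?_
    simp
  have h4 := (hw.hasDerivAt_logDerivOf hP zero_mem_ball).cexp.fun_mul h3
  have h5 : deriv (deriv (deriv f)) 0 = _ := (h4.congr_of_eventuallyEq (by
    filter_upwards [isOpen_ball.mem_nhds zero_mem_ball] with z hz using
      (h.hasDerivAt_deriv hw hP hz).deriv)).deriv
  rw [coeff, iteratedDeriv_succ, iteratedDeriv_succ, iteratedDeriv_one, h5,
    coeff_two_eq_deriv_dslope hP, coeff_one, logDerivOf_zero]
  simp [preSchwarzian, Nat.factorial]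
  ring

end


/-! ### Convexity from supporting lines -/

/-- A compact set `h(closedBall)` lying on one side of a line through each of its boundary values is
the intersection of the corresponding half-planes. -/
lemma mem_image_closedBall_of_forall {h k : ℂ → ℂ} (hd : DifferentiableOn ℂ h (ball 0 1))
    (hc : ContinuousOn h (closedBall 0 1)) (hinj : InjOn h (closedBall 0 1))
    (hpos : ∀ ε : ℂ, ‖ε‖ = 1 → 0 < ((h ε - h 0) / k ε).re) {w : ℂ}
    (hw : ∀ ε : ℂ, ‖ε‖ = 1 → 0 ≤ ((h ε - w) / k ε).re) : w ∈ h '' closedBall 0 1 := by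
  by_contra hwK
  have hK : IsCompact (h '' closedBall 0 1) := (isCompact_closedBall 0 1).image_of_continuousOn hc
  set γ : ℝ → ℂ := fun t => h 0 + t * (w - h 0) with hγ
  have hγc : Continuous γ := by fun_prop
  have hT : IsCompact (Icc (0 : ℝ) 1 ∩ γ ⁻¹' (h '' closedBall 0 1)) :=
    isCompact_Icc.inter_right (hK.isClosed.preimage hγc)
  -- The last point of the segment from h(0) to w that lies in the image. It is not the image of an
  -- interior point, by the open mapping theorem.
  obtain ⟨t, ⟨ht, htK⟩, hmax⟩ := hT.exists_isMaxOn
    ⟨0, by simp, 0, by simp, by simp [hγ]⟩ (f := fun t : ℝ => t) continuous_id.continuousOn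
  have ht1 : t < 1 := by
    refine lt_of_le_of_ne ht.2 fun h1 => hwK ?_
    rw [h1] at htK
    simpa [hγ] using htK
  obtain ⟨ε, hε, hεt⟩ := htK
  have hε1 : ‖ε‖ ≤ 1 := by simpa using hε
  rcases hε1.lt_or_eq with hlt | heq
  · have hn : h '' ball 0 1 ∈ 𝓝 (h ε) :=
      (continuousAt_of_leftInverse isOpen_ball hd
        (fun z hz => (hinj.mono ball_subset_closedBall).leftInvOn_invFunOn hz)
        (mem_ball_zero_iff.2 hlt)).2
    rw [hεt] at hn
    have h1 : ∀ᶠ s in 𝓝[>] t, γ s ∈ h '' ball 0 1 ∧ s ∈ Ioo t 1 :=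
      ((hγc.continuousAt.eventually hn).filter_mono nhdsWithin_le_nhds).and (Ioo_mem_nhdsGT ht1)
    obtain ⟨s, hs1, hs2⟩ := h1.exists
    have : s ≤ t := hmax ⟨⟨ht.1.trans hs2.1.le, hs2.2.le⟩,
      image_mono ball_subset_closedBall hs1⟩
    exact absurd hs2.1 (not_lt.2 this)
  -- The point h(ε) lies between h(0), strictly inside the half-plane at ε, and w, weakly inside, so
  -- it cannot be on the bounding line.
  · have e : (0 : ℂ) = ((1 - t : ℝ) : ℂ) * ((h ε - h 0) / k ε) + (t : ℂ) * ((h ε - w) / k ε) := by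
      rw [← mul_div_assoc, ← mul_div_assoc, ← add_div]
      have : ((1 - t : ℝ) : ℂ) * (h ε - h 0) + t * (h ε - w) = 0 := by
        rw [hεt, hγ]
        push_cast
        ring
      rw [this, zero_div]
    have e2 := congrArg Complex.re e
    rw [Complex.add_re, Complex.re_ofReal_mul, Complex.re_ofReal_mul, Complex.zero_re] at e2
    have h1 : 0 < (1 - t) * ((h ε - h 0) / k ε).re := mul_pos (by linarith) (hpos ε heq)
    have h2 : 0 ≤ t * ((h ε - w) / k ε).re := mul_nonneg ht.1 (hw ε heq)
    linarith

/-- The vector k(ε) is an outer normal at h(ε). The image of the closed disk is convex as an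
intersection of half-planes, and the image of the open disk is its interior. -/
lemma isConvexUnivalent_of_forall {h k : ℂ → ℂ} (ha : AnalyticOnNhd ℂ h (closedBall 0 1))
    (hinj : InjOn h (closedBall 0 1))
    (hpos : ∀ ε : ℂ, ‖ε‖ = 1 → ∀ ε' ∈ closedBall (0 : ℂ) 1, ε' ≠ ε →
      0 < ((h ε - h ε') / k ε).re) : IsConvexUnivalent h := by
  have hd : DifferentiableOn ℂ h (ball 0 1) := ha.differentiableOn.mono ball_subset_closedBall
  have h0 : ∀ ε : ℂ, ‖ε‖ = 1 → 0 < ((h ε - h 0) / k ε).re := fun ε hε =>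
    hpos ε hε 0 (by simp) (by rintro rfl; simp at hε)
  have hnn : ∀ ε : ℂ, ‖ε‖ = 1 → ∀ ε' ∈ closedBall (0 : ℂ) 1, 0 ≤ ((h ε - h ε') / k ε).re := by
    intro ε hε ε' hε'
    rcases eq_or_ne ε' ε with rfl | hne
    · simp
    · exact (hpos ε hε ε' hε' hne).le
  have hconv : Convex ℝ (h '' closedBall 0 1) := by
    rintro _ ⟨x, hx, rfl⟩ _ ⟨y, hy, rfl⟩ a b ha' hb hab
    refine mem_image_closedBall_of_forall hd ha.continuousOn hinj h0 fun ε hε => ?_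
    have e : (h ε - (a • h x + b • h y)) / k ε =
        (a : ℂ) * ((h ε - h x) / k ε) + (b : ℂ) * ((h ε - h y) / k ε) := by
      have : (b : ℂ) = 1 - a := by
        rw [eq_sub_iff_add_eq', ← Complex.ofReal_add, hab, Complex.ofReal_one]
      simp only [Complex.real_smul]
      rw [this]
      ring
    rw [e, Complex.add_re, Complex.re_ofReal_mul, Complex.re_ofReal_mul]
    exact add_nonneg (mul_nonneg ha' (hnn ε hε x hx)) (mul_nonneg hb (hnn ε hε y hy))
  refine ⟨ha, hinj, ?_, hconv⟩
  have hint : h '' ball 0 1 = interior (h '' closedBall 0 1) := by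
    refine Subset.antisymm (interior_maximal (image_mono ball_subset_closedBall) ?_) ?_
    · refine isOpen_iff_mem_nhds.2 ?_
      rintro _ ⟨z, hz, rfl⟩
      exact (continuousAt_of_leftInverse isOpen_ball hd
        (fun z hz => (hinj.mono ball_subset_closedBall).leftInvOn_invFunOn hz) hz).2
    · intro v hv
      obtain ⟨ε, hε, rfl⟩ := interior_subset hv
      have hε1 : ‖ε‖ ≤ 1 := by simpa using hε
      rcases hε1.lt_or_eq with hlt | heq
      · exact ⟨ε, mem_ball_zero_iff.2 hlt, rfl⟩
      · have hk : k ε ≠ 0 := fun hk => by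
          have := h0 ε heq
          simp [hk] at this
        -- A boundary value is not interior to the image: a small step along the outer normal leaves
        -- the supporting half-plane.
        have hcont : ContinuousAt (fun s : ℝ => h ε + s * k ε) 0 := by fun_prop
        have h1 : ∀ᶠ s : ℝ in 𝓝[>] 0, h ε + s * k ε ∈ h '' closedBall 0 1 := by
          refine (hcont.eventually_mem ?_).filter_mono nhdsWithin_le_nhds
          simpa using mem_interior_iff_mem_nhds.1 hv
        obtain ⟨s, ⟨ε', hε', hs⟩, hs0⟩ := (h1.and self_mem_nhdsWithin).exists
        have h2 := hnn ε heq ε' hε'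
        rw [hs, sub_add_cancel_left, neg_div, mul_div_cancel_right₀ _ hk] at h2
        have hs0' : 0 < s := hs0
        simp at h2
        linarith
  rw [hint]
  exact hconv.interior

/-- The integrand only sees ε through tzε with 0 ≤ t ≤ 1, so it stays differentiable in ε on the
open set |zε| < 1, which contains the closed disk because |z| < 1. -/
lemma analyticOnNhd_logDerivOf {P : ℂ → ℂ} (hP : DifferentiableOn ℂ P (ball 0 1)) {γ₁ γ₂ z : ℂ}
    (h₁ : ‖γ₁‖ < 1) (h₂ : ‖γ₂‖ < 1) (hz : z ∈ ball (0 : ℂ) 1) :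
    AnalyticOnNhd ℂ (fun ε => logDerivOf P (schurTower γ₁ γ₂ fun _ => ε) z) (closedBall 0 1) := by
  set U : Set ℂ := {ε | ‖z * ε‖ < 1} with hU
  have hUo : IsOpen U := isOpen_lt (by fun_prop) continuous_const
  have hsub : closedBall (0 : ℂ) 1 ⊆ U := fun ε hε =>
    norm_mul_lt_one_of_mem_ball hz (by simpa using hε)
  have hd := differentiableOn_dslope_zero hP
  have hat : ∀ {f : ℂ → ℂ}, DifferentiableOn ℂ f (ball 0 1) → ∀ z, ‖z‖ < 1 →
      HasDerivAt f (deriv f z) z := fun hf z hz =>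
    (hf.differentiableAt (isOpen_ball.mem_nhds (mem_ball_zero_iff.2 hz))).hasDerivAt
  set W : Set (ℂ × ℝ) := U ×ˢ Icc 0 1 with hW
  have hζ : ∀ p ∈ W, (p.2 : ℂ) * z ∈ ball (0 : ℂ) 1 := fun p hp => ofReal_mul_mem_ball hz hp.2
  have b1 : ∀ p ∈ W, ‖(p.2 : ℂ) * z * p.1‖ < 1 := fun p hp => by
    have h3 : ‖z * p.1‖ < 1 := hp.1
    rw [mul_assoc]
    exact mem_ball_zero_iff.1 (ofReal_mul_mem_ball (mem_ball_zero_iff.2 h3) hp.2)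
  have b2 : ∀ p ∈ W, ‖(p.2 : ℂ) * z * sigma γ₂ (p.2 * z * p.1)‖ < 1 := fun p hp =>
    norm_sigma_mul_sigma_lt h₂ (hζ p hp) (b1 p hp).le
  have b3 : ∀ p ∈ W, ‖(p.2 : ℂ) * z * sigma γ₁ (p.2 * z * sigma γ₂ (p.2 * z * p.1))‖ < 1 :=
    fun p hp => norm_sigma_mul_sigma_lt h₁ (hζ p hp) (b2 p hp).le
  have comp : ∀ {g : ℂ → ℂ} {u : ℂ × ℝ → ℂ}, DifferentiableOn ℂ g (ball 0 1) →
      ContinuousOn u W → (∀ p ∈ W, ‖u p‖ < 1) → ContinuousOn (fun p => g (u p)) W :=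
    fun hg hu h => hg.continuousOn.comp hu fun p hp => mem_ball_zero_iff.2 (h p hp)
  have hsd : ∀ {c : ℂ}, ‖c‖ < 1 → DifferentiableOn ℂ (sigmaDeriv c) (ball 0 1) := fun hc u hu =>
    (hasDerivAt_sigmaDeriv (norm_mul_norm_lt_one hc
      (mem_ball_zero_iff.1 hu).le)).differentiableAt.differentiableWithinAt
  have c0 : ContinuousOn (fun p : ℂ × ℝ => (p.2 : ℂ) * z) W := by fun_prop
  have c1 : ContinuousOn (fun p : ℂ × ℝ => (p.2 : ℂ) * z * p.1) W := by fun_prop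
  have c2 := c0.mul (comp (differentiableOn_sigma h₂) c1 b1)
  have c3 := comp (differentiableOn_sigma h₁) c2 b2
  have cG : ContinuousOn (fun p : ℂ × ℝ =>
      preSchwarzian P (schurTower γ₁ γ₂ fun _ => p.1) (p.2 * z)) W :=
    c3.mul (comp hd (c0.mul c3) b3)
  have cw : ContinuousOn (fun p : ℂ × ℝ => sigmaDeriv γ₁ (p.2 * z * sigma γ₂ (p.2 * z * p.1)) *
      (p.2 * z * (sigmaDeriv γ₂ (p.2 * z * p.1) * (p.2 * z)))) W :=
    (comp (hsd h₁) c2 b2).mul (c0.mul ((comp (hsd h₂) c1 b1).mul c0))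
  set G' : ℂ → ℝ → ℂ := fun ε t =>
    sigmaDeriv γ₁ (t * z * sigma γ₂ (t * z * ε)) * (t * z * (sigmaDeriv γ₂ (t * z * ε) * (t * z))) *
      dslope P 0 (t * z * sigma γ₁ (t * z * sigma γ₂ (t * z * ε))) +
    sigma γ₁ (t * z * sigma γ₂ (t * z * ε)) *
      (deriv (dslope P 0) (t * z * sigma γ₁ (t * z * sigma γ₂ (t * z * ε))) * (t * z *
        (sigmaDeriv γ₁ (t * z * sigma γ₂ (t * z * ε)) *
          (t * z * (sigmaDeriv γ₂ (t * z * ε) * (t * z)))))) with hG'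
  have cG' : ContinuousOn (fun p : ℂ × ℝ => G' p.1 p.2) W := (cw.mul (comp hd (c0.mul c3) b3)).add
    (c3.mul ((comp (hd.deriv isOpen_ball) (c0.mul c3) b3).mul (c0.mul cw)))
  have hdiff : DifferentiableOn ℂ
      (fun ε => logDerivOf P (schurTower γ₁ γ₂ fun _ => ε) z) U := by
    intro ε hε
    refine ((hasDerivAt_integral_of_continuousOn
      (G := fun ε (t : ℝ) => preSchwarzian P (schurTower γ₁ γ₂ fun _ => ε) (t * z)) (G' := G')
      hUo (fun w hw => cG.comp (f := fun t : ℝ => (w, t)) (by fun_prop) fun t ht => ⟨hw, ht⟩)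
      cG' (fun w hw t ht => ?_) hε).const_mul z).differentiableAt.differentiableWithinAt
    have hp : (w, t) ∈ W := ⟨hw, ht⟩
    have d1 : HasDerivAt (fun ε : ℂ => t * z * ε) (t * z) w := by
      simpa using (hasDerivAt_id w).const_mul (t * z : ℂ)
    have d2 := (hasDerivAt_sigma (norm_mul_norm_lt_one h₂ (b1 _ hp).le)).comp (h₂ := sigma γ₂)
      (h := fun ε : ℂ => t * z * ε) w d1
    have d3 := d2.const_mul (t * z : ℂ)
    have d4 := (hasDerivAt_sigma (norm_mul_norm_lt_one h₁ (b2 _ hp).le)).comp (h₂ := sigma γ₁)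
      (h := fun ε : ℂ => t * z * sigma γ₂ (t * z * ε)) w d3
    have d5 := (hat hd _ (b3 _ hp)).comp
      (h := fun ε : ℂ => t * z * sigma γ₁ (t * z * sigma γ₂ (t * z * ε))) w (d4.const_mul (t * z : ℂ))
    exact d4.mul d5
  exact (hdiff.analyticOnNhd hUo).mono hsub

section

variable {P : ℂ → ℂ} {Ω : Set ℂ} {γ₁ γ₂ z : ℂ}

lemma IsSchur.schurTower {ψ : ℂ → ℂ} (hψ : IsSchur ψ) (h₁ : ‖γ₁‖ < 1) (h₂ : ‖γ₂‖ < 1) :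
    IsSchur (schurTower γ₁ γ₂ ψ) :=
  (hψ.sigma_mul h₂).sigma_mul h₁

/-- The half-plane inequality with the parameter of larger modulus as base point and the other as a
constant ψ. Ordering two parameters by modulus then gives injectivity on the whole closed disk. -/
lemma logDerivOf_ne_of_norm_le (hP : IsConformalMap P Ω) (hΩ : Convex ℝ Ω) (hP0 : P 0 = 1)
    (h₁ : ‖γ₁‖ < 1) (h₂ : ‖γ₂‖ < 1) (hz : z ∈ ball (0 : ℂ) 1) (hz0 : z ≠ 0) {ε ε' : ℂ}
    (hε : ‖ε‖ ≤ 1) (hle : ‖ε'‖ ≤ ‖ε‖) (hne : ε' ≠ ε) :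
    logDerivOf P (schurTower γ₁ γ₂ fun _ => ε) z ≠
      logDerivOf P (schurTower γ₁ γ₂ fun _ => ε') z := by
  intro h
  have hε0 : ε ≠ 0 := by
    rintro rfl
    rw [norm_zero, norm_le_zero_iff] at hle
    exact hne hle
  have := re_logIntegral_sub_div_pos hP hΩ hP0 h₁ h₂ hε hε0 (ψ := fun _ => ε')
    (differentiableOn_const ε') (fun _ _ => hle) (fun _ _ => hne) hz hz0
  simp only [logDerivOf] at h
  rw [h, sub_self, zero_div, Complex.zero_re] at this
  exact lt_irrefl _ this

/-- For |ε| = 1 a Schur function that takes the value ε is constant by the maximum principle. The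
strict alternative is what yields uniqueness of the extremal functions. -/
lemma re_logDerivOf_sub_div_pos (hP : IsConformalMap P Ω) (hΩ : Convex ℝ Ω) (hP0 : P 0 = 1)
    (h₁ : ‖γ₁‖ < 1) (h₂ : ‖γ₂‖ < 1) (hz : z ∈ ball (0 : ℂ) 1) (hz0 : z ≠ 0) {ε : ℂ}
    (hε : ‖ε‖ = 1) {ψ : ℂ → ℂ} (hψ : IsSchur ψ) :
    (∀ ζ ∈ ball (0 : ℂ) 1, ψ ζ = ε) ∨
      0 < ((logDerivOf P (schurTower γ₁ γ₂ fun _ => ε) z - logDerivOf P (schurTower γ₁ γ₂ ψ) z) /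
        (ε * (z ^ 3 * weightedMean 2 (varKernel P γ₁ γ₂ ε) z))).re := by
  by_cases h : ∃ y ∈ ball (0 : ℂ) 1, ψ y = ε
  · obtain ⟨y, hy, rfl⟩ := h
    exact Or.inl (hψ.eq_of_norm_eq_one hy hε)
  · push Not at h
    exact Or.inr (re_logIntegral_sub_div_pos hP hΩ hP0 h₁ h₂ hε.le (by rintro rfl; simp at hε) hψ.1
      (fun ζ hζ => (hψ.2 ζ hζ).trans hε.ge) h hz hz0)

lemma isConvexUnivalent_logDerivOf (hP : IsConformalMap P Ω) (hΩ : Convex ℝ Ω) (hP0 : P 0 = 1)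
    (h₁ : ‖γ₁‖ < 1) (h₂ : ‖γ₂‖ < 1) (hz : z ∈ ball (0 : ℂ) 1) (hz0 : z ≠ 0) :
    IsConvexUnivalent (fun ε => logDerivOf P (schurTower γ₁ γ₂ fun _ => ε) z) := by
  refine isConvexUnivalent_of_forall
    (k := fun ε => ε * (z ^ 3 * weightedMean 2 (varKernel P γ₁ γ₂ ε) z))
    (analyticOnNhd_logDerivOf hP.1 h₁ h₂ hz) ?_ ?_
  · intro x hx y hy hxy
    rw [mem_closedBall_zero_iff] at hx hy
    by_contra hne
    rcases le_total ‖y‖ ‖x‖ with h | h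
    · exact logDerivOf_ne_of_norm_le hP hΩ hP0 h₁ h₂ hz hz0 hx h (Ne.symm hne) hxy
    · exact logDerivOf_ne_of_norm_le hP hΩ hP0 h₁ h₂ hz hz0 hy h hne hxy.symm
  · intro ε hε ε' hε' hne
    exact (re_logDerivOf_sub_div_pos hP hΩ hP0 h₁ h₂ hz hz0 hε
      (isSchur_const (by simpa using hε'))).resolve_left fun h => hne (h 0 zero_mem_ball)

lemma logDerivOf_mem_image (hP : IsConformalMap P Ω) (hΩ : Convex ℝ Ω) (hP0 : P 0 = 1)
    (h₁ : ‖γ₁‖ < 1) (h₂ : ‖γ₂‖ < 1) (hz : z ∈ ball (0 : ℂ) 1) (hz0 : z ≠ 0) {ψ : ℂ → ℂ}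
    (hψ : IsSchur ψ) :
    logDerivOf P (schurTower γ₁ γ₂ ψ) z ∈
      (fun ε => logDerivOf P (schurTower γ₁ γ₂ fun _ => ε) z) '' closedBall 0 1 := by
  obtain ⟨ha, hinj, -, -⟩ := isConvexUnivalent_logDerivOf hP hΩ hP0 h₁ h₂ hz hz0
  refine mem_image_closedBall_of_forall
    (k := fun ε => ε * (z ^ 3 * weightedMean 2 (varKernel P γ₁ γ₂ ε) z))
    (ha.differentiableOn.mono ball_subset_closedBall) ha.continuousOn hinj (fun ε hε => ?_)
    fun ε hε => ?_
  · exact (re_logDerivOf_sub_div_pos hP hΩ hP0 h₁ h₂ hz hz0 hε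
      (isSchur_const (c := 0) (by simp))).resolve_left fun h => by
        have := h 0 zero_mem_ball
        rw [← this] at hε
        simp at hε
  · rcases re_logDerivOf_sub_div_pos hP hΩ hP0 h₁ h₂ hz hz0 hε hψ with h | h
    · rw [logDerivOf_congr P (v := VariabilityRegion.schurTower γ₁ γ₂ ψ)
        (w := VariabilityRegion.schurTower γ₁ γ₂ fun _ => ε)
        (fun y hy => by simp only [VariabilityRegion.schurTower, h y hy]) hz]
      simp
    · exact h.le

end


/-! ### The coefficient region and the Schur parameters -/

/-- The derivative at the origin of the Schur function that corresponds to a function of `CV Ω` with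
second and third coefficients `lam` and `mu`. -/
noncomputable def schurCoeff (P : ℂ → ℂ) (lam mu : ℂ) : ℂ :=
  2 * (3 * coeff P 1 ^ 2 * mu - 2 * (coeff P 1 ^ 2 + coeff P 2) * lam ^ 2) / coeff P 1 ^ 3

section

variable {P : ℂ → ℂ} {Ω : Set ℂ} {lam mu : ℂ}

lemma IsConformalMap.coeff_one_ne_zero (hP : IsConformalMap P Ω) : coeff P 1 ≠ 0 := by
  rw [coeff_one]
  exact hP.deriv_ne_zero zero_mem_ball

lemma coeffs_eq_iff {c₀ c₁ : ℂ} (h : coeff P 1 ≠ 0) :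
    (coeff P 1 * c₀ / 2, (coeff P 1 ^ 2 * c₀ ^ 2 + coeff P 1 * c₁ + coeff P 2 * c₀ ^ 2) / 6) =
      (lam, mu) ↔ c₀ = gamma₁ P lam ∧ c₁ = schurCoeff P lam mu := by
  rw [Prod.mk.injEq, gamma₁, schurCoeff]
  constructor
  · rintro ⟨rfl, rfl⟩
    constructor
    · field_simp
    · field_simp
      ring
  · rintro ⟨rfl, rfl⟩
    constructor
    · field_simp
    · field_simp
      ring

lemma IsGeneratedBy.coeffs_eq_iff {f w : ℂ → ℂ} (hf : IsGeneratedBy P w f) (hw : IsSchur w)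
    (hP : IsConformalMap P Ω) :
    (coeff f 2, coeff f 3) = (lam, mu) ↔
      w 0 = gamma₁ P lam ∧ deriv w 0 = schurCoeff P lam mu := by
  rw [hf.coeff_two hw hP.1, hf.coeff_three hw hP.1]
  exact VariabilityRegion.coeffs_eq_iff hP.coeff_one_ne_zero

lemma mem_coeffRegion_iff (hP : IsConformalMap P Ω) (hP0 : P 0 = 1) :
    (lam, mu) ∈ coeffRegion Ω ↔ ‖gamma₁ P lam‖ ^ 2 + ‖schurCoeff P lam mu‖ ≤ 1 := by
  rw [← exists_isSchur_iff]
  constructor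
  · rintro ⟨f, hf, hc⟩
    obtain ⟨w, hw, hfw⟩ := exists_isGeneratedBy hP hP0 hf
    exact ⟨w, hw, (hfw.coeffs_eq_iff hw hP).1 hc⟩
  · rintro ⟨w, hw, h⟩
    have hf : IsGeneratedBy P w (integralTo fun ζ => Complex.exp (logDerivOf P w ζ)) :=
      fun z _ => rfl
    exact ⟨_, hf.mem_CV hw hP hP0, (hf.coeffs_eq_iff hw hP).2 h⟩

lemma mem_region_iff (hP : IsConformalMap P Ω) (hP0 : P 0 = 1) {z v : ℂ}
    (hz : z ∈ ball (0 : ℂ) 1) :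
    v ∈ region Ω z lam mu ↔ ∃ w, IsSchur w ∧ w 0 = gamma₁ P lam ∧
      deriv w 0 = schurCoeff P lam mu ∧ v = logDerivOf P w z := by
  constructor
  · rintro ⟨f, hf, hc, hv⟩
    obtain ⟨w, hw, hfw⟩ := exists_isGeneratedBy hP hP0 hf
    have h := (hfw.coeffs_eq_iff hw hP).1 hc
    exact ⟨w, hw, h.1, h.2, (hfw.isLogDerivValue_iff hw hP.1 hz).1 hv⟩
  · rintro ⟨w, hw, h₀, h₁, hv⟩
    have hf : IsGeneratedBy P w (integralTo fun ζ => Complex.exp (logDerivOf P w ζ)) :=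
      fun z _ => rfl
    exact ⟨_, hf.mem_CV hw hP hP0, (hf.coeffs_eq_iff hw hP).2 ⟨h₀, h₁⟩,
      (hf.isLogDerivValue_iff hw hP.1 hz).2 hv⟩

lemma continuous_schurNorm (P : ℂ → ℂ) :
    Continuous fun p : ℂ × ℂ => ‖gamma₁ P p.1‖ ^ 2 + ‖schurCoeff P p.1 p.2‖ := by
  unfold gamma₁ schurCoeff
  fun_prop

lemma mem_interior_coeffRegion_iff (hP : IsConformalMap P Ω) (hP0 : P 0 = 1) :
    (lam, mu) ∈ interior (coeffRegion Ω) ↔ ‖gamma₁ P lam‖ ^ 2 + ‖schurCoeff P lam mu‖ < 1 := by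
  have hα := hP.coeff_one_ne_zero
  constructor
  · intro h
    refine lt_of_le_of_ne ((mem_coeffRegion_iff hP hP0).1 (interior_subset h)) fun h1 => ?_
    set c₀ := gamma₁ P lam with hc₀
    set c₁ := schurCoeff P lam mu with hc₁
    -- The curve of coefficient pairs whose Schur data are (1 + t)(c₀, c₁). When |c₀|² + |c₁| = 1 it
    -- leaves the region for every t > 0.
    set Φ : ℝ → ℂ × ℂ := fun t => (coeff P 1 * ((1 + t : ℝ) * c₀) / 2,
      (coeff P 1 ^ 2 * ((1 + t : ℝ) * c₀) ^ 2 + coeff P 1 * ((1 + t : ℝ) * c₁) +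
        coeff P 2 * ((1 + t : ℝ) * c₀) ^ 2) / 6) with hΦ
    have hΦc : Continuous Φ := by fun_prop
    have hΦ0 : Φ 0 = (lam, mu) := by
      simp only [hΦ, add_zero, Complex.ofReal_one, one_mul]
      exact (VariabilityRegion.coeffs_eq_iff hα).2 ⟨hc₀, hc₁⟩
    have hev : ∀ᶠ t in 𝓝[>] (0 : ℝ), Φ t ∈ coeffRegion Ω := by
      refine (hΦc.continuousAt.eventually_mem ?_).filter_mono nhdsWithin_le_nhds
      rw [hΦ0]
      exact mem_interior_iff_mem_nhds.1 h
    obtain ⟨t, ht, ht0⟩ := (hev.and self_mem_nhdsWithin).exists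
    have ht0' : 0 < t := ht0
    obtain ⟨e₀, e₁⟩ := (VariabilityRegion.coeffs_eq_iff (lam := (Φ t).1) (mu := (Φ t).2) hα).1
      (show (_, _) = ((Φ t).1, (Φ t).2) from rfl)
    have h2 := (mem_coeffRegion_iff (lam := (Φ t).1) (mu := (Φ t).2) hP hP0).1 ht
    rw [← e₀, ← e₁, norm_mul, norm_mul, Complex.norm_real, Real.norm_of_nonneg (by linarith)] at h2
    nlinarith [sq_nonneg ‖c₀‖, norm_nonneg c₁, mul_nonneg (sq_nonneg t) (sq_nonneg ‖c₀‖),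
      mul_nonneg ht0'.le (sq_nonneg ‖c₀‖)]
  · intro h
    have hopen : IsOpen {p : ℂ × ℂ | ‖gamma₁ P p.1‖ ^ 2 + ‖schurCoeff P p.1 p.2‖ < 1} :=
      isOpen_lt (continuous_schurNorm P) continuous_const
    refine mem_interior.2 ⟨_, fun p hp => ?_, hopen, h⟩
    exact (mem_coeffRegion_iff (lam := p.1) (mu := p.2) hP hP0).2 (mem_ofPred_eq.mp hp).le

lemma mem_frontier_coeffRegion_iff (hP : IsConformalMap P Ω) (hP0 : P 0 = 1) :
    (lam, mu) ∈ frontier (coeffRegion Ω) ↔ ‖gamma₁ P lam‖ ^ 2 + ‖schurCoeff P lam mu‖ = 1 := by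
  have hcl : IsClosed (coeffRegion Ω) := by
    have : coeffRegion Ω = {p : ℂ × ℂ | ‖gamma₁ P p.1‖ ^ 2 + ‖schurCoeff P p.1 p.2‖ ≤ 1} := by
      ext ⟨a, b⟩
      exact mem_coeffRegion_iff hP hP0
    rw [this]
    exact isClosed_le (continuous_schurNorm P) continuous_const
  rw [hcl.frontier_eq, Set.mem_sdiff, mem_coeffRegion_iff hP hP0, mem_interior_coeffRegion_iff hP hP0,
    not_lt, le_antisymm_iff]

/-- Since |α₁|² - 4|λ|² = |α₁|² (1 - |γ₁|²), the explicit formula for γ₂ is w'(0) / (1 - |γ₁|²), the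
value at 0 of the Schur function left after one step of the algorithm. -/
lemma exists_gamma₂_eq (hα : coeff P 1 ≠ 0) (mu : ℂ) (h : ‖gamma₁ P lam‖ < 1) :
    ∃ g : ℂ, gamma₂ P lam mu = (g : OnePoint ℂ) ∧
      schurCoeff P lam mu = (1 - conj (gamma₁ P lam) * gamma₁ P lam) * g := by
  refine ⟨_, if_pos h, ?_⟩
  have h1 : ((‖coeff P 1‖ ^ 2 - 4 * ‖lam‖ ^ 2 : ℝ) : ℂ) =
      conj (coeff P 1) * coeff P 1 * (1 - conj (gamma₁ P lam) * gamma₁ P lam) := by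
    have hα' : conj (coeff P 1) ≠ 0 := (map_ne_zero _).2 hα
    push_cast
    rw [← Complex.conj_mul', ← Complex.conj_mul', gamma₁, map_div₀, map_mul, map_ofNat]
    field_simp
    ring
  have h2 := one_sub_conj_mul_self_ne_zero h
  have hα' : conj (coeff P 1) ≠ 0 := (map_ne_zero _).2 hα
  rw [h1, schurCoeff]
  generalize 1 - conj (gamma₁ P lam) * gamma₁ P lam = d at *
  field_simp

lemma gamma₂_eq_zero_iff (hα : coeff P 1 ≠ 0) (h : ‖gamma₁ P lam‖ = 1) :
    gamma₂ P lam mu = ((0 : ℂ) : OnePoint ℂ) ↔ schurCoeff P lam mu = 0 := by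
  have h1 : schurCoeff P lam mu = 0 ↔
      3 * coeff P 1 ^ 2 * mu = 2 * (coeff P 1 ^ 2 + coeff P 2) * lam ^ 2 := by
    rw [schurCoeff, div_eq_zero_iff, or_iff_left (pow_ne_zero 3 hα), mul_eq_zero,
      or_iff_right two_ne_zero, sub_eq_zero]
  rw [h1, gamma₂, if_neg (by rw [h]; exact lt_irrefl _)]
  split_ifs with h2
  · exact iff_of_true rfl h2.2
  · exact iff_of_false (OnePoint.infty_ne_coe _) fun h3 => h2 ⟨h, h3⟩

lemma norm_schurCoeff_eq {g : ℂ} (h : ‖gamma₁ P lam‖ < 1)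
    (hg : schurCoeff P lam mu = (1 - conj (gamma₁ P lam) * gamma₁ P lam) * g) :
    ‖schurCoeff P lam mu‖ = (1 - ‖gamma₁ P lam‖ ^ 2) * ‖g‖ := by
  rw [hg, norm_mul, ← ofReal_one_sub_norm_sq, Complex.norm_real,
    Real.norm_of_nonneg (by nlinarith [norm_nonneg (gamma₁ P lam)])]

lemma schurNorm_eq_one_iff (hα : coeff P 1 ≠ 0) :
    ‖gamma₁ P lam‖ ^ 2 + ‖schurCoeff P lam mu‖ = 1 ↔
      (‖gamma₁ P lam‖ = 1 ∧ gamma₂ P lam mu = ((0 : ℂ) : OnePoint ℂ)) ∨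
      (‖gamma₁ P lam‖ < 1 ∧ ∃ γ₂ : ℂ, gamma₂ P lam mu = (γ₂ : OnePoint ℂ) ∧ ‖γ₂‖ = 1) := by
  rcases lt_trichotomy ‖gamma₁ P lam‖ 1 with h | h | h
  · obtain ⟨g, hg, hs⟩ := exists_gamma₂_eq hα mu h
    have hpos : 0 < 1 - ‖gamma₁ P lam‖ ^ 2 := by nlinarith [norm_nonneg (gamma₁ P lam)]
    rw [norm_schurCoeff_eq h hs, hg]
    simp only [OnePoint.coe_eq_coe, h, h.ne, false_and, true_and, false_or, exists_eq_left']
    constructor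
    · intro h1
      have : (1 - ‖gamma₁ P lam‖ ^ 2) * (‖g‖ - 1) = 0 := by linarith
      linarith [(mul_eq_zero.1 this).resolve_left hpos.ne']
    · intro h1
      rw [h1]; ring
  · rw [h, gamma₂_eq_zero_iff hα h]
    simp
  · refine iff_of_false (fun h1 => ?_) (by rintro (⟨h1, -⟩ | ⟨h1, -⟩) <;> linarith)
    nlinarith [norm_nonneg (schurCoeff P lam mu)]

lemma schurNorm_lt_one_iff (hα : coeff P 1 ≠ 0) :
    ‖gamma₁ P lam‖ ^ 2 + ‖schurCoeff P lam mu‖ < 1 ↔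
      ‖gamma₁ P lam‖ < 1 ∧ ∃ γ₂ : ℂ, gamma₂ P lam mu = (γ₂ : OnePoint ℂ) ∧ ‖γ₂‖ < 1 := by
  rcases lt_or_ge ‖gamma₁ P lam‖ 1 with h | h
  · obtain ⟨g, hg, hs⟩ := exists_gamma₂_eq hα mu h
    have hpos : 0 < 1 - ‖gamma₁ P lam‖ ^ 2 := by nlinarith [norm_nonneg (gamma₁ P lam)]
    rw [norm_schurCoeff_eq h hs, hg]
    simp only [OnePoint.coe_eq_coe, h, true_and, exists_eq_left']
    constructor
    · intro h1
      nlinarith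
    · intro h1
      nlinarith
  · refine iff_of_false (fun h1 => ?_) fun h1 => absurd h1.1 (not_lt.2 h)
    nlinarith [norm_nonneg (schurCoeff P lam mu)]

lemma schurCoeff_eq_of_gamma₂_eq (hα : coeff P 1 ≠ 0) (h : ‖gamma₁ P lam‖ < 1) {g : ℂ}
    (hg : gamma₂ P lam mu = (g : OnePoint ℂ)) :
    schurCoeff P lam mu = (1 - conj (gamma₁ P lam) * gamma₁ P lam) * g := by
  obtain ⟨g', hg', hs⟩ := exists_gamma₂_eq hα mu h
  rw [hg', OnePoint.coe_eq_coe] at hg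
  rw [← hg, hs]

/-- The Schur functions with prescribed first two coefficients, after one Schur step. -/
lemma IsSchur.exists_of_coeffs {w : ℂ → ℂ} (hw : IsSchur w) {γ₁ γ₂ : ℂ} (h₁ : ‖γ₁‖ < 1)
    (h0 : w 0 = γ₁) (hd : deriv w 0 = (1 - conj γ₁ * γ₁) * γ₂) :
    ∃ v, IsSchur v ∧ v 0 = γ₂ ∧ ∀ z ∈ ball (0 : ℂ) 1, w z = sigma γ₁ (z * v z) := by
  obtain ⟨v, hv, he⟩ := hw.exists_eq_sigma (by rw [h0]; exact h₁)
  rw [h0] at he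
  refine ⟨v, hv, ?_, he⟩
  have := (hv.deriv_sigma_mul he).2
  rw [hd] at this
  exact (mul_left_cancel₀ (one_sub_conj_mul_self_ne_zero h₁) this).symm

lemma IsSchur.exists_eq_schurTower {w : ℂ → ℂ} (hw : IsSchur w) {γ₁ γ₂ : ℂ} (h₁ : ‖γ₁‖ < 1)
    (h₂ : ‖γ₂‖ < 1) (h0 : w 0 = γ₁) (hd : deriv w 0 = (1 - conj γ₁ * γ₁) * γ₂) :
    ∃ ψ, IsSchur ψ ∧ ∀ z ∈ ball (0 : ℂ) 1, w z = VariabilityRegion.schurTower γ₁ γ₂ ψ z := by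
  obtain ⟨v, hv, hv0, he⟩ := hw.exists_of_coeffs h₁ h0 hd
  obtain ⟨ψ, hψ, hψe⟩ := hv.exists_eq_sigma (by rw [hv0]; exact h₂)
  rw [hv0] at hψe
  exact ⟨ψ, hψ, fun z hz => by rw [he z hz, hψe z hz, VariabilityRegion.schurTower]⟩

lemma IsSchur.schurTower_coeffs {ψ : ℂ → ℂ} (hψ : IsSchur ψ) {γ₁ γ₂ : ℂ} (h₂ : ‖γ₂‖ < 1) :
    VariabilityRegion.schurTower γ₁ γ₂ ψ 0 = γ₁ ∧
      deriv (VariabilityRegion.schurTower γ₁ γ₂ ψ) 0 = (1 - conj γ₁ * γ₁) * γ₂ := by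
  have h := (hψ.sigma_mul h₂).deriv_sigma_mul (w := VariabilityRegion.schurTower γ₁ γ₂ ψ) (c := γ₁)
    fun z _ => rfl
  rwa [zero_mul, sigma_zero] at h

lemma Q_eq_logDerivOf (hP0 : P 0 = 1) (γ₁ γ₂ z ε : ℂ) :
    Q P γ₁ γ₂ z ε = logDerivOf P (schurTower γ₁ γ₂ fun _ => ε) z := by
  rw [logDerivOf, ← logIntegral_eq_integralTo hP0]
  simp only [Q, schurTower, mul_comm ε]

end

end VariabilityRegion

/-! ### The theorem -/

open VariabilityRegion in
theorem theorem2p4 (Ω : Set ℂ) (hΩ_open : IsOpen Ω) (hΩ_convex : Convex ℝ Ω)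
    (hΩ_one : (1 : ℂ) ∈ Ω) (P : ℂ → ℂ) (hP : IsConformalMap P Ω) (hP_zero : P 0 = 1)
    (lam mu z₀ : ℂ) (hz₀_mem : z₀ ∈ ball (0 : ℂ) 1) (hz₀_ne : z₀ ≠ 0) :
    -- the two boundary cases and the interior case of the coefficient region
    ((lam, mu) ∈ frontier (coeffRegion Ω) ↔
      (‖gamma₁ P lam‖ = 1 ∧ gamma₂ P lam mu = ((0 : ℂ) : OnePoint ℂ)) ∨
      (‖gamma₁ P lam‖ < 1 ∧ ∃ γ₂ : ℂ, gamma₂ P lam mu = (γ₂ : OnePoint ℂ) ∧ ‖γ₂‖ = 1)) ∧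
    ((lam, mu) ∈ interior (coeffRegion Ω) ↔
      ‖gamma₁ P lam‖ < 1 ∧ ∃ γ₂ : ℂ, gamma₂ P lam mu = (γ₂ : OnePoint ℂ) ∧ ‖γ₂‖ < 1) ∧
    -- (i)
    (‖gamma₁ P lam‖ = 1 → gamma₂ P lam mu = ((0 : ℂ) : OnePoint ℂ) →
      region Ω z₀ lam mu = {logIntegral P (fun ζ => gamma₁ P lam * ζ) z₀}) ∧
    -- (ii)
    (∀ γ₂ : ℂ, gamma₂ P lam mu = (γ₂ : OnePoint ℂ) → ‖gamma₁ P lam‖ < 1 → ‖γ₂‖ = 1 →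
      region Ω z₀ lam mu =
        {logIntegral P (fun ζ => ζ * sigma (gamma₁ P lam) (γ₂ * ζ)) z₀}) ∧
    -- (iii)
    (∀ γ₂ : ℂ, gamma₂ P lam mu = (γ₂ : OnePoint ℂ) → ‖gamma₁ P lam‖ < 1 → ‖γ₂‖ < 1 →
      IsConvexUnivalent (fun ε => Q P (gamma₁ P lam) γ₂ z₀ ε) ∧
      region Ω z₀ lam mu =
        (fun ε => Q P (gamma₁ P lam) γ₂ z₀ ε) '' closedBall (0 : ℂ) 1 ∧
      ∀ ε : ℂ, ‖ε‖ = 1 → ∀ f : ℂ → ℂ,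
        ((f ∈ CV Ω ∧ (coeff f 2, coeff f 3) = (lam, mu) ∧
            IsLogDerivValue f z₀ (Q P (gamma₁ P lam) γ₂ z₀ ε)) ↔
          ∀ z ∈ ball (0 : ℂ) 1,
            f z = integralTo (fun ζ₁ => Complex.exp (Q P (gamma₁ P lam) γ₂ ζ₁ ε)) z)) := by
  have hα := hP.coeff_one_ne_zero
  refine ⟨?_, ?_, ?_, ?_, ?_⟩
  · rw [mem_frontier_coeffRegion_iff hP hP_zero, schurNorm_eq_one_iff hα]
  · rw [mem_interior_coeffRegion_iff hP hP_zero, schurNorm_lt_one_iff hα]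
  · intro h h₂
    have hc := (gamma₂_eq_zero_iff hα h).1 h₂
    have he : logIntegral P (fun ζ => gamma₁ P lam * ζ) z₀ =
        logDerivOf P (fun _ => gamma₁ P lam) z₀ := by
      rw [logDerivOf, ← logIntegral_eq_integralTo hP_zero]
      simp only [mul_comm (gamma₁ P lam)]
    rw [he]
    ext v
    rw [mem_region_iff hP hP_zero hz₀_mem, mem_singleton_iff]
    constructor
    · rintro ⟨w, hw, h0, -, rfl⟩
      exact logDerivOf_congr P (fun z hz => (hw.eq_of_norm_eq_one zero_mem_ball
        (by rw [h0, h]) z hz).trans h0) hz₀_mem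
    · rintro rfl
      exact ⟨_, isSchur_const h.le, rfl, by simp [hc], rfl⟩
  · intro γ₂ hγ₂ h₁ h₂
    have hc := schurCoeff_eq_of_gamma₂_eq hα h₁ hγ₂
    have he : logIntegral P (fun ζ => ζ * sigma (gamma₁ P lam) (γ₂ * ζ)) z₀ =
        logDerivOf P (fun ζ => sigma (gamma₁ P lam) (ζ * γ₂)) z₀ := by
      rw [logDerivOf, ← logIntegral_eq_integralTo hP_zero]
      simp only [mul_comm γ₂]
    rw [he]
    ext v
    rw [mem_region_iff hP hP_zero hz₀_mem, mem_singleton_iff]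
    constructor
    · rintro ⟨w, hw, h0, hd, rfl⟩
      rw [hc] at hd
      obtain ⟨v, hv, hv0, hve⟩ := hw.exists_of_coeffs h₁ h0 hd
      refine logDerivOf_congr P (fun z hz => ?_) hz₀_mem
      rw [hve z hz, hv.eq_of_norm_eq_one zero_mem_ball (by rw [hv0, h₂]) z hz, hv0]
    · rintro rfl
      have hv := isSchur_const h₂.le
      obtain ⟨h0, hd⟩ := hv.deriv_sigma_mul (c := gamma₁ P lam) fun _ _ => rfl
      exact ⟨_, hv.sigma_mul h₁, h0, by rw [hd, hc], rfl⟩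
  · intro γ₂ hγ₂ h₁ h₂
    have hc := schurCoeff_eq_of_gamma₂_eq hα h₁ hγ₂
    simp only [Q_eq_logDerivOf hP_zero]
    refine ⟨isConvexUnivalent_logDerivOf hP hΩ_convex hP_zero h₁ h₂ hz₀_mem hz₀_ne, ?_, ?_⟩
    · ext v
      rw [mem_region_iff hP hP_zero hz₀_mem]
      constructor
      · rintro ⟨w, hw, h0, hd, rfl⟩
        obtain ⟨ψ, hψ, he⟩ := hw.exists_eq_schurTower h₁ h₂ h0 (hd.trans hc)
        rw [logDerivOf_congr P he hz₀_mem]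
        exact logDerivOf_mem_image hP hΩ_convex hP_zero h₁ h₂ hz₀_mem hz₀_ne hψ
      · rintro ⟨ε, hε, rfl⟩
        have hψ : IsSchur fun _ => ε := isSchur_const (by simpa using hε)
        exact ⟨_, hψ.schurTower h₁ h₂, (hψ.schurTower_coeffs h₂).1,
          by rw [(hψ.schurTower_coeffs h₂).2, hc], rfl⟩
    · intro ε hε f
      have hψ : IsSchur fun _ => ε := isSchur_const hε.le
      constructor
      · rintro ⟨hf, hcf, hL⟩
        obtain ⟨w, hw, hfw⟩ := exists_isGeneratedBy hP hP_zero hf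
        obtain ⟨h0, hd⟩ := (hfw.coeffs_eq_iff hw hP).1 hcf
        have hv := (hfw.isLogDerivValue_iff hw hP.1 hz₀_mem).1 hL
        obtain ⟨φ, hφ, he⟩ := hw.exists_eq_schurTower h₁ h₂ h0 (hd.trans hc)
        rw [logDerivOf_congr P he hz₀_mem] at hv
        -- Equality of the values at z₀ makes the quotient zero, which excludes the strict
        -- alternative, so the remaining Schur function is identically ε.
        have hφε := (re_logDerivOf_sub_div_pos hP hΩ_convex hP_zero h₁ h₂ hz₀_mem hz₀_ne hε
          hφ).resolve_right (by rw [hv]; simp)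
        intro z hz
        rw [hfw z hz]
        refine integralTo_congr_ball (fun y hy => ?_) hz
        rw [logDerivOf_congr P (fun x hx => (he x hx).trans ?_) hy]
        simp only [schurTower, hφε x hx]
      · intro hf
        have hfw : IsGeneratedBy P (schurTower (gamma₁ P lam) γ₂ fun _ => ε) f := hf
        have hw := hψ.schurTower h₁ h₂
        have hco := hψ.schurTower_coeffs (γ₁ := gamma₁ P lam) h₂
        exact ⟨hfw.mem_CV hw hP hP_zero, (hfw.coeffs_eq_iff hw hP).2 ⟨hco.1, hco.2.trans hc.symm⟩,
          (hfw.isLogDerivValue_iff hw hP.1 hz₀_mem).2 rfl⟩
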